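/- A \emph{blind $m$-tape non-deterministic Turing machine} ($m\ge 1$) consists of a finite alphabet $\Sigma$ containing a blank symbol, a finite set $Q$ of states with an initial state and a set of accepting states, and a finite set of transitions $\Delta \subseteq \underline\Sigma^m \times Q \times \underline\Sigma^m \times Q \times \{-1,0,1\}^m$, where $\underline\Sigma=\Sigma\cup\{\_\}$ and $\_$ is a neutral symbol not in $\Sigma$. The transition $\langle a_1,\dots,a_m,q,b_1,\dots,b_m,q',d_1,\dots,d_m\rangle$ can be applied in state $q$ if for every tape $t$ either $a_t=\_$ or $a_t$ is the symbol under the head of tape $t$; it then writes $b_t$ on tape $t$ (and keeps the symbol if $b_t=\_$), moves the head of tape $t$ by $d_t$, and changes the state to $q'$. The tapes are infinite in both directions; initially the input word $w\in\Sigma^*$ is written on the first tape starting at cell $0$, all other cells are blank, and all heads are at cell $0$. \emph{Short Blind Multi-Tape Non-Deterministic Turing Machine Computation} is the following parameterized problem. Input: a blind multi-tape non-deterministic Turing machine $M$ (the number $m$ of tapes is part of the input), a word $w$ on its alphabet, and an integer $k\ge 0$. Parameter: $k$. Question: is there a computation of $M$ on $w$ that reaches an accepting state in at most $k$ steps? An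 \emph{fpt-reduction} from a parameterized problem $A$ to a parameterized problem $B$ is an algorithm that maps every instance $(x,k)$ of $A$ to an instance $(y,l)$ of $B$ such that $(x,k)$ is a yes-instance of $A$ if and only if $(y,l)$ is a yes-instance of $B$, that $l\le g(k)$, and that the running time is at most $f(k)\cdot|(x,k)|^{c}$, for some computable functions $f,g:\mathbb N\to\mathbb N$ and some constant $c$. For a Boolean circuit with NOT gates and AND and OR gates of arbitrary fan-in, the \emph{depth} is the maximum number of gates, and the \emph{weft} the maximum number of gates of fan-in greater than $2$, on a path from an input to the output. A parameterized problem belongs to $\mathrm W[2]$ if for some constant $h$ it has an fpt-reduction to the problem of deciding, given a Boolean circuit of weft at most $2$ and depth at most $h$ and the parameter $k$, whether the circuit accepts some input vector of Hamming weight exactly $k$. A problem is $\mathrm W[2]$-hard if every problem in $\mathrm W[2]$ has an fpt-reduction to it, and $\mathrm W[2]$-complete if moreover it belongs to $\mathrm W[2]$. \textbf{Theorem.} Short Blind Multi-Tape Non-Deterministic Turing Machine Computation is $\mathrm W[2]$-complete. -/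

import Mathlib

namespace ParamW

/-! ### Data, programs and running time

The model of computation is the one-variable WHILE language over binary trees (pure LISP with the
single atom `nil`), written as a language of unary functions on trees, with one time unit for every
operation. It is deterministic, and polynomially equivalent to Turing machines. -/

/-- Binary trees with one atom, the data of programs. -/
inductive Val : Type
  | nil : Val
  | cons : Val → Val → Val

/-- The number of nodes of a tree; the size of an encoded input or output. -/
def Val.size : Val → ℕ
  | .nil => 1
  | .cons a b => a.size + b.size + 1

/-- First component (`nil` for the atom). -/
def Val.hd : Val → Val
  | .nil => .nil
  | .cons a _ => a

/-- Second component (`nil` for the atom). -/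
def Val.tl : Val → Val
  | .nil => .nil
  | .cons _ b => b

/-- Programs. `nil` counts as false and every other tree as true in `ite` and `loop`. -/
inductive Prog : Type
  /-- return the input -/
  | id : Prog
  /-- return the atom -/
  | nil : Prog
  /-- first component of the input -/
  | hd : Prog
  /-- second component of the input -/
  | tl : Prog
  /-- run both programs on the input and pair the results -/
  | cons : Prog → Prog → Prog
  /-- `seq f g`: run `f`, then run `g` on the result -/
  | seq : Prog → Prog → Prog
  /-- `ite c f g`: run `f` or `g` on the input, according to the result of `c` on it -/
  | ite : Prog → Prog → Prog → Prog
  /-- `loop c f`: while `c` returns true on the current value, replace this value by the result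
  of `f` on it -/
  | loop : Prog → Prog → Prog

/-- `Runs p v w t`: the program `p` on input `v` halts with output `w` after exactly `t` steps. -/
inductive Runs : Prog → Val → Val → ℕ → Prop
  | id (v : Val) : Runs .id v v 1
  | nil (v : Val) : Runs .nil v .nil 1
  | hd (v : Val) : Runs .hd v v.hd 1
  | tl (v : Val) : Runs .tl v v.tl 1
  | cons {f g : Prog} {v a b : Val} {s t : ℕ} :
      Runs f v a s → Runs g v b t → Runs (.cons f g) v (.cons a b) (s + t + 1)
  | seq {f g : Prog} {v a b : Val} {s t : ℕ} :
      Runs f v a s → Runs g a b t → Runs (.seq f g) v b (s + t + 1)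
  | ite_true {c f g : Prog} {v d a : Val} {s t : ℕ} :
      Runs c v d s → d ≠ .nil → Runs f v a t → Runs (.ite c f g) v a (s + t + 1)
  | ite_false {c f g : Prog} {v a : Val} {s t : ℕ} :
      Runs c v .nil s → Runs g v a t → Runs (.ite c f g) v a (s + t + 1)
  | loop_done {c f : Prog} {v : Val} {s : ℕ} :
      Runs c v .nil s → Runs (.loop c f) v v (s + 1)
  | loop_step {c f : Prog} {v d v' w : Val} {s t u : ℕ} :
      Runs c v d s → d ≠ .nil → Runs f v v' t → Runs (.loop c f) v' w u →
        Runs (.loop c f) v w (s + t + u + 1)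

/-! ### Encodings of finite objects as trees -/

/-- An injective encoding of a type by trees. -/
class TreeEnc (α : Type) where
  enc : α → Val
  inj : Function.Injective enc

/-- Natural numbers are written in unary. -/
def encNat : ℕ → Val
  | 0 => .nil
  | n + 1 => .cons .nil (encNat n)

theorem encNat_injective : Function.Injective encNat := by
  intro a
  induction a with
  | zero => intro b h; cases b <;> simp_all [encNat]
  | succ a ih =>
    intro b h
    cases b with
    | zero => simp [encNat] at h
    | succ b => simp only [encNat, Val.cons.injEq, true_and] at h; rw [ih h]

/-- Lists are written as right-nested pairs ending in `nil`. -/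
def encList {α : Type} (e : α → Val) : List α → Val
  | [] => .nil
  | a :: l => .cons (e a) (encList e l)

theorem encList_injective {α : Type} {e : α → Val} (he : Function.Injective e) :
    Function.Injective (encList e) := by
  intro a
  induction a with
  | nil => intro b h; cases b <;> simp_all [encList]
  | cons x a ih =>
    intro b h
    cases b with
    | nil => simp [encList] at h
    | cons y b =>
      simp only [encList, Val.cons.injEq] at h
      rw [he h.1, ih h.2]

instance : TreeEnc ℕ := ⟨encNat, encNat_injective⟩

instance (n : ℕ) : TreeEnc (Fin n) :=
  ⟨fun i => encNat i, fun _ _ h => Fin.ext (encNat_injective h)⟩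

instance : TreeEnc Bool :=
  ⟨fun b => if b then .cons .nil .nil else .nil, by intro a b; cases a <;> cases b <;> simp⟩

/-- Head movements `0`, `1`, `-1` are written as the numbers `0`, `1`, `2`. -/
instance : TreeEnc SignType :=
  ⟨fun d => match d with
    | .zero => encNat 0
    | .pos => encNat 1
    | .neg => encNat 2, by intro a b; cases a <;> cases b <;> simp [encNat]⟩

instance {α : Type} [TreeEnc α] : TreeEnc (Option α) :=
  ⟨fun o => match o with
    | none => .nil
    | some a => .cons .nil (TreeEnc.enc a), by
      intro a b h
      cases a <;> cases b <;> simp at h ⊢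
      exact TreeEnc.inj h⟩

instance {α β : Type} [TreeEnc α] [TreeEnc β] : TreeEnc (α × β) :=
  ⟨fun p => .cons (TreeEnc.enc p.1) (TreeEnc.enc p.2), by
    intro a b h
    simp only [Val.cons.injEq] at h
    exact Prod.ext (TreeEnc.inj h.1) (TreeEnc.inj h.2)⟩

instance {α : Type} [TreeEnc α] : TreeEnc (List α) :=
  ⟨encList TreeEnc.enc, encList_injective TreeEnc.inj⟩

/-- A tuple is written as the list of its entries. -/
instance {α : Type} [TreeEnc α] (n : ℕ) : TreeEnc (Fin n → α) :=
  ⟨fun f => TreeEnc.enc (List.ofFn f), fun _ _ h => List.ofFn_injective (TreeEnc.inj h)⟩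

/-! ### Parameterized problems and fpt-reductions -/

/-- A parameterized problem: a set of pairs (instance, parameter), where the instances are finite
objects given by an encoding. -/
structure ParamProblem where
  Inst : Type
  [code : TreeEnc Inst]
  Yes : Inst → ℕ → Prop

/-- The input tree of a program that is run on the instance `x` with parameter `k`. -/
def ParamProblem.input (A : ParamProblem) (x : A.Inst) (k : ℕ) : Val :=
  .cons (A.code.enc x) (encNat k)

/-- Parameterized many-one reducibility: a program maps `(x, k)` to an equivalent `(y, l)` with
`l ≤ g k`, in time `f k * |(x, k)| ^ c`, for computable `f` and `g` and a constant `c`. Trees may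
share subtrees in memory, so that a tree can be larger than the number of steps that built it;
therefore the size of the written output is counted as well. -/
def FPTReducible (A B : ParamProblem) : Prop :=
  ∃ (p : Prog) (f g : ℕ → ℕ) (c : ℕ), Computable f ∧ Computable g ∧
    ∀ (x : A.Inst) (k : ℕ), ∃ (y : B.Inst) (l t : ℕ),
      Runs p (A.input x k) (B.input y l) t ∧
      t + (B.input y l).size ≤ f k * (A.input x k).size ^ c ∧
      l ≤ g k ∧
      (A.Yes x k ↔ B.Yes y l)

/-! ### Boolean circuits, weft, and the W-hierarchy -/

/-- A gate, with the numbers of the wires that enter it. -/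
inductive Gate : Type
  | not : ℕ → Gate
  | and : List ℕ → Gate
  | or : List ℕ → Gate

/-- The wires that enter a gate. -/
def Gate.args : Gate → List ℕ
  | .not a => [a]
  | .and l => l
  | .or l => l

/-- The Boolean operation of a gate, where `v` gives the values of the wires. -/
def Gate.eval (v : ℕ → Bool) : Gate → Bool
  | .not a => !(v a)
  | .and l => l.all v
  | .or l => l.any v

/-- A gate is large if its fan-in exceeds two. -/
def Gate.isLarge (g : Gate) : Bool := decide (2 < g.args.length)

instance : TreeEnc Gate :=
  ⟨fun g => match g with
    | .not a => TreeEnc.enc ((0 : ℕ), [a])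
    | .and l => TreeEnc.enc ((1 : ℕ), l)
    | .or l => TreeEnc.enc ((2 : ℕ), l), by
      intro a b h
      cases a <;> cases b <;> have h' := TreeEnc.inj h <;> simp at h' ⊢ <;> exact h'⟩

/-- A Boolean circuit (an acyclic network of gates of arbitrary fan-out), with its gates in
topological order: the wires `0, …, inputs - 1` are the inputs, the wire `inputs + i` leaves
the gate number `i`, and a gate only uses earlier wires. -/
structure Circuit where
  inputs : ℕ
  gates : List Gate
  output : ℕ
  acyclic : ∀ (i : ℕ) (hi : i < gates.length), ∀ a ∈ gates[i].args, a < inputs + i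
  output_lt : output < inputs + gates.length

instance : TreeEnc Circuit :=
  ⟨fun C => TreeEnc.enc (C.inputs, C.gates, C.output), by
    rintro ⟨n, gs, o, _, _⟩ ⟨n', gs', o', _, _⟩ h
    have h' := TreeEnc.inj h
    simp only [Prod.mk.injEq] at h'
    obtain ⟨rfl, rfl, rfl⟩ := h'
    rfl⟩

/-- Values of all wires, computed gate by gate: `init` lists the values of the inputs, and a gate
`g` adds `op g v`, where `v` gives the values of the earlier wires. -/
def wireValues {α : Type} (dflt : α) (op : Gate → (ℕ → α) → α) (init : List α)
    (gates : List Gate) : List α :=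
  gates.foldl (fun vs g => vs ++ [op g (fun i => vs.getD i dflt)]) init

/-- The output of the circuit on the input vector `x`. -/
def Circuit.eval (C : Circuit) (x : Fin C.inputs → Bool) : Bool :=
  (wireValues false (fun g v => g.eval v) (List.ofFn x) C.gates).getD C.output false

/-- The maximum of `v` over a list (`0` for the empty list). -/
def maxOver (v : ℕ → ℕ) (l : List ℕ) : ℕ := l.foldr (fun a m => max (v a) m) 0

/-- The maximal number of gates on a path that ends in the output. -/
def Circuit.depth (C : Circuit) : ℕ :=
  (wireValues 0 (fun g v => maxOver v g.args + 1) (List.replicate C.inputs 0) C.gates).getD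
    C.output 0

/-- The maximal number of large gates on a path that ends in the output. -/
def Circuit.weft (C : Circuit) : ℕ :=
  (wireValues 0 (fun g v => maxOver v g.args + (if g.isLarge then 1 else 0))
    (List.replicate C.inputs 0) C.gates).getD C.output 0

instance (t h : ℕ) : TreeEnc {C : Circuit // C.weft ≤ t ∧ C.depth ≤ h} :=
  ⟨fun C => TreeEnc.enc C.1, fun _ _ e => Subtype.ext (TreeEnc.inj e)⟩

/-- Weighted satisfiability of circuits of weft at most `t` and depth at most `h`: does the
circuit accept an input vector with exactly `k` entries equal to true, where `k` is the
parameter? -/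
def WeightedCircuitSat (t h : ℕ) : ParamProblem where
  Inst := {C : Circuit // C.weft ≤ t ∧ C.depth ≤ h}
  Yes C k := ∃ x : Fin C.1.inputs → Bool,
    (Finset.univ.filter fun i => x i = true).card = k ∧ C.1.eval x = true

/-- The class `W[t]`: reducibility to weighted satisfiability of circuits of weft at most `t` and
depth at most some constant. -/
def InW (t : ℕ) (A : ParamProblem) : Prop :=
  ∃ h : ℕ, FPTReducible A (WeightedCircuitSat t h)

/-- Hardness for `W[t]`. -/
def WHard (t : ℕ) (B : ParamProblem) : Prop :=
  ∀ A : ParamProblem, InW t A → FPTReducible A B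

/-- Completeness for `W[t]`. -/
def WComplete (t : ℕ) (B : ParamProblem) : Prop := InW t B ∧ WHard t B

/-! ### Blind multi-tape non-deterministic Turing machines -/

/-- A transition of a blind machine with `m` tapes, `s` symbols and `q` states. The neutral symbol
is `none`: as an entry of `read` it matches every symbol, as an entry of `write` it keeps the
symbol. -/
structure Transition (m s q : ℕ) where
  read : Fin m → Option (Fin s)
  src : Fin q
  write : Fin m → Option (Fin s)
  tgt : Fin q
  move : Fin m → SignType

instance (m s q : ℕ) : TreeEnc (Transition m s q) :=
  ⟨fun δ => TreeEnc.enc (δ.read, δ.src, δ.write, δ.tgt, δ.move), by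
    rintro ⟨a, b, c, d, e⟩ ⟨a', b', c', d', e'⟩ h
    have h' := TreeEnc.inj h
    simp only [Prod.mk.injEq] at h'
    obtain ⟨rfl, rfl, rfl, rfl, rfl⟩ := h'
    rfl⟩

/-- A blind multi-tape non-deterministic Turing machine, whose transition relation is given as a
list. -/
structure BlindNTM where
  tapes : ℕ
  symbols : ℕ
  states : ℕ
  tapes_pos : 0 < tapes
  blank : Fin symbols
  start : Fin states
  accepting : Fin states → Bool
  delta : List (Transition tapes symbols states)

namespace BlindNTM

/-- A configuration: the state, the positions of the heads, and the contents of the two-way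
infinite tapes. -/
structure Config (M : BlindNTM) where
  state : Fin M.states
  head : Fin M.tapes → ℤ
  cell : Fin M.tapes → ℤ → Fin M.symbols

/-- The initial configuration: the word stands on the first tape, from cell `0` on, all other cells
are blank, and all heads are at cell `0`. -/
def init (M : BlindNTM) (w : List (Fin M.symbols)) : M.Config where
  state := M.start
  head _ := 0
  cell t l := if t.val = 0 ∧ 0 ≤ l then w.getD l.toNat M.blank else M.blank

/-- The state is right, and every tape on which the transition is not neutral shows the symbol to
be read. -/
def Applicable (M : BlindNTM) (δ : Transition M.tapes M.symbols M.states) (c : M.Config) : Prop :=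
  c.state = δ.src ∧ ∀ t, δ.read t = none ∨ δ.read t = some (c.cell t (c.head t))

/-- Write (or keep) the symbols under the heads, then move the heads and change the state. -/
def apply (M : BlindNTM) (δ : Transition M.tapes M.symbols M.states) (c : M.Config) :
    M.Config where
  state := δ.tgt
  head t := c.head t + (δ.move t : ℤ)
  cell t := Function.update (c.cell t) (c.head t) ((δ.write t).getD (c.cell t (c.head t)))

/-- One step of the machine. -/
def Step (M : BlindNTM) (c c' : M.Config) : Prop :=
  ∃ δ ∈ M.delta, M.Applicable δ c ∧ c' = M.apply δ c

/-- `M.Reach n c c'`: some computation of exactly `n` steps leads from `c` to `c'`. -/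
inductive Reach (M : BlindNTM) : ℕ → M.Config → M.Config → Prop
  | refl (c : M.Config) : Reach M 0 c c
  | step {n : ℕ} {c c' c'' : M.Config} : M.Step c c' → Reach M n c' c'' → Reach M (n + 1) c c''

/-- Some computation of `M` on `w` reaches an accepting state in at most `k` steps. -/
def AcceptsWithin (M : BlindNTM) (w : List (Fin M.symbols)) (k : ℕ) : Prop :=
  ∃ n ≤ k, ∃ c : M.Config, M.Reach n (M.init w) c ∧ M.accepting c.state = true

end BlindNTM

/-- A machine with an input word. -/
structure BlindInstance where
  machine : BlindNTM
  word : List (Fin machine.symbols)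

instance : TreeEnc BlindInstance :=
  ⟨fun I => .cons
      (TreeEnc.enc (I.machine.tapes, I.machine.symbols, I.machine.states))
      (TreeEnc.enc (I.machine.blank, I.machine.start, I.machine.accepting, I.machine.delta,
        I.word)), by
    rintro ⟨⟨m, s, q, _, b, i, a, d⟩, w⟩ ⟨⟨m', s', q', _, b', i', a', d'⟩, w'⟩ h
    simp only [Val.cons.injEq] at h
    obtain ⟨h1, h2⟩ := h
    have h1' := TreeEnc.inj h1
    simp only [Prod.mk.injEq] at h1'
    obtain ⟨rfl, rfl, rfl⟩ := h1'
    have h2' := TreeEnc.inj h2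
    simp only [Prod.mk.injEq] at h2'
    obtain ⟨rfl, rfl, rfl, rfl, rfl⟩ := h2'
    rfl⟩

/-- Short Blind Multi-Tape Non-Deterministic Turing Machine Computation, parameterized by the
number of steps. -/
def ShortBlindMultiTapeNTM : ParamProblem where
  Inst := BlindInstance
  Yes I k := I.machine.AcceptsWithin I.word k

end ParamW

/-!
Both reductions go through a hitting set problem, in which one option is chosen for each of finitely
many slots and every clause has to be hit by a chosen option; the number of slots is the parameter.

*Membership.* Pad a computation by idle transitions and let the slot `i` choose the transition at
time `i`. Blindness makes the acceptance condition local: that a transition reads the right symbol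
is a condition on the last earlier write to the same cell, and whether two times address the same
cell of a tape depends only on the moves on that tape. There are `3 ^ k` sequences of such moves,
so there is a clause for each of them, which is hit by any transition that moves otherwise. A
hitting set instance is a conjunction of positive disjunctions, and thus a circuit of weft two.

*Hardness.* Merging the gates of one kind and multiplying out the small ones brings a circuit of
weft two and bounded depth into a form with four levels: a disjunction of conjunctions of
disjunctions of conjunctions, where the innermost conjunctions have bounded length. An input vector
of weight `k` is a chain of `k + 2` positions. Since positive and negative literals alike are
witnessed by one gap of the chain, a bounded conjunction of literals is witnessed by boundedly many
gaps, so that it is decided by a single slot. A blind machine solves a hitting set instance by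
marking, on one tape per clause, the clauses that are hit, all of them in one step for each slot,
and reading all tapes at once in the end.
-/

namespace ParamW

open TreeEnc

instance : TreeEnc Unit := ⟨fun _ => .nil, fun _ _ _ => rfl⟩

instance {α β : Type} [TreeEnc α] [TreeEnc β] : TreeEnc (α ⊕ β) :=
  ⟨fun x => match x with
    | .inl a => .cons .nil (enc a)
    | .inr b => .cons (.cons .nil .nil) (enc b), by
      intro x y h
      cases x <;> cases y <;>
        simp only [Val.cons.injEq, reduceCtorEq, true_and, false_and] at h <;>
        rw [TreeEnc.inj h]⟩

/-! ### Polynomial bounds in the size of an encoding -/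

section EncSize

variable {α β : Type} [TreeEnc α] [TreeEnc β]

theorem Val.size_pos (v : Val) : 0 < v.size := by
  cases v <;> simp [Val.size]

/-- The size of the encoding of an object, which measures inputs and outputs of programs. -/
def encSize (a : α) : ℕ := (enc a).size

theorem encSize_pos (a : α) : 0 < encSize a := Val.size_pos _

theorem encSize_pair (a : α) (b : β) : encSize (a, b) = encSize a + encSize b + 1 := rfl

theorem encSize_inl (a : α) : encSize (Sum.inl a : α ⊕ β) = 1 + encSize a + 1 := rfl

theorem encSize_inr (b : β) : encSize (Sum.inr b : α ⊕ β) = 3 + encSize b + 1 := rfl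

theorem encSize_bool_le (b : Bool) : encSize b ≤ 3 := by
  cases b <;> simp [encSize, enc, Val.size]

theorem encSize_nat (n : ℕ) : encSize n = 2 * n + 1 := by
  induction n with
  | zero => rfl
  | succ n ih =>
    have h : encSize (n + 1) = 1 + encSize n + 1 := rfl
    omega

theorem encSize_nil : encSize ([] : List α) = 1 := rfl

theorem encSize_cons (a : α) (l : List α) : encSize (a :: l) = encSize a + encSize l + 1 := rfl

theorem encSize_append (l l' : List α) : encSize (l ++ l') + 1 = encSize l + encSize l' := by
  induction l with
  | nil => rw [List.nil_append, encSize_nil, add_comm]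
  | cons a l ih => rw [List.cons_append, encSize_cons, encSize_cons]; omega

theorem encSize_reverse (l : List α) : encSize l.reverse = encSize l := by
  induction l with
  | nil => rfl
  | cons a l ih =>
    have h := encSize_append l.reverse [a]
    rw [List.reverse_cons, encSize_cons]
    rw [encSize_cons, encSize_nil] at h
    omega

theorem encSize_lt_of_mem {l : List α} {a : α} (h : a ∈ l) : encSize a < encSize l := by
  obtain ⟨l₁, l₂, rfl⟩ := List.mem_iff_append.1 h
  have h₁ := encSize_append l₁ (a :: l₂)
  have := encSize_pos l₁
  have := encSize_pos l₂
  rw [encSize_cons] at h₁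
  omega

theorem length_lt_encSize (l : List α) : l.length < encSize l := by
  induction l with
  | nil => exact Nat.one_pos
  | cons a l ih => rw [encSize_cons, List.length_cons]; have := encSize_pos a; omega

theorem encSize_le_of_isPrefix {l l' : List α} (h : l' <+: l) : encSize l' ≤ encSize l := by
  obtain ⟨m, rfl⟩ := h
  have := encSize_append l' m
  have := encSize_pos m
  omega

theorem encSize_le_of_suffix {l l' : List α} (h : l' <:+ l) : encSize l' ≤ encSize l := by
  obtain ⟨m, rfl⟩ := h
  have := encSize_append m l'
  have := encSize_pos m
  omega

theorem encSize_list_le (l : List α) {B : ℕ} (h : ∀ a ∈ l, encSize a ≤ B) :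
    encSize l ≤ l.length * (B + 1) + 1 := by
  induction l with
  | nil => exact Nat.le_add_left _ _
  | cons a l ih =>
    obtain ⟨ha, hl⟩ := List.forall_mem_cons.1 h
    have := ih hl
    rw [encSize_cons, List.length_cons, Nat.succ_mul]
    omega

theorem encSize_flatten_le (l : List (List α)) : encSize l.flatten ≤ encSize l := by
  induction l with
  | nil => exact le_rfl
  | cons a l ih =>
    have := encSize_append a l.flatten
    rw [List.flatten_cons, encSize_cons]
    omega

/-- `T` is bounded by a polynomial in the size of its argument. -/
@[fun_prop]
def PolyBounded (T : α → ℕ) : Prop := ∃ c : ℕ, ∀ a, T a ≤ (encSize a + 1) ^ c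

namespace PolyBounded

variable {T U : α → ℕ}

theorem mono (hU : PolyBounded U) (h : ∀ a, T a ≤ U a) : PolyBounded T :=
  hU.imp fun _ hc a => (h a).trans (hc a)

@[fun_prop]
theorem size : PolyBounded (fun a : α => encSize a) := ⟨1, fun a => by simp⟩

@[fun_prop]
theorem const (n : ℕ) : PolyBounded (fun _ : α => n) :=
  ⟨n, fun a => Nat.lt_two_pow_self.le.trans (Nat.pow_le_pow_left (Nat.succ_le_succ
    (encSize_pos a)) n)⟩

@[fun_prop]
theorem mul (hT : PolyBounded T) (hU : PolyBounded U) : PolyBounded (fun a => T a * U a) := by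
  obtain ⟨c, hc⟩ := hT
  obtain ⟨d, hd⟩ := hU
  exact ⟨c + d, fun a => by rw [pow_add]; exact Nat.mul_le_mul (hc a) (hd a)⟩

@[fun_prop]
theorem add (hT : PolyBounded T) (hU : PolyBounded U) : PolyBounded (fun a => T a + U a) := by
  obtain ⟨c, hc⟩ := hT
  obtain ⟨d, hd⟩ := hU
  refine ⟨max c d + 1, fun a => ?_⟩
  have hpos := encSize_pos a
  calc T a + U a ≤ (encSize a + 1) ^ max c d + (encSize a + 1) ^ max c d :=
        Nat.add_le_add
          ((hc a).trans (Nat.pow_le_pow_right (Nat.succ_pos _) (le_max_left c d)))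
          ((hd a).trans (Nat.pow_le_pow_right (Nat.succ_pos _) (le_max_right c d)))
    _ = (encSize a + 1) ^ max c d * 2 := (mul_two _).symm
    _ ≤ (encSize a + 1) ^ (max c d + 1) := Nat.mul_le_mul_left _ (by omega)

@[fun_prop]
theorem pow (hT : PolyBounded T) (n : ℕ) : PolyBounded (fun a => T a ^ n) := by
  induction n with
  | zero => simpa only [pow_zero] using const 1
  | succ n ih => simpa only [pow_succ] using ih.mul hT

theorem exists_bound {T : β → ℕ} (hT : PolyBounded T) {S : α → ℕ} (hS : PolyBounded S) :
    ∃ U : α → ℕ, PolyBounded U ∧ ∀ a b, encSize b ≤ S a → T b ≤ U a := by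
  obtain ⟨c, hc⟩ := hT
  exact ⟨fun a => (S a + 1) ^ c, by fun_prop, fun a b h =>
    (hc b).trans (Nat.pow_le_pow_left (Nat.succ_le_succ h) c)⟩

theorem comp {T : β → ℕ} (hT : PolyBounded T) {f : α → β}
    (hf : PolyBounded fun a => encSize (f a)) : PolyBounded fun a => T (f a) := by
  obtain ⟨U, hU, hTU⟩ := hT.exists_bound hf
  exact hU.mono fun a => hTU a _ le_rfl

end PolyBounded

end EncSize

/-! ### Functions computable in polynomial time -/

section PolyTime

variable {α β γ σ : Type} [TreeEnc α] [TreeEnc β] [TreeEnc γ] [TreeEnc σ]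

/-- `f` is computed on encodings by a program in polynomial time, with output of polynomial size.
The second condition does not follow from the first, as trees may share subtrees in memory. -/
@[fun_prop]
def PolyTime (f : α → β) : Prop :=
  ∃ (p : Prog) (T : α → ℕ), (∀ a, Runs p (enc a) (enc (f a)) (T a)) ∧ PolyBounded T ∧
    PolyBounded fun a => encSize (f a)

theorem exists_runs_const (w : Val) : ∃ (p : Prog) (t : ℕ), ∀ v, Runs p v w t := by
  induction w with
  | nil => exact ⟨.nil, 1, fun v => .nil v⟩
  | cons a b iha ihb =>
    obtain ⟨p, s, hp⟩ := iha
    obtain ⟨q, t, hq⟩ := ihb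
    exact ⟨.cons p q, s + t + 1, fun v => .cons (hp v) (hq v)⟩

/-- The program that folds the program `p` over the list in the first component; the second
component holds the parameters of `p`, which stay constant, and the accumulator. -/
def foldProg (p : Prog) : Prog :=
  .loop .hd (.cons (.seq .hd .tl) (.cons (.seq .tl .hd)
    (.seq (.cons (.seq .tl .hd) (.cons (.seq .tl .tl) (.seq .hd .hd))) p)))

theorem runs_foldProg {p : Prog} {e : Val} {B : ℕ} {step : σ → β → σ} (l : List β) (s : σ)
    (h : ∀ l₁ b l₂, l = l₁ ++ b :: l₂ → ∃ t ≤ B,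
      Runs p (.cons e (.cons (enc (l₁.foldl step s)) (enc b)))
        (enc (step (l₁.foldl step s) b)) t) :
    ∃ t ≤ l.length * (B + 25) + 2,
      Runs (foldProg p) (.cons (enc l) (.cons e (enc s)))
        (.cons .nil (.cons e (enc (l.foldl step s)))) t := by
  induction l generalizing s with
  | nil => exact ⟨2, by simp, .loop_done (.hd _)⟩
  | cons b l ih =>
    obtain ⟨t, ht, hstep⟩ := h [] b l rfl
    obtain ⟨u, hu, hrest⟩ := ih (step s b) fun l₁ b' l₂ hl =>
      h (b :: l₁) b' l₂ (by rw [hl, List.cons_append])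
    refine ⟨_, ?_, .loop_step (.hd _) (by simp [Val.hd, enc, encList])
      (.cons (.seq (.hd _) (.tl _)) (.cons (.seq (.tl _) (.hd _))
        (.seq (.cons (.seq (.tl _) (.hd _)) (.cons (.seq (.tl _) (.tl _))
          (.seq (.hd _) (.hd _)))) hstep))) hrest⟩
    rw [List.length_cons, Nat.succ_mul]
    omega

namespace PolyTime

theorem polyBounded_encSize {f : α → β} (hf : PolyTime f) :
    PolyBounded fun a => encSize (f a) :=
  hf.choose_spec.choose_spec.2.2

theorem of_exists_runs {f : α → β} {p : Prog} {T : α → ℕ}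
    (hp : ∀ a, ∃ t ≤ T a, Runs p (enc a) (enc (f a)) t) (hT : PolyBounded T)
    (hs : PolyBounded fun a => encSize (f a)) : PolyTime f := by
  choose U hU hp using hp
  exact ⟨p, U, hp, hT.mono hU, hs⟩

theorem congr_enc {f : α → β} {g : α → γ} (hf : PolyTime f) (h : ∀ a, enc (g a) = enc (f a)) :
    PolyTime g := by
  obtain ⟨p, T, hp, hT, hs⟩ := hf
  exact ⟨p, T, fun a => by rw [h]; exact hp a, hT, hs.mono fun a => by rw [encSize, h, encSize]⟩

theorem of_eq {f g : α → β} (hf : PolyTime f) (h : ∀ a, g a = f a) : PolyTime g :=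
  hf.congr_enc fun a => by rw [h]

@[fun_prop]
theorem id : PolyTime (fun a : α => a) :=
  ⟨.id, fun _ => 1, fun _ => .id _, by fun_prop, by fun_prop⟩

theorem of_enc_eq {f : α → β} (h : ∀ a, enc (f a) = enc a) : PolyTime f := id.congr_enc h

@[fun_prop]
theorem comp {f : β → γ} {g : α → β} (hf : PolyTime f) (hg : PolyTime g) :
    PolyTime (fun a => f (g a)) := by
  obtain ⟨p, T, hp, hT, hs⟩ := hf
  obtain ⟨q, U, hq, hU, hr⟩ := hg
  exact ⟨.seq q p, fun a => U a + T (g a) + 1, fun a => .seq (hq a) (hp _),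
    (hU.add (hT.comp hr)).add (.const 1), hs.comp hr⟩

@[fun_prop]
theorem const (b : β) : PolyTime (fun _ : α => b) := by
  obtain ⟨p, t, hp⟩ := exists_runs_const (enc b)
  exact ⟨p, fun _ => t, fun a => hp _, .const t, .const _⟩

@[fun_prop]
theorem pair {f : α → β} {g : α → γ} (hf : PolyTime f) (hg : PolyTime g) :
    PolyTime (fun a => (f a, g a)) := by
  obtain ⟨p, T, hp, hT, hs⟩ := hf
  obtain ⟨q, U, hq, hU, hr⟩ := hg
  exact ⟨.cons p q, fun a => T a + U a + 1, fun a => .cons (hp a) (hq a), by fun_prop,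
    (hs.add hr).add (.const 1)⟩

@[fun_prop]
theorem fst {f : α → β × γ} (hf : PolyTime f) : PolyTime (fun a => (f a).1) :=
  comp (f := Prod.fst) ⟨.hd, fun _ => 1, fun _ => .hd _, by fun_prop,
    PolyBounded.size.mono fun x => by rw [encSize_pair x.1 x.2]; omega⟩ hf

@[fun_prop]
theorem snd {f : α → β × γ} (hf : PolyTime f) : PolyTime (fun a => (f a).2) :=
  comp (f := Prod.snd) ⟨.tl, fun _ => 1, fun _ => .tl _, by fun_prop,
    PolyBounded.size.mono fun x => by rw [encSize_pair x.1 x.2]; omega⟩ hf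

theorem ite_runs {c : α → σ} {h : α → β} {p q : Prog} {T U : α → ℕ} (hc : PolyTime c)
    (hp : ∀ a, enc (c a) ≠ .nil → ∃ t ≤ T a, Runs p (enc a) (enc (h a)) t)
    (hq : ∀ a, enc (c a) = .nil → ∃ t ≤ U a, Runs q (enc a) (enc (h a)) t)
    (hT : PolyBounded T) (hU : PolyBounded U) (hs : PolyBounded fun a => encSize (h a)) :
    PolyTime h := by
  obtain ⟨r, V, hr, hV, -⟩ := hc
  refine of_exists_runs (p := .ite r p q) (T := fun a => V a + (T a + U a) + 1) (fun a => ?_)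
    (by fun_prop) hs
  by_cases hn : enc (c a) = .nil
  · obtain ⟨t, ht, h⟩ := hq a hn
    exact ⟨V a + t + 1, by omega, .ite_false (hn ▸ hr a) h⟩
  · obtain ⟨t, ht, h⟩ := hp a hn
    exact ⟨V a + t + 1, by omega, .ite_true (hr a) hn h⟩

theorem ite_enc {c : α → σ} {f g h : α → β} (hc : PolyTime c) (hf : PolyTime f)
    (hg : PolyTime g) (hfh : ∀ a, enc (c a) ≠ .nil → h a = f a)
    (hgh : ∀ a, enc (c a) = .nil → h a = g a) : PolyTime h := by
  obtain ⟨p, T, hp, hT, hs⟩ := hf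
  obtain ⟨q, U, hq, hU, ht⟩ := hg
  refine ite_runs (p := p) (q := q) hc
    (fun a hn => ⟨T a, le_rfl, by rw [hfh a hn]; exact hp a⟩)
    (fun a hn => ⟨U a, le_rfl, by rw [hgh a hn]; exact hq a⟩) hT hU
    ((hs.add ht).mono fun a => ?_)
  by_cases hn : enc (c a) = .nil
  · rw [hgh a hn]; omega
  · rw [hfh a hn]; omega

@[fun_prop]
theorem cond {c : α → Bool} {f g : α → β} (hc : PolyTime c) (hf : PolyTime f)
    (hg : PolyTime g) : PolyTime (fun a => bif c a then f a else g a) :=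
  hc.ite_enc hf hg (fun a h => by cases hca : c a <;> simp_all [enc])
    (fun a h => by cases hca : c a <;> simp_all [enc])

@[fun_prop]
theorem inl {f : α → β} (hf : PolyTime f) : PolyTime (fun a => (Sum.inl (f a) : β ⊕ γ)) :=
  ((const ()).pair hf).congr_enc fun _ => rfl

@[fun_prop]
theorem inr {f : α → γ} (hf : PolyTime f) : PolyTime (fun a => (Sum.inr (f a) : β ⊕ γ)) :=
  ((const true).pair hf).congr_enc fun _ => rfl

theorem isRight {f : α → β ⊕ γ} (hf : PolyTime f) : PolyTime (fun a => (f a).isRight) := by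
  refine comp (f := Sum.isRight) ⟨.hd, fun _ => 1, fun x => ?_, by fun_prop,
    (PolyBounded.const 3).mono fun _ => encSize_bool_le _⟩ hf
  cases x <;> exact .hd _

@[fun_prop]
theorem sumElim {f : α → β ⊕ γ} {F : α → β → σ} {G : α → γ → σ} (hf : PolyTime f)
    (hF : PolyTime (fun p : α × β => F p.1 p.2)) (hG : PolyTime (fun p : α × γ => G p.1 p.2)) :
    PolyTime (fun a => Sum.elim (F a) (G a) (f a)) := by
  have hbranch := hf.isRight
  obtain ⟨r, V, hr, hV, hw⟩ := hf
  obtain ⟨p, T, hp, hT, hs⟩ := hF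
  obtain ⟨q, U, hq, hU, ht⟩ := hG
  have hS : PolyBounded (fun a => encSize a + encSize (f a) + 1) :=
    (PolyBounded.size.add hw).add (.const 1)
  obtain ⟨T', hT', hTT'⟩ := (hT.add hs).exists_bound hS
  obtain ⟨U', hU', hUU'⟩ := (hU.add ht).exists_bound hS
  have hinl {a b} (h : f a = .inl b) : T (a, b) + encSize (F a b) ≤ T' a :=
    hTT' a (a, b) (by rw [encSize_pair, h, encSize_inl]; omega)
  have hinr {a b} (h : f a = .inr b) : U (a, b) + encSize (G a b) ≤ U' a :=
    hUU' a (a, b) (by rw [encSize_pair, h, encSize_inr]; omega)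
  refine ite_runs (p := .seq (.cons .id (.seq r .tl)) q) (q := .seq (.cons .id (.seq r .tl)) p)
    (T := fun a => V a + U' a + 5) (U := fun a => V a + T' a + 5) hbranch
    (fun a hn => ?_) (fun a hn => ?_) (by fun_prop) (by fun_prop)
    ((hT'.add hU').mono fun a => ?_)
  all_goals cases hfa : f a with
    | inl b => ?_
    | inr b => ?_
  · exact absurd (by rw [hfa]; rfl) hn
  · have hra := hr a
    rw [hfa] at hra
    have := hinr hfa
    refine ⟨_, ?_, .seq (.cons (.id _) (.seq hra (.tl _))) (hq (a, b))⟩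
    omega
  · have hra := hr a
    rw [hfa] at hra
    have := hinl hfa
    refine ⟨_, ?_, .seq (.cons (.id _) (.seq hra (.tl _))) (hp (a, b))⟩
    omega
  · rw [hfa] at hn; cases hn
  · have := hinl hfa
    simp only [Sum.elim_inl]; omega
  · have := hinr hfa
    simp only [Sum.elim_inr]; omega

@[fun_prop]
theorem listCons {f : α → β} {g : α → List β} (hf : PolyTime f) (hg : PolyTime g) :
    PolyTime (fun a => f a :: g a) :=
  (hf.pair hg).congr_enc fun _ => rfl

@[fun_prop]
theorem tail {f : α → List β} (hf : PolyTime f) : PolyTime (fun a => (f a).tail) := by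
  refine comp (f := List.tail) ⟨.tl, fun _ => 1, fun l => ?_, by fun_prop,
    PolyBounded.size.mono fun l => encSize_le_of_suffix l.tail_suffix⟩ hf
  cases l <;> exact .tl _

@[fun_prop]
theorem headD {f : α → List β} {d : α → β} (hf : PolyTime f) (hd : PolyTime d) :
    PolyTime (fun a => (f a).headD (d a)) := by
  have hbranch := hf
  obtain ⟨p, T, hp, hT, hs⟩ := hf
  obtain ⟨q, U, hq, hU, ht⟩ := hd
  refine ite_runs (p := .seq p .hd) (q := q) (T := fun a => T a + 1 + 1) hbranch
    (fun a hn => ⟨_, le_rfl, .seq (hp a) ?_⟩) (fun a hn => ⟨U a, le_rfl, ?_⟩) (by fun_prop) hU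
    ((hs.add ht).mono fun a => ?_)
  all_goals cases hfa : f a with
    | nil => ?_
    | cons b l => ?_
  · exact absurd (by rw [hfa]; rfl) hn
  · exact .hd _
  · exact hq a
  · rw [hfa] at hn; cases hn
  · exact Nat.le_add_left _ _
  · rw [List.headD_cons, encSize_cons]; omega

theorem foldl {l : α → List β} {init : α → σ} {step : α → σ → β → σ} (hl : PolyTime l)
    (hi : PolyTime init) (hs : PolyTime (fun p : α × σ × β => step p.1 p.2.1 p.2.2)) {S : α → ℕ}
    (hS : PolyBounded S)
    (hb : ∀ a l', l' <+: l a → encSize (l'.foldl (step a) (init a)) ≤ S a) :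
    PolyTime (fun a => (l a).foldl (step a) (init a)) := by
  obtain ⟨pl, Tl, hpl, hTl, hsl⟩ := hl
  obtain ⟨pi, Ti, hpi, hTi, -⟩ := hi
  obtain ⟨p, T, hp, hT, -⟩ := hs
  obtain ⟨B, hB, hTB⟩ := hT.exists_bound (S := fun a => encSize a + S a + encSize (l a) + 2)
    (((PolyBounded.size.add hS).add hsl).add (.const 2))
  refine of_exists_runs (p := .seq (.cons pl (.cons .id pi)) (.seq (foldProg p) (.seq .tl .tl)))
    (T := fun a => Tl a + Ti a + encSize (l a) * (B a + 25) + 15) (fun a => ?_) (by fun_prop)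
    (hS.mono fun a => hb a _ List.prefix_rfl)
  obtain ⟨t, ht, hr⟩ := runs_foldProg (p := p) (e := enc a) (step := step a) (B := B a) (l a)
    (init a) fun l₁ b l₂ h => by
      refine ⟨_, hTB a _ ?_, hp (a, l₁.foldl (step a) (init a), b)⟩
      have hacc := hb a l₁ ⟨b :: l₂, h.symm⟩
      have hbl : encSize b < encSize (l a) := encSize_lt_of_mem (by rw [h]; simp)
      rw [encSize_pair, encSize_pair]
      omega
  refine ⟨_, ?_, .seq (.cons (hpl a) (.cons (.id _) (hpi a))) (.seq hr (.seq (.tl _) (.tl _)))⟩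
  have := Nat.mul_le_mul_right (B a + 25) (length_lt_encSize (l a)).le
  omega

end PolyTime

end PolyTime

section PolyTime

variable {α β γ σ : Type} [TreeEnc α] [TreeEnc β] [TreeEnc γ] [TreeEnc σ]

theorem enc_nat_eq_enc_replicate (n : ℕ) : enc n = enc (List.replicate n ()) := by
  induction n with
  | zero => rfl
  | succ n ih => exact congrArg (Val.cons .nil) ih

theorem iterate_append_length_eq_range (n : ℕ) :
    (fun l : List ℕ => l ++ [l.length])^[n] [] = List.range n := by
  induction n with
  | zero => rfl
  | succ n ih => rw [Function.iterate_succ_apply', ih, List.range_succ, List.length_range]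

theorem nat_blt_iff {m n : ℕ} : Nat.blt m n = true ↔ m < n := by
  rw [Nat.blt, Nat.ble_eq, Nat.succ_le_iff]

/-- The list of all lists of length `r` with entries in `l`. -/
def tuples {β : Type} : ℕ → List β → List (List β)
  | 0, _ => [[]]
  | r + 1, l => l.flatMap fun x => (tuples r l).map (x :: ·)

theorem mem_tuples {β : Type} {r : ℕ} {l m : List β} :
    m ∈ tuples r l ↔ m.length = r ∧ ∀ x ∈ m, x ∈ l := by
  induction r generalizing m with
  | zero => simp +contextual [tuples]
  | succ r ih =>
    cases m with
    | nil => simp [tuples]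
    | cons y m =>
      simp only [tuples, List.mem_flatMap, List.mem_map, ih, List.cons.injEq, List.length_cons,
        Nat.add_right_cancel_iff, List.forall_mem_cons]
      grind

theorem length_tuples {β : Type} (r : ℕ) (l : List β) : (tuples r l).length = l.length ^ r := by
  induction r with
  | zero => rfl
  | succ r ih => simp [tuples, List.length_flatMap, ih, pow_succ, mul_comm]

namespace PolyTime

@[fun_prop]
theorem not {f : α → Bool} (hf : PolyTime f) : PolyTime (fun a => !(f a)) :=
  (hf.cond (const false) (const true)).of_eq fun a => by cases f a <;> rfl

@[fun_prop]
theorem and {f g : α → Bool} (hf : PolyTime f) (hg : PolyTime g) :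
    PolyTime (fun a => f a && g a) :=
  (hf.cond hg (const false)).of_eq fun a => by cases f a <;> rfl

@[fun_prop]
theorem or {f g : α → Bool} (hf : PolyTime f) (hg : PolyTime g) :
    PolyTime (fun a => f a || g a) :=
  (hf.cond (const true) hg).of_eq fun a => by cases f a <;> rfl

@[fun_prop]
theorem beqBool {f g : α → Bool} (hf : PolyTime f) (hg : PolyTime g) :
    PolyTime (fun a => f a == g a) :=
  (hf.cond hg hg.not).of_eq fun a => by cases f a <;> cases g a <;> rfl

theorem reverseAppend {f g : α → List β} (hf : PolyTime f) (hg : PolyTime g) :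
    PolyTime (fun a => (f a).reverse ++ g a) := by
  refine (foldl (step := fun _ acc b => b :: acc) (S := fun a => encSize (f a) + encSize (g a))
    hf hg (by fun_prop) (hf.polyBounded_encSize.add hg.polyBounded_encSize)
    fun a l' h => ?_).of_eq fun _ => List.foldl_flip_cons_eq_append'.symm
  have := encSize_append l'.reverse (g a)
  have := encSize_le_of_isPrefix h
  rw [List.foldl_flip_cons_eq_append']
  rw [encSize_reverse] at *
  omega

@[fun_prop]
theorem reverse {f : α → List β} (hf : PolyTime f) : PolyTime (fun a => (f a).reverse) :=
  (hf.reverseAppend (const [])).of_eq fun _ => (List.append_nil _).symm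

@[fun_prop]
theorem append {f g : α → List β} (hf : PolyTime f) (hg : PolyTime g) :
    PolyTime (fun a => f a ++ g a) :=
  (hf.reverse.reverseAppend hg).of_eq fun a => by rw [List.reverse_reverse]

@[fun_prop]
theorem map {l : α → List β} {F : α → β → γ} (hl : PolyTime l)
    (hF : PolyTime (fun p : α × β => F p.1 p.2)) : PolyTime (fun a => (l a).map (F a)) := by
  obtain ⟨B, hB, hFB⟩ := hF.polyBounded_encSize.exists_bound
    ((PolyBounded.size.add hl.polyBounded_encSize).add (.const 1))
  refine (foldl (init := fun _ => []) (step := fun a acc b => F a b :: acc)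
    (S := fun a => encSize (l a) * (B a + 1) + 1) hl (const [])
    (listCons (hF.comp (g := fun p : α × List γ × β => (p.1, p.2.2)) (by fun_prop))
      (by fun_prop))
    ((hl.polyBounded_encSize.mul (hB.add (.const 1))).add (.const 1))
    fun a l' h => ?_).reverse.of_eq fun a => by
      rw [List.foldl_flip_cons_eq_append, List.append_nil, List.reverse_reverse]
  rw [List.foldl_flip_cons_eq_append, List.append_nil, encSize_reverse]
  have hlen := (length_lt_encSize l').le.trans (encSize_le_of_isPrefix h)
  refine (encSize_list_le (B := B a) _ ?_).trans ?_
  · refine List.forall_mem_map.2 fun b hb => hFB a (a, b) ?_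
    have := encSize_lt_of_mem (h.subset hb)
    rw [encSize_pair]
    omega
  · rw [List.length_map]
    exact Nat.succ_le_succ (Nat.mul_le_mul_right _ hlen)

@[fun_prop]
theorem flatten {f : α → List (List β)} (hf : PolyTime f) :
    PolyTime (fun a => (f a).flatten) := by
  have hfold (l : List (List β)) : l.foldl (fun acc b => acc ++ b) [] = l.flatten := by
    simpa using List.foldl_append_eq_append (l := l) (f := _root_.id) (l' := [])
  refine (foldl (init := fun _ => []) (step := fun _ acc b => acc ++ b) hf (const [])
    (by fun_prop) hf.polyBounded_encSize fun _ l' h => ?_).of_eq fun a => (hfold _).symm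
  rw [hfold]
  exact (encSize_flatten_le _).trans (encSize_le_of_isPrefix h)

@[fun_prop]
theorem flatMap {l : α → List β} {F : α → β → List γ} (hl : PolyTime l)
    (hF : PolyTime (fun p : α × β => F p.1 p.2)) : PolyTime (fun a => (l a).flatMap (F a)) :=
  (hl.map hF).flatten.of_eq fun _ => List.flatMap_def

@[fun_prop]
theorem filter {l : α → List β} {F : α → β → Bool} (hl : PolyTime l)
    (hF : PolyTime (fun p : α × β => F p.1 p.2)) : PolyTime (fun a => (l a).filter (F a)) := by
  refine (hl.flatMap (F := fun a b => bif F a b then [b] else [])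
    (hF.cond (by fun_prop) (by fun_prop))).of_eq fun a => ?_
  induction l a with
  | nil => rfl
  | cons b m ih => cases h : F a b <;> simp [h, ih]

@[fun_prop]
theorem isEmpty {f : α → List β} (hf : PolyTime f) : PolyTime (fun a => (f a).isEmpty) := by
  refine hf.ite_enc (const false) (const true) (fun a h => ?_) fun a h => ?_ <;>
    cases hfa : f a <;> simp_all [enc, encList]

@[fun_prop]
theorem all {l : α → List β} {F : α → β → Bool} (hl : PolyTime l)
    (hF : PolyTime (fun p : α × β => F p.1 p.2)) : PolyTime (fun a => (l a).all (F a)) :=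
  (hl.filter (F := fun a b => !F a b) hF.not).isEmpty.of_eq fun a => by
    rw [Bool.eq_iff_iff, List.isEmpty_iff, List.filter_eq_nil_iff, List.all_eq_true]
    simp only [Bool.not_eq_true', Bool.not_eq_false]

@[fun_prop]
theorem any {l : α → List β} {F : α → β → Bool} (hl : PolyTime l)
    (hF : PolyTime (fun p : α × β => F p.1 p.2)) : PolyTime (fun a => (l a).any (F a)) :=
  (hl.all (F := fun a b => !F a b) hF.not).not.of_eq fun _ => List.any_eq_not_all_not

theorem iterate {n : α → ℕ} {init : α → σ} {step : σ → σ} (hn : PolyTime n) (hi : PolyTime init)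
    (hs : PolyTime step) {S : α → ℕ} (hS : PolyBounded S)
    (hb : ∀ a, ∀ i ≤ n a, encSize (step^[i] (init a)) ≤ S a) :
    PolyTime (fun a => step^[n a] (init a)) := by
  refine (foldl (step := fun _ acc _ => step acc)
    (hn.congr_enc (g := fun a => List.replicate (n a) ())
      fun _ => (enc_nat_eq_enc_replicate _).symm) hi (by fun_prop) hS fun a l' h => ?_).of_eq
    fun a => by rw [List.foldl_const, List.length_replicate]
  rw [List.foldl_const]
  exact hb a _ (h.length_le.trans_eq List.length_replicate)

@[fun_prop]
theorem drop {f : α → ℕ} {l : α → List β} (hf : PolyTime f) (hl : PolyTime l) :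
    PolyTime (fun a => (l a).drop (f a)) := by
  refine (iterate hf hl (tail id) hl.polyBounded_encSize fun a i _ => ?_).of_eq
    fun a => (List.tail_iterate _ _).symm
  rw [List.tail_iterate]
  exact encSize_le_of_suffix (List.drop_suffix _ _)

@[fun_prop]
theorem getD {f : α → ℕ} {l : α → List β} {d : α → β} (hl : PolyTime l) (hf : PolyTime f)
    (hd : PolyTime d) : PolyTime (fun a => (l a).getD (f a) (d a)) :=
  ((hf.drop hl).headD hd).of_eq fun a => by
    rw [List.headD_eq_head?_getD, List.head?_drop, List.getD_eq_getElem?_getD]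

@[fun_prop]
theorem length {f : α → List β} (hf : PolyTime f) : PolyTime (fun a => (f a).length) :=
  (hf.map (F := fun _ _ => ()) (const ())).congr_enc fun a => by
    rw [enc_nat_eq_enc_replicate, List.map_const']

theorem replicateUnit {f : α → ℕ} (hf : PolyTime f) :
    PolyTime (fun a => List.replicate (f a) ()) :=
  hf.congr_enc fun _ => (enc_nat_eq_enc_replicate _).symm

@[fun_prop]
theorem add {f g : α → ℕ} (hf : PolyTime f) (hg : PolyTime g) : PolyTime (fun a => f a + g a) :=
  (hf.replicateUnit.append hg.replicateUnit).length.of_eq fun a => by simp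

@[fun_prop]
theorem sub {f g : α → ℕ} (hf : PolyTime f) (hg : PolyTime g) : PolyTime (fun a => f a - g a) :=
  (hg.drop hf.replicateUnit).length.of_eq fun a => by simp

@[fun_prop]
theorem ble {f g : α → ℕ} (hf : PolyTime f) (hg : PolyTime g) :
    PolyTime (fun a => Nat.ble (f a) (g a)) :=
  (hg.drop hf.replicateUnit).isEmpty.of_eq fun a => by
    rw [Bool.eq_iff_iff, Nat.ble_eq, List.isEmpty_iff, List.drop_eq_nil_iff,
      List.length_replicate]

@[fun_prop]
theorem blt {f g : α → ℕ} (hf : PolyTime f) (hg : PolyTime g) :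
    PolyTime (fun a => Nat.blt (f a) (g a)) :=
  (hf.add (const 1)).ble hg

@[fun_prop]
theorem beqNat {f g : α → ℕ} (hf : PolyTime f) (hg : PolyTime g) :
    PolyTime (fun a => f a == g a) :=
  ((hf.ble hg).and (hg.ble hf)).of_eq fun a => by
    rw [Bool.eq_iff_iff, beq_iff_eq, Bool.and_eq_true, Nat.ble_eq, Nat.ble_eq]; omega

@[fun_prop]
theorem range {f : α → ℕ} (hf : PolyTime f) : PolyTime (fun a => List.range (f a)) := by
  have hS := hf.polyBounded_encSize
  refine (iterate (step := fun l : List ℕ => l ++ [l.length]) (init := fun _ => [])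
    (S := fun a => encSize (f a) * (encSize (f a) + 1) + 1) hf (by fun_prop) (by fun_prop)
    ((hS.mul (hS.add (.const 1))).add (.const 1)) fun a i hi => ?_).of_eq
    fun a => (iterate_append_length_eq_range _).symm
  rw [iterate_append_length_eq_range]
  refine (encSize_list_le (B := encSize (f a)) _ fun x hx => ?_).trans ?_
  · have := List.mem_range.1 hx
    rw [encSize_nat, encSize_nat]
    omega
  · rw [List.length_range]
    refine Nat.add_le_add_right (Nat.mul_le_mul_right _ ?_) _
    rw [encSize_nat]
    omega

@[fun_prop]
theorem beqListNat {f g : α → List ℕ} (hf : PolyTime f) (hg : PolyTime g) :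
    PolyTime (fun a => f a == g a) := by
  refine ((hf.length.beqNat hg.length).and ((hf.length.range).all
    (F := fun a i => (f a).getD i 0 == (g a).getD i 0) (by fun_prop))).of_eq fun a => ?_
  rw [Bool.eq_iff_iff]
  simp only [beq_iff_eq, Bool.and_eq_true, List.all_eq_true, List.mem_range]
  refine ⟨fun h => by simp [h], fun ⟨hlen, hget⟩ => List.ext_getElem hlen fun i hi hi' => ?_⟩
  simpa only [List.getD_eq_getElem _ _ hi, List.getD_eq_getElem _ _ hi'] using hget i hi

@[fun_prop]
theorem tuples (r : ℕ) {l : α → List β} (hl : PolyTime l) :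
    PolyTime (fun a => tuples r (l a)) := by
  induction r with
  | zero => exact const _
  | succ r ih =>
    exact hl.flatMap (F := fun a x => (ParamW.tuples r (l a)).map (x :: ·))
      (map (F := fun p y => p.2 :: y) (ih.comp id.fst) (by fun_prop))

end PolyTime

end PolyTime

/-! ### Reductions -/

attribute [instance] ParamProblem.code

theorem computable_add {f g : ℕ → ℕ} (hf : Computable f) (hg : Computable g) :
    Computable fun k => f k + g k :=
  (Primrec.nat_add.to_comp (α := ℕ) (β := ℕ)).comp hf hg

theorem computable_mul {f g : ℕ → ℕ} (hf : Computable f) (hg : Computable g) :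
    Computable fun k => f k * g k :=
  (Primrec.nat_mul.to_comp (α := ℕ) (β := ℕ)).comp hf hg

theorem computable_pow {f g : ℕ → ℕ} (hf : Computable f) (hg : Computable g) :
    Computable fun k => f k ^ g k :=
  ((Primrec₂.unpaired'.1 Nat.Primrec.pow).to_comp (α := ℕ) (β := ℕ)).comp hf hg

theorem exists_computable_monotone_ge {f : ℕ → ℕ} (hf : Computable f) :
    ∃ F : ℕ → ℕ, Computable F ∧ Monotone F ∧ ∀ n, f n ≤ F n := by
  refine ⟨fun n => ∑ i ∈ Finset.range (n + 1), f i, ?_, fun m n h => ?_, fun n => ?_⟩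
  · refine (Computable.nat_rec (g := fun _ => f 0) (h := fun _ p => p.2 + f (p.1 + 1))
      Computable.id (Computable.const _) ?_).of_eq fun n => ?_
    · exact (Primrec.nat_add.to_comp (α := ℕ) (β := ℕ)).comp
        (Computable.snd.comp Computable.snd)
        (hf.comp (Computable.succ.comp (Computable.fst.comp Computable.snd)))
    · induction n with
      | zero => exact (Finset.sum_range_one f).symm
      | succ n ih => rw [Finset.sum_range_succ, ← ih]; rfl
  · exact Finset.sum_le_sum_of_subset (Finset.range_subset_range.2 (Nat.succ_le_succ h))
  · exact Finset.single_le_sum (fun _ _ => Nat.zero_le _) (Finset.self_mem_range_succ n)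

theorem FPTReducible.trans {A B C : ParamProblem} (hAB : FPTReducible A B)
    (hBC : FPTReducible B C) : FPTReducible A C := by
  obtain ⟨p, f, g, c, hf, hg, h⟩ := hAB
  obtain ⟨p', f', g', c', hf', hg', h'⟩ := hBC
  obtain ⟨F, hF, hFmono, hfF⟩ := exists_computable_monotone_ge hf'
  obtain ⟨G, hG, hGmono, hgG⟩ := exists_computable_monotone_ge hg'
  refine ⟨.seq p p', fun k => f k + F (g k) * f k ^ c' + 1, fun k => G (g k), c + c * c', ?_,
    hG.comp hg, fun x k => ?_⟩
  · exact computable_add (computable_add hf (computable_mul (hF.comp hg)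
      (computable_pow hf (.const c')))) (.const 1)
  obtain ⟨y, l, t, hr, ht, hl, hy⟩ := h x k
  obtain ⟨z, m, u, hr', hu, hm, hz⟩ := h' y l
  refine ⟨z, m, t + u + 1, .seq hr hr', ?_, hm.trans ((hgG l).trans (hGmono hl)), hy.trans hz⟩
  set n := (A.input x k).size
  have hn : 1 ≤ n := Val.size_pos _
  have hB : (B.input y l).size ≤ f k * n ^ c := (Nat.le_add_left _ _).trans ht
  have hsecond : u + (C.input z m).size ≤ F (g k) * f k ^ c' * n ^ (c * c') :=
    calc u + (C.input z m).size ≤ f' l * (B.input y l).size ^ c' := hu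
      _ ≤ F (g k) * (f k * n ^ c) ^ c' :=
        Nat.mul_le_mul ((hfF l).trans (hFmono hl)) (Nat.pow_le_pow_left hB c')
      _ = F (g k) * f k ^ c' * n ^ (c * c') := by rw [mul_pow, ← pow_mul, mul_assoc]
  calc t + u + 1 + (C.input z m).size
      ≤ f k * n ^ c + F (g k) * f k ^ c' * n ^ (c * c') + 1 := by omega
    _ ≤ f k * n ^ (c + c * c') + F (g k) * f k ^ c' * n ^ (c + c * c') + n ^ (c + c * c') := by
        gcongr <;> first | omega | exact Nat.one_le_pow _ _ hn
    _ = (f k + F (g k) * f k ^ c' + 1) * n ^ (c + c * c') := by ring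

/-- `E k` is computed from the parameter `k` by a program whose running time and output size are
bounded by a computable function. -/
def ParamComputable {ε : Type} [TreeEnc ε] (E : ℕ → ε) : Prop :=
  ∃ (q : Prog) (b : ℕ → ℕ), Computable b ∧
    ∀ k, ∃ t, Runs q (enc k) (enc (E k)) t ∧ t + encSize (E k) ≤ b k

theorem FPTReducible.of_paramComputable {A B : ParamProblem} {ε : Type} [TreeEnc ε] {E : ℕ → ε}
    (hE : ParamComputable E) {R : (A.Inst × ℕ) × ε → B.Inst × ℕ} (hR : PolyTime R) {g : ℕ → ℕ}
    (hg : Computable g) (hRg : ∀ x k, (R ((x, k), E k)).2 ≤ g k)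
    (hyes : ∀ x k, A.Yes x k ↔ B.Yes (R ((x, k), E k)).1 (R ((x, k), E k)).2) :
    FPTReducible A B := by
  obtain ⟨q, b, hb, hq⟩ := hE
  obtain ⟨p, T, hp, hT, hs⟩ := hR
  obtain ⟨c, hc⟩ := hT.add hs
  refine ⟨.seq (.cons .id (.seq .tl q)) p, fun k => b k + 5 + (b k + 3) ^ c, g, c, ?_, hg,
    fun x k => ⟨(R ((x, k), E k)).1, (R ((x, k), E k)).2, ?_⟩⟩
  · exact computable_add (computable_add hb (.const 5))
      (computable_pow (computable_add hb (.const 3)) (.const c))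
  obtain ⟨t, hr, ht⟩ := hq k
  refine ⟨_, .seq (.cons (.id _) (.seq (.tl _) hr)) (hp ((x, k), E k)), ?_, hRg x k, hyes x k⟩
  set n := (A.input x k).size
  have hn1 : 1 ≤ n := Val.size_pos _
  have hinput : encSize ((x, k), E k) + 1 ≤ (b k + 3) * n := by
    have hsize : encSize ((x, k), E k) = n + encSize (E k) + 1 := rfl
    nlinarith
  calc 1 + (1 + t + 1) + 1 + T ((x, k), E k) + 1 + encSize (R ((x, k), E k))
      = t + 5 + (T ((x, k), E k) + encSize (R ((x, k), E k))) := by ring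
    _ ≤ (b k + 5) * n ^ c + ((b k + 3) * n) ^ c := by
        refine Nat.add_le_add ?_ ((hc _).trans (Nat.pow_le_pow_left hinput c))
        exact (by omega : t + 5 ≤ b k + 5).trans (Nat.le_mul_of_pos_right _ (Nat.pow_pos hn1))
    _ = (b k + 5 + (b k + 3) ^ c) * n ^ c := by rw [mul_pow, ← add_mul]

theorem FPTReducible.of_polyTime {A B : ParamProblem} {R : A.Inst × ℕ → B.Inst × ℕ}
    (hR : PolyTime R) {g : ℕ → ℕ} (hg : Computable g) (hRg : ∀ x k, (R (x, k)).2 ≤ g k)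
    (hyes : ∀ x k, A.Yes x k ↔ B.Yes (R (x, k)).1 (R (x, k)).2) : FPTReducible A B :=
  of_paramComputable (E := fun _ => ())
    ⟨.nil, fun _ => 2, .const 2, fun _ => ⟨1, .nil _, le_rfl⟩⟩ (hR.comp (PolyTime.fst .id)) hg
    hRg hyes

/-! ### A colored hitting set problem -/

/-- The problem through which both reductions go. The instance `(m, L)` lists for every slot its
options, each given by the list of the Booleans that tell which of the `m` clauses it hits. The
question is whether one can choose an option for each of the first `k` slots such that all clauses
are hit. -/
def ColoredHittingSet : ParamProblem where
  Inst := ℕ × List (List (List Bool))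
  Yes x k := ∃ f : ℕ → List Bool, (∀ i < k, f i ∈ x.2.getD i []) ∧
    ∀ c < x.1, ∃ i < k, (f i).getD c false = true

section HitInstance

variable {ι ν κ : Type}

/-- The instance of the hitting set problem with the slots `idx`, the options `opts i` of the slot
`i` and the clauses `Cl`, where `inc i v c` says that the option `v` of the slot `i` hits `c`. -/
def hitInstance (idx : List ι) (opts : ι → List ν) (Cl : List κ) (inc : ι → ν → κ → Bool) :
    ℕ × List (List (List Bool)) :=
  (Cl.length, idx.map fun i => (opts i).map fun v => Cl.map (inc i v))

theorem getD_map_of_lt {α β : Type} {f : α → β} {l : List α} {i : ℕ} {d : β}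
    (h : i < l.length) : (l.map f).getD i d = f l[i] := by
  rw [List.getD_eq_getElem _ _ (by rwa [List.length_map]), List.getElem_map]

theorem mem_hitInstance_getD {idx : List ι} {opts : ι → List ν} {Cl : List κ}
    {inc : ι → ν → κ → Bool} {p : ℕ} (hp : p < idx.length) {l : List Bool} :
    l ∈ (hitInstance idx opts Cl inc).2.getD p [] ↔
      ∃ v ∈ opts idx[p], Cl.map (inc idx[p] v) = l := by
  rw [hitInstance, getD_map_of_lt hp, List.mem_map]

theorem hitInstance_yes_iff [Nonempty ν] {idx : List ι} (hidx : idx.Nodup)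
    {opts : ι → List ν} {Cl : List κ} {inc : ι → ν → κ → Bool} :
    ColoredHittingSet.Yes (hitInstance idx opts Cl inc) idx.length ↔
    ∃ f : ι → ν, (∀ i ∈ idx, f i ∈ opts i) ∧ ∀ c ∈ Cl, ∃ i ∈ idx, inc i (f i) c = true := by
  classical
  constructor
  · rintro ⟨F, hF, hhit⟩
    have hchoice : ∀ i ∈ idx, ∃ v ∈ opts i, Cl.map (inc i v) = F (idx.idxOf i) := fun i hi => by
      have hlt := List.idxOf_lt_length_of_mem hi
      simpa only [List.getElem_idxOf] using (mem_hitInstance_getD hlt).1 (hF _ hlt)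
    choose! f hf hfF using hchoice
    refine ⟨f, hf, fun c hc => ?_⟩
    obtain ⟨j, hj, rfl⟩ := List.getElem_of_mem hc
    obtain ⟨p, hp, hpj⟩ := hhit j hj
    refine ⟨idx[p], List.getElem_mem hp, ?_⟩
    rwa [← hidx.idxOf_getElem p hp, ← hfF _ (List.getElem_mem hp), getD_map_of_lt hj] at hpj
  · rintro ⟨f, hf, hhit⟩
    refine ⟨fun p => (idx.map fun i => Cl.map (inc i (f i))).getD p [], fun p hp => ?_,
      fun j hj => ?_⟩
    · exact (mem_hitInstance_getD hp).2
        ⟨f idx[p], hf _ (List.getElem_mem hp), by beta_reduce; rw [getD_map_of_lt hp]⟩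
    · change j < Cl.length at hj
      obtain ⟨i, hi, hic⟩ := hhit Cl[j] (List.getElem_mem hj)
      obtain ⟨p, hp, rfl⟩ := List.getElem_of_mem hi
      refine ⟨p, hp, ?_⟩
      beta_reduce
      rwa [getD_map_of_lt hp, getD_map_of_lt hj]

end HitInstance

theorem map_range_eq_ofFn {β : Type} (n : ℕ) (g : ℕ → β) :
    (List.range n).map g = List.ofFn fun i : Fin n => g i := by
  rw [List.ofFn_eq_map, ← List.map_coe_finRange_eq_range, List.map_map]
  rfl

section EncCongr

variable {α β : Type} [TreeEnc α] [TreeEnc β]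

theorem enc_list_eq_encList_map (l : List α) : enc l = encList id (l.map enc) := by
  induction l with
  | nil => rfl
  | cons a l ih => exact congrArg (Val.cons (enc a)) ih

theorem enc_list_congr {l : List α} {l' : List β} (h : l.map enc = l'.map enc) :
    enc l = enc l' := by
  rw [enc_list_eq_encList_map, h, ← enc_list_eq_encList_map]

theorem enc_fun_congr {n : ℕ} {f : Fin n → α} {g : Fin n → β}
    (h : ∀ i, enc (f i) = enc (g i)) : enc f = enc g :=
  enc_list_congr (by rw [List.map_ofFn, List.map_ofFn]; exact congrArg List.ofFn (funext h))

theorem enc_fun_eq_enc_map_range {n : ℕ} {f : Fin n → α} {g : ℕ → β}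
    (h : ∀ i : Fin n, enc (f i) = enc (g i)) : enc f = enc ((List.range n).map g) := by
  rw [map_range_eq_ofFn]
  exact enc_fun_congr h

theorem enc_pair_congr {α' β' : Type} [TreeEnc α'] [TreeEnc β'] {a : α} {b : β} {a' : α'}
    {b' : β'} (h : enc a = enc a') (h' : enc b = enc b') : enc (a, b) = enc (a', b') :=
  congrArg₂ Val.cons h h'

end EncCongr

namespace BlindNTM

variable {M : BlindNTM} {n : ℕ} {c c' c'' : M.Config}

theorem Reach.snoc (h : M.Reach n c c') (h' : M.Step c' c'') : M.Reach (n + 1) c c'' := by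
  induction h with
  | refl c => exact .step h' (.refl _)
  | step hs _ ih => exact .step hs (ih h')

theorem Reach.exists_snoc (h : M.Reach (n + 1) c c'') :
    ∃ c', M.Reach n c c' ∧ M.Step c' c'' := by
  induction n generalizing c with
  | zero =>
    cases h with
    | step hs h =>
      cases h with
      | refl => exact ⟨c, .refl _, hs⟩
  | succ n ih =>
    cases h with
    | step hs h =>
      obtain ⟨c', hr, hs'⟩ := ih h
      exact ⟨c', .step hs hr, hs'⟩

end BlindNTM

/-! ### From hitting sets to blind machines -/

section HitMachine

variable (m : ℕ) (L : List (List (List Bool))) (k : ℕ)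

/-- The transition that chooses the option `row` for the slot `i`, and records the clauses it hits
by the symbol `1` on their tapes. -/
def hitTransition (i : Fin k) (row : List Bool) : Transition (m + 1) 2 (k + 2) where
  read _ := none
  src := ⟨i, by omega⟩
  write t := if row.getD t false then some 1 else none
  tgt := ⟨i + 1, by omega⟩
  move _ := 0

/-- The transition that checks that all clauses are hit. -/
def hitCheck : Transition (m + 1) 2 (k + 2) where
  read t := if t < m then some 1 else none
  src := ⟨k, by omega⟩
  write _ := none
  tgt := ⟨k + 1, by omega⟩
  move _ := 0

/-- The machine that chooses an option for each of the `k` slots and then checks that all clauses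
are hit. It has one tape for each clause, and a spare one as there may be no clauses. -/
abbrev hitMachine : BlindNTM where
  tapes := m + 1
  symbols := 2
  states := k + 2
  tapes_pos := by omega
  blank := 0
  start := 0
  accepting q := q.val == k + 1
  delta := ((List.finRange k).flatMap fun i : Fin k => (L.getD i []).map fun row =>
    hitTransition m k i row) ++ [hitCheck m k]

variable {m L k}

theorem mem_hitMachine_delta {δ : Transition (m + 1) 2 (k + 2)} :
    δ ∈ (hitMachine m L k).delta ↔
      (∃ i : Fin k, ∃ row ∈ L.getD i [], hitTransition m k i row = δ) ∨ δ = hitCheck m k := by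
  simp only [hitMachine, List.mem_append, List.mem_flatMap, List.mem_map, List.mem_finRange,
    true_and, List.mem_singleton]

theorem enc_hitTransition (i : Fin k) (row : List Bool) : enc (hitTransition m k i row) =
    enc ((List.range (m + 1)).map (fun _ => (none : Option ℕ)), i.val,
      (List.range (m + 1)).map (fun t => bif row.getD t false then some 1 else none), i.val + 1,
      (List.range (m + 1)).map fun _ => 0) := by
  refine enc_pair_congr (enc_fun_eq_enc_map_range fun _ => rfl) (enc_pair_congr rfl
    (enc_pair_congr (enc_fun_eq_enc_map_range fun t => ?_) (enc_pair_congr rfl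
      (enc_fun_eq_enc_map_range fun _ => rfl))))
  simp only [hitTransition]
  cases row.getD t false <;> rfl

theorem enc_hitCheck : enc (hitCheck m k) =
    enc ((List.range (m + 1)).map (fun t => bif Nat.blt t m then some 1 else none), k,
      (List.range (m + 1)).map (fun _ => (none : Option ℕ)), k + 1,
      (List.range (m + 1)).map fun _ => 0) := by
  refine enc_pair_congr (enc_fun_eq_enc_map_range fun t => ?_) (enc_pair_congr rfl
    (enc_pair_congr (enc_fun_eq_enc_map_range fun _ => rfl) (enc_pair_congr rfl
      (enc_fun_eq_enc_map_range fun _ => rfl))))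
  simp only [hitCheck, ← nat_blt_iff]
  cases Nat.blt t m <;> rfl

theorem polyTime_hitMachine : PolyTime (fun p : (ℕ × List (List (List Bool))) × ℕ =>
    ((⟨hitMachine p.1.1 p.1.2 p.2, []⟩ : BlindInstance), p.2 + 1)) := by
  have hraw : PolyTime (fun p : (ℕ × List (List (List Bool))) × ℕ =>
      (((p.1.1 + 1, 2, p.2 + 2),
        (0, 0, (List.range (p.2 + 2)).map (fun q => q == p.2 + 1),
          ((List.range p.2).flatMap fun i => (p.1.2.getD i []).map fun row =>
              ((List.range (p.1.1 + 1)).map fun _ => (none : Option ℕ), i,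
                (List.range (p.1.1 + 1)).map fun t => bif row.getD t false then some 1 else none,
                i + 1, (List.range (p.1.1 + 1)).map fun _ => 0)) ++
            [((List.range (p.1.1 + 1)).map fun t => bif Nat.blt t p.1.1 then some 1 else none, p.2,
              (List.range (p.1.1 + 1)).map fun _ => (none : Option ℕ), p.2 + 1,
              (List.range (p.1.1 + 1)).map fun _ => 0)],
          ([] : List ℕ))), p.2 + 1)) := by
    fun_prop
  refine hraw.congr_enc ?_
  rintro ⟨⟨m, L⟩, k⟩
  refine enc_pair_congr (congrArg₂ Val.cons rfl (enc_pair_congr rfl (enc_pair_congr rfl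
    (enc_pair_congr (enc_fun_eq_enc_map_range fun _ => rfl)
      (enc_pair_congr (enc_list_congr ?_) rfl))))) rfl
  simp only [hitMachine, List.map_append, List.map_flatMap, List.map_map, List.map_singleton]
  congr 1
  · rw [List.flatMap_def, List.flatMap_def, map_range_eq_ofFn, List.ofFn_eq_map]
    exact congrArg List.flatten (List.map_congr_left fun i _ =>
      List.map_congr_left fun row _ => enc_hitTransition i row)
  · rw [enc_hitCheck]

variable (m L k) in
/-- The configuration after the options `f 0, …, f (n - 1)` have been chosen. -/
def hitConfig (f : ℕ → List Bool) (n : ℕ) (hn : n < k + 2) : (hitMachine m L k).Config where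
  state := ⟨n, hn⟩
  head _ := 0
  cell t l := if l = 0 ∧ ∃ i < n, (f i).getD t.val false = true then (1 : Fin 2) else (0 : Fin 2)

theorem hitMachine_init (f : ℕ → List Bool) :
    (hitMachine m L k).init [] = hitConfig m L k f 0 (by omega) := by
  simp [BlindNTM.init, hitConfig, hitMachine]

theorem hitConfig_congr {f g : ℕ → List Bool} {n : ℕ} (hn : n < k + 2)
    (h : ∀ i < n, f i = g i) : hitConfig m L k f n hn = hitConfig m L k g n hn := by
  have hcell (t) : (∃ i < n, (f i).getD t false = true) ↔ ∃ i < n, (g i).getD t false = true :=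
    exists_congr fun i => and_congr_right fun hi => by rw [h i hi]
  simp only [hitConfig, hcell]

theorem apply_hitTransition (f : ℕ → List Bool) (i : Fin k) :
    (hitMachine m L k).apply (hitTransition m k i (f i)) (hitConfig m L k f i (by omega)) =
      hitConfig m L k f (i + 1) (by omega) := by
  simp only [BlindNTM.apply, hitConfig, hitTransition]
  congr 1
  funext t l
  by_cases hl : l = 0
  · subst hl
    simp only [Function.update_self, true_and, Nat.exists_lt_succ_right]
    cases (f i).getD t.val false <;> simp
  · simp [hl]

theorem applicable_hitCheck_iff {f : ℕ → List Bool} {n : ℕ} {hn : n < k + 2} :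
    (hitMachine m L k).Applicable (hitCheck m k) (hitConfig m L k f n hn) ↔
      n = k ∧ ∀ c < m, ∃ i < n, (f i).getD c false = true := by
  refine and_congr Fin.ext_iff ⟨fun h c hc => ?_, fun h t => ?_⟩
  · simpa [hitCheck, hitConfig, hc] using h ⟨c, Nat.lt_succ_of_lt hc⟩
  · by_cases ht : t.val < m
    · simpa [hitCheck, hitConfig, ht] using h t ht
    · simp [hitCheck, ht]

theorem step_hitConfig {f : ℕ → List Bool} (hf : ∀ i < k, f i ∈ L.getD i []) {n : ℕ}
    (hn : n < k) : (hitMachine m L k).Step (hitConfig m L k f n (by omega))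
      (hitConfig m L k f (n + 1) (by omega)) :=
  ⟨hitTransition m k ⟨n, hn⟩ (f n), mem_hitMachine_delta.2 (.inl ⟨⟨n, hn⟩, f n, hf n hn, rfl⟩),
    ⟨rfl, fun _ => .inl rfl⟩, (apply_hitTransition f ⟨n, hn⟩).symm⟩

theorem reach_hitConfig {f : ℕ → List Bool} (hf : ∀ i < k, f i ∈ L.getD i []) {n : ℕ}
    (hn : n ≤ k) : (hitMachine m L k).Reach n ((hitMachine m L k).init [])
      (hitConfig m L k f n (by omega)) := by
  induction n with
  | zero => rw [hitMachine_init f]; exact .refl _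
  | succ n ih => exact (ih (by omega)).snoc (step_hitConfig hf hn)

theorem hitConfig_or_yes_of_reach {n : ℕ} {c : (hitMachine m L k).Config}
    (h : (hitMachine m L k).Reach n ((hitMachine m L k).init []) c) :
    (∃ (f : ℕ → List Bool) (hn : n < k + 1), (∀ i < n, f i ∈ L.getD i []) ∧
      c = hitConfig m L k f n (by omega)) ∨
    (c.state.val = k + 1 ∧ ColoredHittingSet.Yes (m, L) k) := by
  induction n generalizing c with
  | zero =>
    cases h with
    | refl => exact .inl ⟨fun _ => [], by omega, by simp, hitMachine_init _⟩
  | succ n ih =>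
    obtain ⟨c', hc', δ, hδ, happ, rfl⟩ := h.exists_snoc
    obtain ⟨f, hn, hf, rfl⟩ | ⟨hstate, -⟩ := ih hc'
    · obtain ⟨i, row, hrow, rfl⟩ | rfl := mem_hitMachine_delta.1 hδ
      · obtain rfl : n = i.val := congrArg Fin.val happ.1
        set g := Function.update f i row
        have hgi : g i = row := Function.update_self ..
        have hgj (j) (hj : j < i.val) : f j = g j := (Function.update_of_ne hj.ne ..).symm
        refine .inl ⟨g, by omega, Nat.forall_lt_succ_right.2 ⟨fun j hj => ?_, hgi ▸ hrow⟩, ?_⟩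
        · exact hgj j hj ▸ hf j hj
        · rw [hitConfig_congr _ hgj, ← hgi]
          exact apply_hitTransition g i
      · obtain ⟨rfl, hhit⟩ := applicable_hitCheck_iff.1 happ
        exact .inr ⟨rfl, f, hf, hhit⟩
    · have hsrc : δ.src.val = k + 1 := (congrArg Fin.val happ.1).symm.trans hstate
      obtain ⟨i, row, -, rfl⟩ | rfl := mem_hitMachine_delta.1 hδ
      · exact absurd hsrc (by simp only [hitTransition]; omega)
      · exact absurd hsrc (by simp only [hitCheck]; omega)

theorem hitMachine_acceptsWithin_iff : (hitMachine m L k).AcceptsWithin [] (k + 1) ↔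
    ColoredHittingSet.Yes (m, L) k := by
  constructor
  · rintro ⟨n, -, c, hr, hacc⟩
    obtain ⟨f, hn, -, rfl⟩ | ⟨-, h⟩ := hitConfig_or_yes_of_reach hr
    · exact absurd (beq_iff_eq.1 hacc) (by simp only [hitConfig]; omega)
    · exact h
  · rintro ⟨f, hf, hhit⟩
    exact ⟨k + 1, le_rfl, _, (reach_hitConfig hf le_rfl).snoc ⟨hitCheck m k,
      mem_hitMachine_delta.2 (.inr rfl), applicable_hitCheck_iff.2 ⟨rfl, hhit⟩, rfl⟩,
      beq_self_eq_true (k + 1)⟩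

end HitMachine

theorem coloredHittingSet_reducible_shortBlind :
    FPTReducible ColoredHittingSet ShortBlindMultiTapeNTM :=
  .of_polyTime polyTime_hitMachine Computable.succ (fun _ _ => le_rfl)
    fun _ _ => hitMachine_acceptsWithin_iff.symm

/-! ### Values of the wires of a circuit -/

section WireValues

variable {α : Type} {d : α} {op : Gate → (ℕ → α) → α} {init : List α}

theorem wireValues_snoc (gates : List Gate) (g : Gate) :
    wireValues d op init (gates ++ [g]) = wireValues d op init gates ++
      [op g fun i => (wireValues d op init gates).getD i d] := by
  simp only [wireValues, List.foldl_append, List.foldl_cons, List.foldl_nil]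

theorem length_wireValues (gates : List Gate) :
    (wireValues d op init gates).length = init.length + gates.length := by
  induction gates using List.reverseRecOn with
  | nil => rfl
  | append_singleton gates g ih => simp [wireValues_snoc, ih, add_assoc]

theorem wireValues_snoc_getD {gates : List Gate} {g : Gate} {j : ℕ}
    (hj : j < init.length + gates.length) :
    (wireValues d op init (gates ++ [g])).getD j d = (wireValues d op init gates).getD j d := by
  rw [wireValues_snoc, List.getD_append _ _ _ _ (by rwa [length_wireValues])]

theorem wireValues_input (gates : List Gate) {j : ℕ} (hj : j < init.length) :
    (wireValues d op init gates).getD j d = init.getD j d := by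
  induction gates using List.reverseRecOn with
  | nil => rfl
  | append_singleton gates g ih => rw [wireValues_snoc_getD (Nat.lt_add_right _ hj), ih]

theorem wireValues_gate (hop : ∀ g v v', (∀ a ∈ g.args, v a = v' a) → op g v = op g v')
    (gates : List Gate)
    (hac : ∀ (i : ℕ) (hi : i < gates.length), ∀ a ∈ gates[i].args, a < init.length + i)
    {i : ℕ} (hi : i < gates.length) :
    (wireValues d op init gates).getD (init.length + i) d =
      op gates[i] fun j => (wireValues d op init gates).getD j d := by
  induction gates using List.reverseRecOn with
  | nil => exact absurd hi (Nat.not_lt_zero i)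
  | append_singleton gates g ih =>
    rw [List.length_append, List.length_singleton] at hi
    rw [hop _ _ _ fun a ha => wireValues_snoc_getD ((hac i _ a ha).trans_le (by omega))]
    obtain hi' | rfl := Nat.lt_succ_iff_lt_or_eq.1 hi
    · rw [wireValues_snoc_getD (by omega), List.getElem_append_left hi']
      refine ih (fun j hj a ha => hac j ?_ a ?_) hi'
      · rw [List.length_append]
        omega
      · rwa [List.getElem_append_left hj]
    · rw [wireValues_snoc, List.getD_append_right _ _ _ _ (by rw [length_wireValues]),
        length_wireValues]
      simp

end WireValues

theorem maxOver_le_iff {v : ℕ → ℕ} {l : List ℕ} {B : ℕ} :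
    maxOver v l ≤ B ↔ ∀ a ∈ l, v a ≤ B := by
  induction l with
  | nil => simp [maxOver]
  | cons a l ih => rw [List.forall_mem_cons, ← ih]; exact max_le_iff

theorem maxOver_congr {v v' : ℕ → ℕ} {l : List ℕ} (h : ∀ a ∈ l, v a = v' a) :
    maxOver v l = maxOver v' l :=
  eq_of_forall_ge_iff fun B => by
    rw [maxOver_le_iff, maxOver_le_iff]
    exact forall₂_congr fun a ha => by rw [h a ha]

/-- The conjunction (for `b = true`) or disjunction (for `b = false`) of the values of `f` on a
list. -/
def aggr {β : Type} (b : Bool) (f : β → Bool) (l : List β) : Bool :=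
  bif b then l.all f else l.any f

theorem aggr_congr {β : Type} {b : Bool} {f g : β → Bool} {l : List β} (h : ∀ a ∈ l, f a = g a) :
    aggr b f l = aggr b g l := by
  rw [Bool.eq_iff_iff]
  cases b
  · simp only [aggr, cond_false, List.any_eq_true]
    exact exists_congr fun a => and_congr_right fun ha => by rw [h a ha]
  · simp only [aggr, cond_true, List.all_eq_true]
    exact forall₂_congr fun a ha => by rw [h a ha]

theorem Gate.eval_congr {g : Gate} {v v' : ℕ → Bool} (h : ∀ a ∈ g.args, v a = v' a) :
    g.eval v = g.eval v' := by
  cases g with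
  | not a => exact congrArg (!·) (h a List.mem_cons_self)
  | and l => exact aggr_congr (b := true) h
  | or l => exact aggr_congr (b := false) h

namespace Circuit

variable (C : Circuit)

/-- The gate that computes the wire `w`, with a junk value if `w` is an input or out of range. -/
def gate (w : ℕ) : Gate := C.gates.getD (w - C.inputs) (.or [])

/-- The wire `w` is computed by a gate. -/
def IsGate (w : ℕ) : Prop := C.inputs ≤ w ∧ w < C.inputs + C.gates.length

/-- The value of a wire on the input vector `x`. -/
def val (x : Fin C.inputs → Bool) (w : ℕ) : Bool :=
  (wireValues false (fun g v => g.eval v) (List.ofFn x) C.gates).getD w false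

/-- The depth of a wire. -/
def wireDepth (w : ℕ) : ℕ :=
  (wireValues 0 (fun g v => maxOver v g.args + 1) (List.replicate C.inputs 0) C.gates).getD w 0

/-- The weft of a wire. -/
def wireWeft (w : ℕ) : ℕ :=
  (wireValues 0 (fun g v => maxOver v g.args + (if g.isLarge then 1 else 0))
    (List.replicate C.inputs 0) C.gates).getD w 0

variable {C} {w : ℕ}

theorem gate_add {i : ℕ} (hi : i < C.gates.length) : C.gate (C.inputs + i) = C.gates[i] := by
  rw [gate, Nat.add_sub_cancel_left, List.getD_eq_getElem _ _ hi]

theorem IsGate.lt_of_mem_args (hw : C.IsGate w) {a : ℕ} (ha : a ∈ (C.gate w).args) : a < w := by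
  obtain ⟨i, rfl⟩ := Nat.exists_eq_add_of_le hw.1
  have hi : i < C.gates.length := Nat.lt_of_add_lt_add_left hw.2
  exact C.acyclic i hi a (gate_add hi ▸ ha)

theorem wireValues_isGate {α : Type} {d : α} {op : Gate → (ℕ → α) → α} {init : List α}
    (hinit : init.length = C.inputs)
    (hop : ∀ g v v', (∀ a ∈ g.args, v a = v' a) → op g v = op g v') (hw : C.IsGate w) :
    (wireValues d op init C.gates).getD w d =
      op (C.gate w) fun j => (wireValues d op init C.gates).getD j d := by
  obtain ⟨i, rfl⟩ := Nat.exists_eq_add_of_le hw.1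
  have hi : i < C.gates.length := Nat.lt_of_add_lt_add_left hw.2
  rw [gate_add hi, ← hinit]
  exact wireValues_gate hop C.gates (hinit ▸ C.acyclic) hi

theorem val_input (x : Fin C.inputs → Bool) (a : Fin C.inputs) : C.val x a = x a := by
  rw [val, wireValues_input _ (by simp)]
  simp

theorem wireDepth_input (hw : w < C.inputs) : C.wireDepth w = 0 := by
  rw [wireDepth, wireValues_input _ (by simpa using hw)]
  simp [hw]

theorem wireWeft_input (hw : w < C.inputs) : C.wireWeft w = 0 := by
  rw [wireWeft, wireValues_input _ (by simpa using hw)]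
  simp [hw]

theorem IsGate.val_eq (hw : C.IsGate w) (x : Fin C.inputs → Bool) :
    C.val x w = (C.gate w).eval (C.val x) :=
  wireValues_isGate List.length_ofFn (fun _ _ _ h => Gate.eval_congr h) hw

theorem IsGate.wireDepth_eq (hw : C.IsGate w) :
    C.wireDepth w = maxOver C.wireDepth (C.gate w).args + 1 :=
  wireValues_isGate List.length_replicate (fun _ _ _ h => by rw [maxOver_congr h]) hw

theorem IsGate.wireWeft_eq (hw : C.IsGate w) :
    C.wireWeft w = maxOver C.wireWeft (C.gate w).args + (if (C.gate w).isLarge then 1 else 0) :=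
  wireValues_isGate (op := fun g v => maxOver v g.args + (if g.isLarge then 1 else 0))
    List.length_replicate (fun _ _ _ h => by rw [maxOver_congr h]) hw

end Circuit

/-! ### From hitting sets to circuits -/

/-- The circuit of the conjunction of the positive clauses in `ors`. -/
abbrev cnfCircuit (n : ℕ) (ors : List (List ℕ)) (h : ∀ l ∈ ors, ∀ a ∈ l, a < n) : Circuit where
  inputs := n
  gates := ors.map Gate.or ++ [Gate.and ((List.range ors.length).map fun i => n + i)]
  output := n + ors.length
  acyclic i hi a ha := by
    obtain hi' | rfl : i < ors.length ∨ i = ors.length := by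
      simp only [List.length_append, List.length_map, List.length_singleton] at hi
      omega
    · rw [List.getElem_append_left (by simpa using hi'), List.getElem_map] at ha
      exact Nat.lt_add_right i (h _ (List.getElem_mem hi') a ha)
    · rw [List.getElem_append_right (by simp)] at ha
      obtain ⟨j, hj, rfl⟩ : ∃ j < ors.length, n + j = a := by simpa [Gate.args] using ha
      exact Nat.add_lt_add_left hj n
  output_lt := by simp

section CnfCircuit

variable {n : ℕ} {ors : List (List ℕ)} (h : ∀ l ∈ ors, ∀ a ∈ l, a < n)

theorem cnfCircuit_isGate {i : ℕ} (hi : i ≤ ors.length) : (cnfCircuit n ors h).IsGate (n + i) := by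
  simp only [Circuit.IsGate, List.length_append, List.length_map,
    List.length_singleton]
  omega

theorem cnfCircuit_gate_clause {i : ℕ} (hi : i < ors.length) :
    (cnfCircuit n ors h).gate (n + i) = Gate.or ors[i] := by
  simp [Circuit.gate, List.getElem?_append_left, hi]

theorem cnfCircuit_gate_output :
    (cnfCircuit n ors h).gate (n + ors.length) =
      Gate.and ((List.range ors.length).map fun i => n + i) := by
  simp [Circuit.gate]

theorem cnfCircuit_val_clause (x : Fin n → Bool) {i : ℕ} (hi : i < ors.length) :
    (cnfCircuit n ors h).val x (n + i) = true ↔ ∃ a : Fin n, a.val ∈ ors[i] ∧ x a = true := by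
  have hinput (a : Fin n) : (cnfCircuit n ors h).val x a = x a :=
    Circuit.val_input (C := cnfCircuit n ors h) x a
  rw [(cnfCircuit_isGate h hi.le).val_eq, cnfCircuit_gate_clause h hi, Gate.eval,
    List.any_eq_true]
  constructor
  · rintro ⟨a, ha, hx⟩
    lift a to Fin n using h _ (List.getElem_mem hi) a ha
    exact ⟨a, ha, hinput a ▸ hx⟩
  · rintro ⟨a, ha, hx⟩
    exact ⟨a, ha, (hinput a).trans hx⟩

theorem cnfCircuit_eval (x : Fin n → Bool) :
    (cnfCircuit n ors h).eval x = true ↔ ∀ l ∈ ors, ∃ a : Fin n, a.val ∈ l ∧ x a = true := by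
  change (cnfCircuit n ors h).val x (n + ors.length) = true ↔ _
  rw [(cnfCircuit_isGate h le_rfl).val_eq, cnfCircuit_gate_output, Gate.eval, List.all_map,
    List.all_eq_true, List.forall_mem_iff_forall_getElem (l := ors)]
  simp only [List.mem_range, Function.comp_apply]
  exact forall₂_congr fun i hi => cnfCircuit_val_clause h x hi

theorem cnfCircuit_depth_le : (cnfCircuit n ors h).depth ≤ 2 := by
  change (cnfCircuit n ors h).wireDepth (n + ors.length) ≤ 2
  rw [(cnfCircuit_isGate h le_rfl).wireDepth_eq, cnfCircuit_gate_output, Nat.succ_le_succ_iff,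
    maxOver_le_iff, Gate.args, List.forall_mem_map]
  intro i hi
  have hi' := List.mem_range.1 hi
  rw [(cnfCircuit_isGate h hi'.le).wireDepth_eq, cnfCircuit_gate_clause h hi',
    Nat.succ_le_succ_iff, maxOver_le_iff]
  exact fun a ha => (Circuit.wireDepth_input (h _ (List.getElem_mem _) a ha)).le

theorem cnfCircuit_weft_le : (cnfCircuit n ors h).weft ≤ 2 := by
  have hlarge (g : Gate) : (if g.isLarge then 1 else 0) ≤ 1 := by split_ifs <;> omega
  change (cnfCircuit n ors h).wireWeft (n + ors.length) ≤ 1 + 1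
  rw [(cnfCircuit_isGate h le_rfl).wireWeft_eq, cnfCircuit_gate_output]
  refine Nat.add_le_add (maxOver_le_iff.2 ?_) (hlarge _)
  rw [Gate.args, List.forall_mem_map]
  intro i hi
  have hi' := List.mem_range.1 hi
  rw [(cnfCircuit_isGate h hi'.le).wireWeft_eq, cnfCircuit_gate_clause h hi', ← zero_add 1]
  refine Nat.add_le_add (maxOver_le_iff.2 fun a ha => ?_) (hlarge _)
  exact (Circuit.wireWeft_input (h _ (List.getElem_mem _) a ha)).le

end CnfCircuit

section HitCircuit

/-- The list of all options, each with its slot; they are the inputs of the circuit. -/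
def hitOptions (L : List (List (List Bool))) (k : ℕ) : List (ℕ × List Bool) :=
  (List.range k).flatMap fun i => (L.getD i []).map fun row => (i, row)

/-- The clauses that say that every slot gets an option and every clause is hit. -/
def hitClauses (m : ℕ) (L : List (List (List Bool))) (k : ℕ) : List (List ℕ) :=
  ((List.range k).map fun i => (List.range (hitOptions L k).length).filter fun p =>
    ((hitOptions L k).getD p (0, [])).1 == i) ++
  ((List.range m).map fun c => (List.range (hitOptions L k).length).filter fun p =>
    ((hitOptions L k).getD p (0, [])).2.getD c false)

variable {m : ℕ} {L : List (List (List Bool))} {k : ℕ}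

theorem mem_hitOptions {o : ℕ × List Bool} :
    o ∈ hitOptions L k ↔ o.1 < k ∧ o.2 ∈ L.getD o.1 [] := by
  simp only [hitOptions, List.mem_flatMap, List.mem_range, List.mem_map]
  constructor
  · rintro ⟨i, hi, row, hrow, rfl⟩
    exact ⟨hi, hrow⟩
  · rintro ⟨hi, hrow⟩
    exact ⟨o.1, hi, o.2, hrow, rfl⟩

theorem hitClauses_lt : ∀ l ∈ hitClauses m L k, ∀ a ∈ l, a < (hitOptions L k).length := by
  intro l hl a ha
  simp only [hitClauses, List.mem_append, List.mem_map] at hl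
  obtain ⟨_, -, rfl⟩ | ⟨_, -, rfl⟩ := hl <;>
    exact List.mem_range.1 (List.mem_of_mem_filter ha)

variable (m L k) in
/-- The circuit that accepts a set of options iff it contains one for every slot and hits every
clause. -/
def hitCircuit : {C : Circuit // C.weft ≤ 2 ∧ C.depth ≤ 2} :=
  ⟨cnfCircuit (hitOptions L k).length (hitClauses m L k) hitClauses_lt,
    cnfCircuit_weft_le _, cnfCircuit_depth_le _⟩

@[fun_prop]
theorem polyTime_hitOptions {α : Type} [TreeEnc α] {L : α → List (List (List Bool))}
    {k : α → ℕ} (hL : PolyTime L) (hk : PolyTime k) :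
    PolyTime (fun a => hitOptions (L a) (k a)) := by
  unfold hitOptions
  fun_prop

@[fun_prop]
theorem polyTime_hitClauses {α : Type} [TreeEnc α] {m : α → ℕ}
    {L : α → List (List (List Bool))} {k : α → ℕ} (hm : PolyTime m) (hL : PolyTime L)
    (hk : PolyTime k) : PolyTime (fun a => hitClauses (m a) (L a) (k a)) := by
  unfold hitClauses
  fun_prop

theorem polyTime_hitCircuit : PolyTime (fun p : (ℕ × List (List (List Bool))) × ℕ =>
    (hitCircuit p.1.1 p.1.2 p.2, p.2)) := by
  have hraw : PolyTime (fun p : (ℕ × List (List (List Bool))) × ℕ =>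
      (((hitOptions p.1.2 p.2).length,
        ((hitClauses p.1.1 p.1.2 p.2).map fun l => (2, l)) ++
          [(1, (List.range (hitClauses p.1.1 p.1.2 p.2).length).map
            fun i => (hitOptions p.1.2 p.2).length + i)],
        (hitOptions p.1.2 p.2).length + (hitClauses p.1.1 p.1.2 p.2).length), p.2)) := by
    fun_prop
  refine hraw.congr_enc fun p => enc_pair_congr
    (enc_pair_congr rfl (enc_pair_congr (enc_list_congr ?_) rfl)) rfl
  simp only [hitCircuit, cnfCircuit, List.map_append, List.map_map, List.map_cons, List.map_nil]
  rfl

theorem hitCircuit_yes_iff_exists_selection :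
    (WeightedCircuitSat 2 2).Yes (hitCircuit m L k) k ↔
      ∃ x : Fin (hitOptions L k).length → Bool, (Finset.univ.filter fun a => x a = true).card = k ∧
        (∀ i < k, ∃ a, (hitOptions L k)[a].1 = i ∧ x a = true) ∧
        ∀ c < m, ∃ a, (hitOptions L k)[a].2.getD c false = true ∧ x a = true := by
  change (∃ x : Fin (hitOptions L k).length → Bool,
    (Finset.univ.filter fun a => x a = true).card = k ∧
      (cnfCircuit _ _ hitClauses_lt).eval x = true) ↔ _
  have hget (a : Fin (hitOptions L k).length) :
      (hitOptions L k).getD a (0, []) = (hitOptions L k)[a] := List.getD_eq_getElem _ _ a.2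
  refine exists_congr fun x => and_congr_right fun _ => ?_
  rw [cnfCircuit_eval]
  simp only [hitClauses, List.mem_append, or_imp, forall_and,
    List.forall_mem_map, List.mem_filter, List.mem_range, Fin.is_lt, true_and, hget, beq_iff_eq]

theorem hitCircuit_yes_of_coloredHittingSet (h : ColoredHittingSet.Yes (m, L) k) :
    (WeightedCircuitSat 2 2).Yes (hitCircuit m L k) k := by
  obtain ⟨f, hf, hhit⟩ := h
  have hoption (i : Fin k) : ∃ a : Fin (hitOptions L k).length,
      (hitOptions L k)[a] = (i.val, f i) := by
    obtain ⟨a, ha, heq⟩ := List.getElem_of_mem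
      (mem_hitOptions.2 ⟨i.2, hf i i.2⟩ : (i.val, f i) ∈ hitOptions L k)
    exact ⟨⟨a, ha⟩, heq⟩
  choose p hp using hoption
  have hinj : Function.Injective p := fun i j hij =>
    Fin.ext (congrArg Prod.fst ((hp i).symm.trans (hij ▸ hp j)))
  refine hitCircuit_yes_iff_exists_selection.2 ⟨fun a => decide (a ∈ Finset.univ.image p), ?_,
    fun i hi => ⟨p ⟨i, hi⟩, by rw [hp], by simp⟩, fun c hc => ?_⟩
  · simp only [decide_eq_true_eq, Finset.filter_univ_mem]
    rw [Finset.card_image_of_injective _ hinj, Finset.card_univ, Fintype.card_fin]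
  · obtain ⟨i, hi, hic⟩ := hhit c hc
    exact ⟨p ⟨i, hi⟩, by rwa [hp], by simp⟩

-- `k` slots and `k` chosen options, so that no slot has two options.
theorem coloredHittingSet_of_hitCircuit_yes
    (h : (WeightedCircuitSat 2 2).Yes (hitCircuit m L k) k) :
    ColoredHittingSet.Yes (m, L) k := by
  obtain ⟨x, hcard, hslot, hhit⟩ := hitCircuit_yes_iff_exists_selection.1 h
  choose p hpi hp using fun i : Fin k => hslot i i.2
  have hinj : Function.Injective p := fun i j hij =>
    Fin.ext ((hpi i).symm.trans (hij ▸ hpi j))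
  have himage : Finset.univ.image p = Finset.univ.filter fun a => x a = true := by
    refine Finset.eq_of_subset_of_card_le (Finset.image_subset_iff.2 fun i _ => by simp [hp i]) ?_
    rw [hcard, Finset.card_image_of_injective _ hinj, Finset.card_univ, Fintype.card_fin]
  refine ⟨fun i => if hi : i < k then (hitOptions L k)[p ⟨i, hi⟩].2 else [], fun i hi => ?_,
    fun c hc => ?_⟩
  · have hmem : (hitOptions L k)[p ⟨i, hi⟩] ∈ hitOptions L k := List.getElem_mem _
    have hrow := (mem_hitOptions.1 hmem).2
    rw [hpi] at hrow
    simpa [hi] using hrow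
  · obtain ⟨a, hac, hxa⟩ := hhit c hc
    have hmem : a ∈ Finset.univ.image p := by rw [himage]; simp [hxa]
    obtain ⟨i, -, rfl⟩ := Finset.mem_image.1 hmem
    exact ⟨i, i.2, by simpa using hac⟩

end HitCircuit

theorem coloredHittingSet_reducible_circuitSat :
    FPTReducible ColoredHittingSet (WeightedCircuitSat 2 2) :=
  .of_polyTime polyTime_hitCircuit Computable.id (fun _ _ => le_rfl)
    fun _ _ => ⟨hitCircuit_yes_of_coloredHittingSet, coloredHittingSet_of_hitCircuit_yes⟩

/-! ### Normal forms of circuits of bounded depth -/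

section NormalForms

variable {β γ : Type}

theorem aggr_flatMap (b : Bool) (f : γ → Bool) (F : β → List γ) (l : List β) :
    aggr b f (l.flatMap F) = aggr b (fun a => aggr b f (F a)) l := by
  cases b <;> simp [aggr, List.any_flatMap, List.all_flatMap]

theorem not_aggr (b : Bool) (f : β → Bool) (l : List β) :
    (!aggr b f l) = aggr (!b) (fun a => !f a) l := by
  cases b <;> simp [aggr, List.any_eq_not_all_not]

theorem aggr_beq (b s : Bool) (f : β → Bool) (l : List β) :
    (aggr b f l == s) = aggr (b == s) (fun a => f a == s) l := by
  cases s
  · simpa using not_aggr b f l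
  · simp

/-- The value of the conjunction of disjunctions (for `pol = true`) or disjunction of conjunctions
(for `pol = false`) of the values of `ev`. -/
def nfEval (pol : Bool) (ev : β → Bool) (D : List (List β)) : Bool :=
  aggr pol (aggr (!pol) ev) D

theorem nfEval_flatMap (pol : Bool) (ev : γ → Bool) (F : β → List (List γ)) (l : List β) :
    nfEval pol ev (l.flatMap F) = aggr pol (fun a => nfEval pol ev (F a)) l :=
  aggr_flatMap _ _ _ _

theorem nfEval_singleton (pol : Bool) (ev : β → Bool) (a : β) : nfEval pol ev [[a]] = ev a := by
  cases pol <;> simp [nfEval, aggr]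

theorem nfEval_nil (pol : Bool) (ev : β → Bool) : nfEval pol ev [[]] = !pol := by
  cases pol <;> simp [nfEval, aggr]

theorem not_nfEval (pol : Bool) (ev : β → Bool) (D : List (List β)) :
    (!nfEval pol ev D) = nfEval (!pol) (fun a => !ev a) D := by
  simp only [nfEval, not_aggr]

theorem nfEval_prod_false (ev : β → Bool) (A B : List (List β)) :
    nfEval false ev (A.flatMap fun l => B.map fun l' => l ++ l') =
      (nfEval false ev A && nfEval false ev B) := by
  rw [Bool.eq_iff_iff, Bool.and_eq_true]
  simp only [nfEval, aggr, Bool.not_false, cond_false, cond_true, List.any_eq_true,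
    List.mem_flatMap, List.mem_map]
  constructor
  · rintro ⟨_, ⟨l, hl, l', hl', rfl⟩, h⟩
    rw [List.all_append, Bool.and_eq_true] at h
    exact ⟨⟨l, hl, h.1⟩, ⟨l', hl', h.2⟩⟩
  · rintro ⟨⟨l, hl, h⟩, ⟨l', hl', h'⟩⟩
    exact ⟨_, ⟨l, hl, l', hl', rfl⟩, by rw [List.all_append, h, h']; rfl⟩

theorem nfEval_prod (pol : Bool) (ev : β → Bool) (A B : List (List β)) :
    nfEval pol ev (A.flatMap fun l => B.map fun l' => l ++ l') =
      aggr (!pol) (nfEval pol ev) [A, B] := by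
  cases pol
  · simp [nfEval_prod_false, aggr]
  · rw [← Bool.not_inj_iff, not_nfEval, not_aggr]
    simp only [not_nfEval]
    simp [nfEval_prod_false, aggr]

end NormalForms

/-- The operation of a gate is the negation. -/
def Gate.isNot : Gate → Bool
  | .not _ => true
  | _ => false

/-- The operation of a gate is the conjunction. -/
def Gate.isAnd : Gate → Bool
  | .and _ => true
  | _ => false

theorem Gate.eval_of_isNot {g : Gate} (hg : g.isNot = true) (v : ℕ → Bool) :
    ∃ a, g.args = [a] ∧ g.eval v = !v a := by
  cases g with
  | not a => exact ⟨a, rfl, rfl⟩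
  | and l => cases hg
  | or l => cases hg

theorem Gate.eval_eq_aggr {g : Gate} (hg : g.isNot = false) (v : ℕ → Bool) :
    g.eval v = aggr g.isAnd v g.args := by
  cases g with
  | not a => cases hg
  | and l => rfl
  | or l => rfl

/-- A gate as a pair of its operation and its arguments. -/
def Gate.toPair : Gate → ℕ × List ℕ
  | .not a => (0, [a])
  | .and l => (1, l)
  | .or l => (2, l)

section PolyTime

variable {α : Type} [TreeEnc α]

@[fun_prop]
theorem polyTime_gate_toPair {g : α → Gate} (hg : PolyTime g) :
    PolyTime (fun a => (g a).toPair) :=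
  hg.congr_enc fun a => by cases g a <;> rfl

@[fun_prop]
theorem polyTime_gate_args {g : α → Gate} (hg : PolyTime g) : PolyTime (fun a => (g a).args) := by
  have h : PolyTime (fun a => (g a).toPair.2) := by fun_prop
  exact h.of_eq fun a => by cases g a <;> rfl

@[fun_prop]
theorem polyTime_gate_isNot {g : α → Gate} (hg : PolyTime g) : PolyTime (fun a => (g a).isNot) := by
  have h : PolyTime (fun a => (g a).toPair.1 == 0) := by fun_prop
  exact h.of_eq fun a => by cases g a <;> rfl

@[fun_prop]
theorem polyTime_gate_isAnd {g : α → Gate} (hg : PolyTime g) : PolyTime (fun a => (g a).isAnd) := by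
  have h : PolyTime (fun a => (g a).toPair.1 == 1) := by fun_prop
  exact h.of_eq fun a => by cases g a <;> rfl

@[fun_prop]
theorem polyTime_gate_isLarge {g : α → Gate} (hg : PolyTime g) :
    PolyTime (fun a => (g a).isLarge) := by
  have h : PolyTime (fun a => Nat.blt 2 (g a).args.length) := by fun_prop
  exact h.of_eq fun a => by rw [Gate.isLarge, Bool.eq_iff_iff, decide_eq_true_iff, nat_blt_iff]

variable {C : α → Circuit}

theorem polyTime_circuit_toTriple (hC : PolyTime C) :
    PolyTime (fun a => ((C a).inputs, (C a).gates, (C a).output)) :=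
  hC.congr_enc fun _ => rfl

@[fun_prop]
theorem polyTime_circuit_inputs (hC : PolyTime C) : PolyTime (fun a => (C a).inputs) :=
  (polyTime_circuit_toTriple hC).fst

@[fun_prop]
theorem polyTime_circuit_output (hC : PolyTime C) : PolyTime (fun a => (C a).output) :=
  (polyTime_circuit_toTriple hC).snd.snd

@[fun_prop]
theorem polyTime_circuit_gate (hC : PolyTime C) {w : α → ℕ} (hw : PolyTime w) :
    PolyTime (fun a => (C a).gate (w a)) := by
  have hgates : PolyTime (fun a => (C a).gates) := (polyTime_circuit_toTriple hC).snd.fst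
  unfold Circuit.gate
  fun_prop

end PolyTime

/-- The claim that a wire of a circuit has a certain value. -/
abbrev WireClaim : Type := Circuit × ℕ × Bool

section Norm

variable {X : Type} {pol : Bool} {lower : WireClaim → X}

variable (pol lower) in
/-- A normal form for a claim: a conjunction of disjunctions for `pol = true`, a disjunction of
conjunctions for `pol = false`. Gates that aggregate in the outer way are merged; small gates that
aggregate in the inner way are multiplied out; large ones, and the inputs, are left to `lower`.
The number is a bound on the depth of the wire. -/
def nf : ℕ → WireClaim → List (List X)
  | 0, p => [[lower p]]
  | h + 1, p =>
    let g := p.1.gate p.2.1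
    bif Nat.blt p.2.1 p.1.inputs then [[lower p]]
    else bif g.isNot then nf h (p.1, g.args.headD 0, !p.2.2)
    else bif (g.isAnd == p.2.2) == pol then g.args.flatMap fun a => nf h (p.1, a, p.2.2)
    else bif g.isLarge then [[lower p]]
    else bif g.args.isEmpty then [[]]
    else (nf h (p.1, g.args.headD 0, p.2.2)).flatMap fun l =>
      (nf h (p.1, g.args.getD 1 (g.args.headD 0), p.2.2)).map fun l' => l ++ l'

theorem polyTime_nf [TreeEnc X] (hlower : PolyTime lower) (h : ℕ) :
    PolyTime (nf pol lower h) := by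
  induction h with
  | zero => exact (hlower.listCons (.const [])).listCons (.const [])
  | succ h ih =>
    change PolyTime (fun p => nf pol lower (h + 1) p)
    simp only [nf]
    generalize nf pol lower h = N at ih
    fun_prop

theorem length_le_of_mem_nf {h : ℕ} {p : WireClaim} {l : List X} (hl : l ∈ nf pol lower h p) :
    l.length ≤ 2 ^ h := by
  have hsingle (n : ℕ) {p : WireClaim} {l : List X} (hl : l ∈ [[lower p]]) : l.length ≤ 2 ^ n := by
    rw [List.mem_singleton.1 hl]
    exact Nat.one_le_two_pow
  induction h generalizing p l with
  | zero => exact hsingle 0 hl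
  | succ h ih =>
    have ih' {p : WireClaim} {l : List X} (hl : l ∈ nf pol lower h p) : l.length ≤ 2 ^ (h + 1) :=
      (ih hl).trans (Nat.pow_le_pow_right two_pos h.le_succ)
    simp only [nf, Bool.cond_eq_ite] at hl
    split_ifs at hl
    · exact hsingle _ hl
    · exact ih' hl
    · obtain ⟨a, -, ha⟩ := List.mem_flatMap.1 hl
      exact ih' ha
    · exact hsingle _ hl
    · simp [List.mem_singleton.1 hl]
    · obtain ⟨l₁, hl₁, hl⟩ := List.mem_flatMap.1 hl
      obtain ⟨l₂, hl₂, rfl⟩ := List.mem_map.1 hl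
      rw [List.length_append, pow_succ, mul_two]
      exact Nat.add_le_add (ih hl₁) (ih hl₂)

theorem exists_eq_lower_of_mem_nf {h : ℕ} {p : WireClaim} {l : List X}
    (hl : l ∈ nf pol lower h p) {y : X} (hy : y ∈ l) : ∃ q, y = lower q := by
  have hsingle {p : WireClaim} {l : List X} (hl : l ∈ [[lower p]]) (hy : y ∈ l) :
      ∃ q, y = lower q := by
    rw [List.mem_singleton.1 hl] at hy
    exact ⟨p, List.mem_singleton.1 hy⟩
  induction h generalizing p l with
  | zero => exact hsingle hl hy
  | succ h ih =>
    simp only [nf, Bool.cond_eq_ite] at hl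
    split_ifs at hl
    · exact hsingle hl hy
    · exact ih hl hy
    · obtain ⟨a, -, ha⟩ := List.mem_flatMap.1 hl
      exact ih ha hy
    · exact hsingle hl hy
    · simp [List.mem_singleton.1 hl] at hy
    · obtain ⟨l₁, hl₁, hl⟩ := List.mem_flatMap.1 hl
      obtain ⟨l₂, hl₂, rfl⟩ := List.mem_map.1 hl
      exact (List.mem_append.1 hy).elim (ih hl₁) (ih hl₂)

variable {C : Circuit} {x : Fin C.inputs → Bool} {w : ℕ} {s : Bool}

variable (C) in
/-- The claim that `w` has the value `s` is the conjunction (for `b = true`) or disjunction (for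
`b = false`) of the same claim for the arguments of the gate of `w`. -/
structure Circuit.IsAggr (b : Bool) (w : ℕ) (s : Bool) : Prop where
  isGate : C.IsGate w
  isNot_eq : (C.gate w).isNot = false
  isAnd_beq : ((C.gate w).isAnd == s) = b

theorem Circuit.IsAggr.val_beq {b : Bool} (hw : C.IsAggr b w s) :
    (C.val x w == s) = aggr b (fun a => C.val x a == s) (C.gate w).args := by
  rw [hw.isGate.val_eq, Gate.eval_eq_aggr hw.isNot_eq, aggr_beq, hw.isAnd_beq]

theorem nf_succ_of_lt (hw : w < C.inputs) (h : ℕ) :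
    nf pol lower (h + 1) (C, w, s) = [[lower (C, w, s)]] := by
  simp only [nf, nat_blt_iff.2 hw, cond_true]

theorem nf_succ_of_isNot (hw : C.IsGate w) (hnot : (C.gate w).isNot = true) (h : ℕ) :
    nf pol lower (h + 1) (C, w, s) = nf pol lower h (C, (C.gate w).args.headD 0, !s) := by
  simp only [nf, Bool.cond_eq_ite, nat_blt_iff, hw.1.not_gt, hnot, if_true, if_false]

theorem nf_succ_of_outer (hw : C.IsAggr pol w s) (h : ℕ) :
    nf pol lower (h + 1) (C, w, s) =
      (C.gate w).args.flatMap fun a => nf pol lower h (C, a, s) := by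
  simp [nf, Bool.cond_eq_ite, hw.isGate.1.not_gt, hw.isNot_eq, hw.isAnd_beq]

theorem nf_succ_of_inner (hw : C.IsAggr (!pol) w s) (h : ℕ) :
    nf pol lower (h + 1) (C, w, s) =
      if (C.gate w).isLarge then [[lower (C, w, s)]]
      else if (C.gate w).args.isEmpty then [[]]
      else (nf pol lower h (C, (C.gate w).args.headD 0, s)).flatMap fun l =>
        (nf pol lower h (C, (C.gate w).args.getD 1 ((C.gate w).args.headD 0), s)).map
          fun l' => l ++ l' := by
  simp [nf, Bool.cond_eq_ite, hw.isGate.1.not_gt, hw.isNot_eq, hw.isAnd_beq]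

theorem nfEval_nf_succ_of_small {ev : X → Bool} {h : ℕ} (hw : C.IsAggr (!pol) w s)
    (hsmall : (C.gate w).isLarge = false)
    (hargs : ∀ a ∈ (C.gate w).args,
      nfEval pol ev (nf pol lower h (C, a, s)) = (C.val x a == s)) :
    nfEval pol ev (nf pol lower (h + 1) (C, w, s)) = (C.val x w == s) := by
  rw [nf_succ_of_inner hw, hw.val_beq, hsmall, if_neg Bool.false_ne_true]
  have hlen : (C.gate w).args.length ≤ 2 := not_lt.1 (of_decide_eq_false hsmall)
  match (C.gate w).args, hlen, hargs with
  | [], _, _ => cases pol <;> exact nfEval_nil _ ev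
  | [a], _, hargs =>
    have ha := hargs a (by simp)
    cases pol <;> simp [nfEval_prod, aggr, ha]
  | [a, b], _, hargs =>
    have ha := hargs a (by simp)
    have hb := hargs b (by simp)
    cases pol <;> simp [nfEval_prod, aggr, ha, hb]

variable (C) in
/-- The arguments of the gate of `w` have weft at most `t`. -/
def Circuit.ArgsWeft (t w : ℕ) : Prop := ∀ a ∈ (C.gate w).args, C.wireWeft a ≤ t

theorem Circuit.IsGate.argsWeft (hw : C.IsGate w) {t : ℕ} (ht : C.wireWeft w ≤ t) :
    C.ArgsWeft t w :=
  maxOver_le_iff.1 ((Nat.le_add_right _ _).trans (hw.wireWeft_eq.symm.trans_le ht))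

theorem Circuit.IsGate.argsWeft_of_isLarge (hw : C.IsGate w) (hlarge : (C.gate w).isLarge = true)
    {t : ℕ} (ht : C.wireWeft w ≤ t) : 0 < t ∧ C.ArgsWeft (t - 1) w := by
  rw [hw.wireWeft_eq, if_pos hlarge] at ht
  exact ⟨by omega, maxOver_le_iff.1 (Nat.le_sub_one_of_lt ht)⟩

theorem nfEval_nf {ev : X → Bool} {t H : ℕ}
    (hinput : ∀ w < C.inputs, ∀ s, ev (lower (C, w, s)) = (C.val x w == s))
    (hlarge : ∀ w s, C.IsAggr (!pol) w s → C.ArgsWeft (t - 1) w → 0 < t → C.wireDepth w ≤ H →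
      ev (lower (C, w, s)) = (C.val x w == s))
    {h : ℕ} (hH : h ≤ H) (hw : w < C.inputs + C.gates.length) (hdepth : C.wireDepth w ≤ h)
    (hweft : C.wireWeft w ≤ t ∨ C.IsAggr pol w s ∧ C.ArgsWeft t w) :
    nfEval pol ev (nf pol lower h (C, w, s)) = (C.val x w == s) := by
  induction h generalizing w s with
  | zero =>
    have hwi : w < C.inputs := by
      by_contra hwi
      have hgate : C.IsGate w := ⟨not_lt.1 hwi, hw⟩
      exact absurd hdepth (by rw [hgate.wireDepth_eq]; omega)
    rw [nf, nfEval_singleton, hinput w hwi]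
  | succ h ih =>
    by_cases hwi : w < C.inputs
    · rw [nf_succ_of_lt hwi, nfEval_singleton, hinput w hwi]
    have hgate : C.IsGate w := ⟨not_lt.1 hwi, hw⟩
    have hdepthArgs : ∀ a ∈ (C.gate w).args, C.wireDepth a ≤ h :=
      maxOver_le_iff.1 (Nat.succ_le_succ_iff.1 (hgate.wireDepth_eq.symm.trans_le hdepth))
    have hweftArgs : C.ArgsWeft t w := hweft.elim hgate.argsWeft And.right
    have hargs (a) (ha : a ∈ (C.gate w).args) (s) :
        nfEval pol ev (nf pol lower h (C, a, s)) = (C.val x a == s) :=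
      ih (by omega) ((hgate.lt_of_mem_args ha).trans hw) (hdepthArgs a ha) (.inl (hweftArgs a ha))
    obtain hnot | hnot := Bool.eq_false_or_eq_true (C.gate w).isNot
    · obtain ⟨a, ha, hval⟩ := Gate.eval_of_isNot hnot (C.val x)
      rw [nf_succ_of_isNot hgate hnot, hgate.val_eq, hval, ha, List.headD_cons,
        hargs a (by simp [ha])]
      cases C.val x a <;> cases s <;> rfl
    obtain hpol | hpol : C.IsAggr pol w s ∨ C.IsAggr (!pol) w s :=
      (Bool.eq_or_eq_not _ pol).imp (⟨hgate, hnot, ·⟩) (⟨hgate, hnot, ·⟩)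
    · rw [nf_succ_of_outer hpol, nfEval_flatMap, hpol.val_beq]
      exact aggr_congr fun a ha => hargs a ha s
    obtain hl | hl := Bool.eq_false_or_eq_true (C.gate w).isLarge
    · have hweft' : C.wireWeft w ≤ t := hweft.resolve_right fun hw' =>
        (Bool.not_ne_self pol) (hpol.isAnd_beq.symm.trans hw'.1.isAnd_beq)
      obtain ⟨ht, hweftArgs'⟩ := hgate.argsWeft_of_isLarge hl hweft'
      rw [nf_succ_of_inner hpol, if_pos hl, nfEval_singleton,
        hlarge w s hpol hweftArgs' ht (hdepth.trans hH)]
    · exact nfEval_nf_succ_of_small hpol hl fun a ha => hargs a ha s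

end Norm

/-! ### The four-level normal form of a circuit of weft two -/

/-- A literal: a variable and its value. -/
abbrev Literal : Type := ℕ × Bool

/-- Disjunctions of conjunctions of disjunctions of conjunctions of literals. -/
abbrev Form : Type := List (List (List (List Literal)))

/-- The value of a four-level form, given the values of the literals. -/
def formEval (ev : Literal → Bool) (D : Form) : Bool :=
  D.any fun F => F.all fun cl => cl.any fun t => t.all ev

/-- Disjunctions of conjunctions of literals. -/
def nf₀ (h : ℕ) : WireClaim → List (List Literal) := nf false Prod.snd h

/-- Conjunctions of disjunctions over `nf₀`. -/
def nf₁ (h : ℕ) : WireClaim → List (List (List (List Literal))) := nf true (nf₀ h) h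

/-- Disjunctions of conjunctions over `nf₁`. -/
def nf₂ (h : ℕ) : WireClaim → List (List (List (List (List (List Literal))))) :=
  nf false (nf₁ h) h

/-- The normal form of the claim that the output of a circuit is true. -/
def outputForm (h : ℕ) (C : Circuit) : Form :=
  (nf₂ h (C, C.output, true)).map fun l => l.flatten.map List.flatten

@[fun_prop]
theorem polyTime_outputForm {α : Type} [TreeEnc α] (h : ℕ) {C : α → Circuit} (hC : PolyTime C) :
    PolyTime (fun a => outputForm h (C a)) := by
  have h₀ : PolyTime (nf₀ h) := polyTime_nf (by unfold Prod.snd; fun_prop) h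
  have h₁ : PolyTime (nf₁ h) := polyTime_nf h₀ h
  have h₂ : PolyTime (nf₂ h) := polyTime_nf h₁ h
  unfold outputForm
  fun_prop

theorem length_le_of_mem_outputForm {h : ℕ} {C : Circuit} {F : List (List (List Literal))}
    (hF : F ∈ outputForm h C) {cl : List (List Literal)} (hcl : cl ∈ F) {t : List Literal}
    (ht : t ∈ cl) : t.length ≤ 2 ^ h := by
  obtain ⟨l, hl, rfl⟩ := List.mem_map.1 hF
  obtain ⟨m, hm, rfl⟩ := List.mem_map.1 hcl
  obtain ⟨u, hu, hmu⟩ := List.mem_flatten.1 hm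
  obtain ⟨y, hy, hty⟩ := List.mem_flatten.1 ht
  obtain ⟨_, rfl⟩ := exists_eq_lower_of_mem_nf hl hu
  obtain ⟨_, rfl⟩ := exists_eq_lower_of_mem_nf hmu hy
  exact length_le_of_mem_nf hty

section OutputForm

variable {C : Circuit} {x : Fin C.inputs → Bool} {ev : Literal → Bool} {h w : ℕ} {s : Bool}

theorem Circuit.IsAggr.lt {b : Bool} (hw : C.IsAggr b w s) : w < C.inputs + C.gates.length :=
  hw.isGate.2

theorem nf₀_eval (hev : ∀ w < C.inputs, ∀ s, ev (w, s) = (C.val x w == s))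
    (hw : w < C.inputs + C.gates.length) (hdepth : C.wireDepth w ≤ h)
    (hweft : C.wireWeft w ≤ 0 ∨ C.IsAggr false w s ∧ C.ArgsWeft 0 w) :
    nfEval false ev (nf₀ h (C, w, s)) = (C.val x w == s) :=
  nfEval_nf (pol := false) hev (fun _ _ _ _ ht => absurd ht (lt_irrefl 0)) le_rfl hw hdepth hweft

theorem nf₁_eval (hev : ∀ w < C.inputs, ∀ s, ev (w, s) = (C.val x w == s))
    (hw : w < C.inputs + C.gates.length) (hdepth : C.wireDepth w ≤ h)
    (hweft : C.wireWeft w ≤ 1 ∨ C.IsAggr true w s ∧ C.ArgsWeft 1 w) :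
    nfEval true (nfEval false ev) (nf₁ h (C, w, s)) = (C.val x w == s) :=
  nfEval_nf (pol := true)
    (fun _ hw _ => nf₀_eval hev (Nat.lt_add_right _ hw)
      ((C.wireDepth_input hw).trans_le (Nat.zero_le h)) (.inl (C.wireWeft_input hw).le))
    (fun _ _ hw hargs _ hdepth => nf₀_eval hev hw.lt hdepth (.inr ⟨hw, hargs⟩)) le_rfl hw hdepth
    hweft

theorem nf₂_eval (hev : ∀ w < C.inputs, ∀ s, ev (w, s) = (C.val x w == s))
    (hw : w < C.inputs + C.gates.length) (hdepth : C.wireDepth w ≤ h) (hweft : C.wireWeft w ≤ 2) :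
    nfEval false (nfEval true (nfEval false ev)) (nf₂ h (C, w, s)) = (C.val x w == s) :=
  nfEval_nf (pol := false) (t := 2)
    (fun _ hw _ => nf₁_eval hev (Nat.lt_add_right _ hw)
      ((C.wireDepth_input hw).trans_le (Nat.zero_le h))
      (.inl ((C.wireWeft_input hw).trans_le zero_le_one)))
    (fun _ _ hw hargs _ hdepth => nf₁_eval hev hw.lt hdepth (.inr ⟨hw, hargs⟩)) le_rfl hw hdepth
    (.inl hweft)

theorem outputForm_eval (hweft : C.weft ≤ 2) (hdepth : C.depth ≤ h)
    (hev : ∀ w < C.inputs, ∀ s, ev (w, s) = (C.val x w == s)) :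
    formEval ev (outputForm h C) = C.eval x := by
  have hnf := nf₂_eval (s := true) hev C.output_lt hdepth hweft
  rw [beq_true] at hnf
  refine Eq.trans ?_ hnf
  simp only [formEval, outputForm, nfEval, aggr, Bool.not_false, cond_false, List.any_map,
    List.all_map, List.all_flatten, List.any_flatten, Function.comp_def]
  rfl

end OutputForm

/-! ### Sets of variables as chains of positions -/

/-- A set of `k` variables below `n` as an increasing sequence of positions from `a 0 = 0` to
`a (k + 1) = n + 1`, where the variable `w` has the position `w + 1`. The point is that positive
and negative literals are alike witnessed by one pair of consecutive positions. -/
structure IsChain (n k : ℕ) (a : ℕ → ℕ) : Prop where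
  zero : a 0 = 0
  last : a (k + 1) = n + 1
  strictMonoOn : StrictMonoOn a (Set.Iic (k + 1))

/-- The variable `w` belongs to the set given by the chain `a`. -/
def InChain (k : ℕ) (a : ℕ → ℕ) (w : ℕ) : Prop := ∃ s < k, a (s + 1) = w + 1

/-- The consecutive positions `g` witness that the literal `l` is true. -/
def gapHolds (g : ℕ × ℕ) (l : Literal) : Bool :=
  bif l.2 then g.1 == l.1 + 1 else Nat.blt g.1 (l.1 + 1) && Nat.blt (l.1 + 1) g.2

/-- The literal `l` is witnessed by the chain `a`. -/
def chainHolds (k : ℕ) (a : ℕ → ℕ) (l : Literal) : Bool :=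
  (List.range (k + 1)).any fun s => gapHolds (a s, a (s + 1)) l

section Chain

variable {n k : ℕ} {a : ℕ → ℕ} {w : ℕ}

theorem chainHolds_iff {l : Literal} :
    chainHolds k a l = true ↔ ∃ s < k + 1, gapHolds (a s, a (s + 1)) l = true := by
  simp only [chainHolds, List.any_eq_true, List.mem_range]

theorem IsChain.lt_add_one (ha : IsChain n k a) {s : ℕ} (hs : s < k + 1) : a s < a (s + 1) :=
  ha.strictMonoOn (Set.mem_Iic.2 hs.le) (Set.mem_Iic.2 hs) s.lt_succ_self

theorem IsChain.le_last (ha : IsChain n k a) {s : ℕ} (hs : s ≤ k + 1) : a s ≤ n + 1 :=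
  (ha.strictMonoOn.monotoneOn (Set.mem_Iic.2 hs) Set.self_mem_Iic hs).trans_eq ha.last

theorem IsChain.exists_gap (ha : IsChain n k a) (hw : w < n) (hwa : ¬InChain k a w) :
    ∃ s < k + 1, a s < w + 1 ∧ w + 1 < a (s + 1) := by
  by_contra! hgap
  have hle (s) (hs : s ≤ k + 1) : a s < w + 1 := by
    induction s with
    | zero => rw [ha.zero]; exact w.succ_pos
    | succ s ih =>
      refine lt_of_le_of_ne (hgap s hs (ih (by omega))) fun hs' => ?_
      obtain rfl | hsk := (Nat.lt_succ_iff.1 hs).eq_or_lt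
      · exact absurd (hs'.symm.trans ha.last) (by omega)
      · exact hwa ⟨s, hsk, hs'⟩
  exact absurd (hle (k + 1) le_rfl) (by rw [ha.last]; omega)

theorem IsChain.not_inChain_of_gap (ha : IsChain n k a) {s : ℕ} (hs : s < k + 1)
    (hl : a s < w + 1) (hr : w + 1 < a (s + 1)) : ¬InChain k a w := by
  rintro ⟨t, ht, htw⟩
  rw [← htw] at hl hr
  have hst := (ha.strictMonoOn.lt_iff_lt (Set.mem_Iic.2 hs.le) (Set.mem_Iic.2 (by omega))).1 hl
  have hts := (ha.strictMonoOn.lt_iff_lt (Set.mem_Iic.2 (by omega)) (Set.mem_Iic.2 hs)).1 hr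
  omega

theorem IsChain.chainHolds_true_iff (ha : IsChain n k a) :
    chainHolds k a (w, true) = true ↔ InChain k a w := by
  simp only [chainHolds_iff, gapHolds, cond_true, beq_iff_eq]
  constructor
  · rintro ⟨_ | s, hs, h⟩
    · exact absurd (ha.zero.symm.trans h) w.succ_ne_zero.symm
    · exact ⟨s, by omega, h⟩
  · rintro ⟨s, hs, h⟩
    exact ⟨s + 1, by omega, h⟩

theorem IsChain.chainHolds_false_iff (ha : IsChain n k a) (hw : w < n) :
    chainHolds k a (w, false) = true ↔ ¬InChain k a w := by
  simp only [chainHolds_iff, gapHolds, cond_false, Bool.and_eq_true, nat_blt_iff]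
  exact ⟨fun ⟨_, hs, hl, hr⟩ => ha.not_inChain_of_gap hs hl hr, ha.exists_gap hw⟩

theorem IsChain.chainHolds_eq_beq (ha : IsChain n k a) (hw : w < n) {b : Bool}
    (hb : b = true ↔ InChain k a w) (s : Bool) : chainHolds k a (w, s) = (b == s) := by
  rw [Bool.eq_iff_iff, beq_iff_eq]
  cases s
  · rw [ha.chainHolds_false_iff hw, ← hb, Bool.not_eq_true]
  · rw [ha.chainHolds_true_iff, ← hb]

theorem IsChain.card_eq (ha : IsChain n k a) {x : Fin n → Bool}
    (hx : ∀ w, x w = true ↔ InChain k a w) : (Finset.univ.filter fun w => x w = true).card = k := by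
  have hpos (s) (hs : s ∈ Finset.range k) : 0 < a (s + 1) ∧ a (s + 1) < n + 1 := by
    have hs := Finset.mem_range.1 hs
    have hlt := ha.lt_add_one (s := s) (by omega)
    have hlt' := (ha.lt_add_one (s := s + 1) (by omega)).trans_le (ha.le_last (by omega))
    omega
  rw [← Finset.card_range k]
  refine (Finset.card_bij (fun s hs => (⟨a (s + 1) - 1, by have := hpos s hs; omega⟩ : Fin n))
    (fun s hs => ?_) (fun s hs t ht hst => ?_) fun w hw => ?_).symm
  · rw [Finset.mem_filter_univ, hx]
    exact ⟨s, Finset.mem_range.1 hs, (Nat.sub_add_cancel (hpos s hs).1).symm⟩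
  · have heq : a (s + 1) = a (t + 1) := by
      have hval := Fin.mk.inj hst
      have := hpos s hs
      have := hpos t ht
      omega
    have hmem {r : ℕ} (hr : r ∈ Finset.range k) : r + 1 ∈ Set.Iic (k + 1) :=
      Set.mem_Iic.2 (Nat.succ_le_succ (Finset.mem_range.1 hr).le)
    exact Nat.succ.inj (ha.strictMonoOn.injOn (hmem hs) (hmem ht) heq)
  · obtain ⟨s, hs, hsw⟩ := (hx w).1 ((Finset.mem_filter_univ w).1 hw)
    exact ⟨s, Finset.mem_range.2 hs, Fin.ext (Nat.sub_eq_of_eq_add hsw)⟩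

end Chain

section ChainOfAssignment

variable {n k : ℕ} {x : Fin n → Bool}

variable (x) in
/-- The positions of the true variables, together with `0` and all positions beyond `n`. The latter
make the set infinite, so that it is enumerated by the strictly increasing `Nat.nth`. -/
def IsPosition (i : ℕ) : Prop := ∀ w : Fin n, i = w + 1 → x w = true

theorem isPosition_zero : IsPosition x 0 := fun w hw => absurd hw w.1.succ_ne_zero.symm

theorem isPosition_succ {w : Fin n} : IsPosition x (w + 1) ↔ x w = true :=
  ⟨fun h => h w rfl, fun h v hv => by rwa [← Fin.ext (Nat.succ.inj hv)]⟩

theorem isPosition_of_lt {i : ℕ} (hi : n < i) : IsPosition x i :=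
  fun w hw => absurd w.2 (by omega)

theorem infinite_isPosition : {i | IsPosition x i}.Infinite :=
  Set.infinite_of_forall_exists_gt fun m => ⟨m + n + 1, isPosition_of_lt (by omega), by omega⟩

theorem count_isPosition [DecidablePred (IsPosition x)] :
    Nat.count (IsPosition x) (n + 1) = (Finset.univ.filter fun w => x w = true).card + 1 := by
  rw [Nat.count_succ', if_pos isPosition_zero, Nat.count_eq_card_filter_range,
    ← Finset.card_map Fin.valEmbedding]
  congr 2
  ext i
  simp only [Finset.mem_filter, Finset.mem_range, Finset.mem_map, Finset.mem_univ, true_and,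
    Fin.valEmbedding_apply]
  constructor
  · rintro ⟨hi, hpos⟩
    exact ⟨⟨i, hi⟩, isPosition_succ.1 hpos, rfl⟩
  · rintro ⟨w, hw, rfl⟩
    exact ⟨w.2, isPosition_succ.2 hw⟩

theorem isChain_nth (hx : (Finset.univ.filter fun w => x w = true).card = k) :
    IsChain n k (Nat.nth (IsPosition x)) := by
  classical
  refine ⟨Nat.nth_zero_of_zero isPosition_zero, ?_,
    (Nat.nth_strictMono infinite_isPosition).strictMonoOn _⟩
  rw [← hx, ← count_isPosition, Nat.nth_count (isPosition_of_lt n.lt_succ_self)]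

theorem inChain_nth_iff (hx : (Finset.univ.filter fun w => x w = true).card = k) (w : Fin n) :
    InChain k (Nat.nth (IsPosition x)) w ↔ x w = true := by
  classical
  rw [← isPosition_succ]
  constructor
  · rintro ⟨s, -, hs⟩
    exact hs ▸ Nat.nth_mem_of_infinite infinite_isPosition (s + 1)
  · intro hw
    have hchain := isChain_nth hx
    have hnth := Nat.nth_count hw
    have hlt : Nat.count (IsPosition x) (w + 1) < k + 1 :=
      (Nat.nth_strictMono infinite_isPosition).lt_iff_lt.1
        (by rw [hnth, hchain.last]; exact Nat.succ_lt_succ w.2)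
    generalize Nat.count (IsPosition x) (w + 1) = s at hnth hlt
    obtain _ | s := s
    · exact absurd (hchain.zero.symm.trans hnth) w.1.succ_ne_zero.symm
    · exact ⟨s, Nat.succ_lt_succ_iff.1 hlt, hnth⟩

end ChainOfAssignment

/-! ### From normal forms to hitting sets -/

/-- The pairs of positions that can be consecutive in a chain. -/
def gaps (n : ℕ) : List (ℕ × ℕ) :=
  (List.range (n + 2)).flatMap fun a =>
    ((List.range (n + 2)).filter fun b => Nat.blt a b).map fun b => (a, b)

/-- The end of a gap: the left one for `e = 0`, the right one for `e = 1`. -/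
def gapEnd (g : ℕ × ℕ) (e : ℕ) : ℕ := bif e == 0 then g.1 else g.2

/-- The slots of the hitting set instance of a form: `s ≤ k + 1` chooses the position `a s` of a
chain, `k + 2` chooses a disjunct of the form, and a tuple of `r` indices `s ≤ k` chooses the
corresponding gaps of the chain. Thus one slot decides whether a conjunction of at most `r` literals
holds. -/
abbrev FormSlot : Type := ℕ ⊕ List ℕ

/-- The options of the slots: numbers for the slots `.inl s`, lists of gaps for the slots `.inr σ`,
with a default value in the other component. -/
abbrev FormOption : Type := ℕ × List (ℕ × ℕ)

/-- The clauses: `.inl (σ, j, e, v)` forces that, if `v` is the end `e` of the `j`-th gap of the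
slot `σ`, then it is the chosen position, and `.inr (i, c)` forces the conjunct `c` if the disjunct
`i` is chosen. -/
abbrev FormClause : Type := (List ℕ × ℕ × ℕ × ℕ) ⊕ (ℕ × List (List Literal))

/-- The list of all slots. -/
def formSlots (r k : ℕ) : List FormSlot :=
  (List.range (k + 3)).map (fun s => .inl s) ++ (tuples r (List.range (k + 1))).map fun σ => .inr σ

/-- The numbers that the slot `.inl s` can choose, for a form with `d` disjuncts. -/
def slotValues (n d k s : ℕ) : List ℕ :=
  bif s == 0 then [0] else bif s == k + 1 then [n + 1] else bif s == k + 2 then List.range d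
  else List.range (n + 2)

/-- The list of the options of a slot. -/
def formOptions (r n d k : ℕ) (i : FormSlot) : List FormOption :=
  Sum.elim (fun s => (slotValues n d k s).map fun v => (v, []))
    (fun _ => (tuples r (gaps n)).map fun τ => (0, τ)) i

/-- The list of all clauses. -/
def formClauses (r n : ℕ) (D : Form) (k : ℕ) : List FormClause :=
  ((tuples r (List.range (k + 1))).flatMap fun σ => (List.range r).flatMap fun j =>
    (List.range 2).flatMap fun e => (List.range (n + 2)).map fun v => .inl (σ, j, e, v)) ++
  (List.range D.length).flatMap fun i => (D.getD i []).map fun c => .inr (i, c)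

/-- The option `o` of the slot `i` hits the clause `c`. -/
def formInc (k : ℕ) (i : FormSlot) (o : FormOption) (c : FormClause) : Bool :=
  Sum.elim
    (fun s => Sum.elim (fun q => s == q.1.getD q.2.1 0 + q.2.2.1 && o.1 == q.2.2.2)
      (fun q => s == k + 2 && !(o.1 == q.1)) c)
    (fun σ => Sum.elim
      (fun q => σ == q.1 && !(gapEnd (o.2.getD q.2.1 (0, 0)) q.2.2.1 == q.2.2.2))
      (fun q => q.2.any fun t => t.all fun l => o.2.any fun g => gapHolds g l) c) i

/-- The hitting set instance of a form in `n` variables, for chains with `k` inner positions. -/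
def formInstance (r n : ℕ) (D : Form) (k : ℕ) : ℕ × List (List (List Bool)) :=
  hitInstance (formSlots r k) (formOptions r n D.length k) (formClauses r n D k) (formInc k)

section PolyTime

variable {α : Type} [TreeEnc α] {n d k : α → ℕ} {D : α → Form} {i : α → FormSlot}

@[fun_prop]
theorem polyTime_gapHolds {g : α → ℕ × ℕ} {l : α → Literal} (hg : PolyTime g) (hl : PolyTime l) :
    PolyTime (fun a => gapHolds (g a) (l a)) := by
  unfold gapHolds
  fun_prop

@[fun_prop]
theorem polyTime_gaps (hn : PolyTime n) : PolyTime (fun a => gaps (n a)) := by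
  unfold gaps
  fun_prop

@[fun_prop]
theorem polyTime_formSlots (r : ℕ) (hk : PolyTime k) : PolyTime (fun a => formSlots r (k a)) := by
  unfold formSlots
  fun_prop

@[fun_prop]
theorem polyTime_formOptions (r : ℕ) (hn : PolyTime n) (hd : PolyTime d) (hk : PolyTime k)
    (hi : PolyTime i) : PolyTime (fun a => formOptions r (n a) (d a) (k a) (i a)) := by
  unfold formOptions slotValues
  fun_prop

@[fun_prop]
theorem polyTime_formClauses (r : ℕ) (hn : PolyTime n) (hD : PolyTime D) (hk : PolyTime k) :
    PolyTime (fun a => formClauses r (n a) (D a) (k a)) := by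
  unfold formClauses
  fun_prop

@[fun_prop]
theorem polyTime_formInc {o : α → FormOption} {c : α → FormClause} (hk : PolyTime k)
    (hi : PolyTime i) (ho : PolyTime o) (hc : PolyTime c) :
    PolyTime (fun a => formInc (k a) (i a) (o a) (c a)) := by
  unfold formInc gapEnd
  fun_prop

@[fun_prop]
theorem polyTime_formInstance (r : ℕ) (hn : PolyTime n) (hD : PolyTime D) (hk : PolyTime k) :
    PolyTime (fun a => formInstance r (n a) (D a) (k a)) := by
  unfold formInstance hitInstance
  fun_prop

end PolyTime

theorem nodup_tuples {β : Type} (r : ℕ) {l : List β} (hl : l.Nodup) : (tuples r l).Nodup := by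
  induction r with
  | zero => exact List.nodup_singleton []
  | succ r ih =>
    rw [tuples, List.nodup_flatMap]
    refine ⟨fun x _ => ih.map List.cons_injective, hl.imp fun hxy z hz hz' => ?_⟩
    obtain ⟨u, -, rfl⟩ := List.mem_map.1 hz
    obtain ⟨v, -, h⟩ := List.mem_map.1 hz'
    exact hxy (List.cons.inj h).1.symm

section FormInstance

variable {r n d k s : ℕ} {D : Form} {σ : List ℕ} {o : FormOption}

theorem mem_gaps {g : ℕ × ℕ} : g ∈ gaps n ↔ g.1 < g.2 ∧ g.2 < n + 2 := by
  simp only [gaps, List.mem_flatMap, List.mem_map, List.mem_filter, List.mem_range, nat_blt_iff]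
  constructor
  · rintro ⟨a, -, b, ⟨hb, hab⟩, rfl⟩
    exact ⟨hab, hb⟩
  · rintro ⟨hab, hb⟩
    exact ⟨g.1, hab.trans hb, g.2, ⟨hb, hab⟩, rfl⟩

theorem formEval_iff {ev : Literal → Bool} :
    formEval ev D = true ↔ ∃ F ∈ D, ∀ c ∈ F, ∃ t ∈ c, ∀ l ∈ t, ev l = true := by
  simp only [formEval, List.any_eq_true, List.all_eq_true]

theorem length_formSlots (r k : ℕ) : (formSlots r k).length = k + 3 + (k + 1) ^ r := by
  simp only [formSlots, List.length_append, List.length_map, List.length_range, length_tuples]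

theorem nodup_formSlots (r k : ℕ) : (formSlots r k).Nodup := by
  refine List.Nodup.append (List.nodup_range.map Sum.inl_injective)
    ((nodup_tuples r List.nodup_range).map Sum.inr_injective) fun x hx hx' => ?_
  obtain ⟨u, -, rfl⟩ := List.mem_map.1 hx
  obtain ⟨v, -, h⟩ := List.mem_map.1 hx'
  cases h

theorem inl_mem_formSlots : Sum.inl s ∈ formSlots r k ↔ s < k + 3 := by
  simp [formSlots]

theorem inr_mem_formSlots : Sum.inr σ ∈ formSlots r k ↔ σ ∈ tuples r (List.range (k + 1)) := by
  simp [formSlots]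

theorem slotValues_zero : slotValues n d k 0 = [0] := rfl

theorem slotValues_last : slotValues n d k (k + 1) = [n + 1] := by
  simp [slotValues]

theorem slotValues_disjunct : slotValues n d k (k + 2) = List.range d := by
  simp [slotValues, Bool.cond_eq_ite]

theorem slotValues_of_le (hs : 0 < s) (hsk : s ≤ k) : slotValues n d k s = List.range (n + 2) := by
  have hlast : s ≠ k + 1 := by omega
  have hdisjunct : s ≠ k + 2 := by omega
  simp [slotValues, Bool.cond_eq_ite, hs.ne', hlast, hdisjunct]

theorem mem_formOptions_inl :
    o ∈ formOptions r n d k (.inl s) ↔ o.1 ∈ slotValues n d k s ∧ o.2 = [] := by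
  obtain ⟨v, τ⟩ := o
  simp [formOptions, eq_comm]

theorem mem_formOptions_inr :
    o ∈ formOptions r n d k (.inr σ) ↔ o.1 = 0 ∧ o.2.length = r ∧ ∀ g ∈ o.2, g ∈ gaps n := by
  obtain ⟨v, τ⟩ := o
  simp [formOptions, mem_tuples, eq_comm, and_comm]

theorem inl_mem_formClauses {j e v : ℕ} :
    Sum.inl (σ, j, e, v) ∈ formClauses r n D k ↔
      σ ∈ tuples r (List.range (k + 1)) ∧ j < r ∧ e < 2 ∧ v < n + 2 := by
  simp only [formClauses, List.mem_append, List.mem_flatMap, List.mem_map, List.mem_range,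
    Sum.inl.injEq, Prod.mk.injEq, reduceCtorEq, and_false, exists_false, or_false]
  constructor
  · rintro ⟨_, hσ, _, hj, _, he, _, hv, rfl, rfl, rfl, rfl⟩
    exact ⟨hσ, hj, he, hv⟩
  · rintro ⟨hσ, hj, he, hv⟩
    exact ⟨_, hσ, _, hj, _, he, _, hv, rfl, rfl, rfl, rfl⟩

theorem inr_mem_formClauses {i : ℕ} {c : List (List Literal)} :
    Sum.inr (i, c) ∈ formClauses r n D k ↔ i < D.length ∧ c ∈ D.getD i [] := by
  simp only [formClauses, List.mem_append, List.mem_flatMap, List.mem_map, List.mem_range,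
    Sum.inr.injEq, Prod.mk.injEq, reduceCtorEq, and_false, exists_false, false_or]
  constructor
  · rintro ⟨_, hi, _, hc, rfl, rfl⟩
    exact ⟨hi, hc⟩
  · rintro ⟨hi, hc⟩
    exact ⟨i, hi, c, hc, rfl, rfl⟩

theorem formInc_inl_inl {j e v : ℕ} :
    formInc k (.inl s) o (.inl (σ, j, e, v)) = true ↔ s = σ.getD j 0 + e ∧ o.1 = v := by
  simp only [formInc, Sum.elim_inl, Bool.and_eq_true, beq_iff_eq]

theorem formInc_inl_inr {i : ℕ} {c : List (List Literal)} :
    formInc k (.inl s) o (.inr (i, c)) = true ↔ s = k + 2 ∧ o.1 ≠ i := by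
  simp only [formInc, Sum.elim_inl, Sum.elim_inr, Bool.and_eq_true, beq_iff_eq, Bool.not_eq_true',
    beq_eq_false_iff_ne]

theorem formInc_inr_inl {σ' : List ℕ} {j e v : ℕ} :
    formInc k (.inr σ') o (.inl (σ, j, e, v)) = true ↔
      σ' = σ ∧ gapEnd (o.2.getD j (0, 0)) e ≠ v := by
  simp only [formInc, Sum.elim_inl, Sum.elim_inr, Bool.and_eq_true, beq_iff_eq, Bool.not_eq_true',
    beq_eq_false_iff_ne]

theorem formInc_inr_inr {i : ℕ} {c : List (List Literal)} :
    formInc k (.inr σ) o (.inr (i, c)) = true ↔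
      ∃ t ∈ c, ∀ l ∈ t, ∃ g ∈ o.2, gapHolds g l = true := by
  simp only [formInc, Sum.elim_inr, List.any_eq_true, List.all_eq_true]

theorem gapEnd_mk {a : ℕ → ℕ} {e : ℕ} (he : e < 2) : gapEnd (a s, a (s + 1)) e = a (s + e) := by
  interval_cases e <;> rfl

theorem exists_tuple_of_chainHolds {a : ℕ → ℕ} {t : List Literal} (hlen : t.length ≤ r)
    (ht : ∀ l ∈ t, chainHolds k a l = true) :
    ∃ σ ∈ tuples r (List.range (k + 1)), ∀ l ∈ t, ∃ s ∈ σ, gapHolds (a s, a (s + 1)) l = true := by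
  simp only [chainHolds_iff] at ht
  choose! f hfk hf using ht
  refine ⟨t.map f ++ List.replicate (r - t.length) 0, mem_tuples.2 ⟨?_, fun s hs => ?_⟩,
    fun l hl => ⟨f l, List.mem_append_left _ (List.mem_map_of_mem hl), hf l hl⟩⟩
  · rw [List.length_append, List.length_map, List.length_replicate, Nat.add_sub_cancel' hlen]
  · rw [List.mem_range]
    obtain hs | hs := List.mem_append.1 hs
    · obtain ⟨l, hl, rfl⟩ := List.mem_map.1 hs
      exact hfk l hl
    · rw [List.eq_of_mem_replicate hs]
      exact k.succ_pos

section OfChain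

variable {a : ℕ → ℕ} {i : ℕ}

/-- The choice of options given by the chain `a` and the disjunct `i`. -/
def chainChoice (k : ℕ) (a : ℕ → ℕ) (i : ℕ) : FormSlot → FormOption :=
  Sum.elim (fun s => (if s = k + 2 then i else a s, []))
    fun σ => (0, σ.map fun s => (a s, a (s + 1)))

theorem IsChain.chainChoice_mem_formOptions (ha : IsChain n k a) (hi : i < d) {p : FormSlot}
    (hp : p ∈ formSlots r k) : chainChoice k a i p ∈ formOptions r n d k p := by
  obtain s | σ := p
  · rw [inl_mem_formSlots] at hp
    refine mem_formOptions_inl.2 ⟨?_, rfl⟩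
    change (if s = k + 2 then i else a s) ∈ _
    obtain rfl | rfl | rfl | ⟨hs, hsk⟩ : s = k + 2 ∨ s = k + 1 ∨ s = 0 ∨ 0 < s ∧ s ≤ k := by omega
    · rwa [if_pos rfl, slotValues_disjunct, List.mem_range]
    · rw [if_neg (by omega), slotValues_last, ha.last, List.mem_singleton]
    · rw [if_neg (by omega), slotValues_zero, ha.zero, List.mem_singleton]
    · rw [if_neg (by omega), slotValues_of_le hs hsk, List.mem_range]
      exact Nat.lt_succ_of_le (ha.le_last (by omega))
  · obtain ⟨hlen, hσ⟩ := mem_tuples.1 (inr_mem_formSlots.1 hp)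
    refine mem_formOptions_inr.2 ⟨rfl, (List.length_map _).trans hlen, fun g hg => ?_⟩
    obtain ⟨s, hs, rfl⟩ := List.mem_map.1 hg
    have hsk := List.mem_range.1 (hσ s hs)
    exact mem_gaps.2 ⟨ha.lt_add_one hsk, Nat.lt_succ_of_le (ha.le_last hsk)⟩

theorem exists_formInc_chainChoice {c : FormClause} (hc : c ∈ formClauses r n D k)
    (hr : ∀ F ∈ D, ∀ c ∈ F, ∀ t ∈ c, t.length ≤ r) (hi : i < D.length)
    (hD : ∀ c ∈ D[i], ∃ t ∈ c, ∀ l ∈ t, chainHolds k a l = true) :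
    ∃ p ∈ formSlots r k, formInc k p (chainChoice k a i p) c = true := by
  obtain ⟨σ, j, e, v⟩ | ⟨i', c⟩ := c
  · obtain ⟨hσ, hj, he, -⟩ := inl_mem_formClauses.1 hc
    obtain ⟨hlen, hmem⟩ := mem_tuples.1 hσ
    have hj : j < σ.length := hj.trans_eq hlen.symm
    have hs := List.mem_range.1 (hmem _ (List.getElem_mem hj))
    by_cases hv : a (σ[j] + e) = v
    · refine ⟨.inl (σ[j] + e), inl_mem_formSlots.2 (by omega), formInc_inl_inl.2 ⟨?_, ?_⟩⟩
      · rw [List.getD_eq_getElem _ _ hj]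
      · exact (if_neg (by omega)).trans hv
    · refine ⟨.inr σ, inr_mem_formSlots.2 hσ, formInc_inr_inl.2 ⟨rfl, ?_⟩⟩
      rwa [chainChoice, Sum.elim_inr, getD_map_of_lt hj, gapEnd_mk he]
  · obtain ⟨hi', hc⟩ := inr_mem_formClauses.1 hc
    by_cases hii' : i = i'
    · subst hii'
      rw [List.getD_eq_getElem _ _ hi] at hc
      obtain ⟨t, ht, hl⟩ := hD c hc
      obtain ⟨σ, hσ, hgap⟩ :=
        exists_tuple_of_chainHolds (hr _ (List.getElem_mem hi) c hc t ht) hl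
      refine ⟨.inr σ, inr_mem_formSlots.2 hσ, formInc_inr_inr.2 ⟨t, ht, fun l hl => ?_⟩⟩
      obtain ⟨s, hs, hsl⟩ := hgap l hl
      exact ⟨_, List.mem_map_of_mem hs, hsl⟩
    · exact ⟨.inl (k + 2), inl_mem_formSlots.2 (by omega),
        formInc_inl_inr.2 ⟨rfl, by rwa [chainChoice, Sum.elim_inl, if_pos rfl]⟩⟩

end OfChain

section ToChain

variable {f : FormSlot → FormOption}

theorem snd_eq_map_of_forall_formInc (hf : ∀ p ∈ formSlots r k, f p ∈ formOptions r n d k p)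
    (hhit : ∀ c ∈ formClauses r n D k, ∃ p ∈ formSlots r k, formInc k p (f p) c = true)
    (hσ : σ ∈ tuples r (List.range (k + 1))) :
    (f (.inr σ)).2 = σ.map fun s => ((f (.inl s)).1, (f (.inl (s + 1))).1) := by
  obtain ⟨-, hlen, hgaps⟩ := mem_formOptions_inr.1 (hf _ (inr_mem_formSlots.2 hσ))
  have hσlen := (mem_tuples.1 hσ).1
  refine List.ext_getElem (by rw [hlen, List.length_map, hσlen]) fun j hj hj' => ?_
  have hjσ : j < σ.length := (List.length_map _).symm.trans_gt hj'
  have hg := mem_gaps.1 (hgaps _ (List.getElem_mem hj))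
  have hend (e : ℕ) (he : e < 2) :
      gapEnd (f (.inr σ)).2[j] e = (f (.inl (σ[j] + e))).1 := by
    have hlt : gapEnd (f (.inr σ)).2[j] e < n + 2 := by
      interval_cases e
      exacts [hg.1.trans hg.2, hg.2]
    obtain ⟨s | σ', -, hinc⟩ :=
      hhit _ (inl_mem_formClauses.2 ⟨hσ, hjσ.trans_eq hσlen, he, hlt⟩)
    · obtain ⟨rfl, hv⟩ := formInc_inl_inl.1 hinc
      rw [← hv, List.getD_eq_getElem _ _ hjσ]
    · obtain ⟨rfl, hv⟩ := formInc_inr_inl.1 hinc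
      rw [List.getD_eq_getElem _ _ hj] at hv
      exact absurd rfl hv
  rw [List.getElem_map]
  exact Prod.ext (hend 0 two_pos) (hend 1 one_lt_two)

theorem isChain_of_forall_formInc (hr : 0 < r)
    (hf : ∀ p ∈ formSlots r k, f p ∈ formOptions r n d k p)
    (hhit : ∀ c ∈ formClauses r n D k, ∃ p ∈ formSlots r k, formInc k p (f p) c = true) :
    IsChain n k fun s => (f (.inl s)).1 := by
  have hvalue {s : ℕ} (hs : s < k + 3) : (f (.inl s)).1 ∈ slotValues n d k s :=
    (mem_formOptions_inl.1 (hf _ (inl_mem_formSlots.2 hs))).1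
  refine ⟨List.mem_singleton.1 (slotValues_zero ▸ hvalue (by omega)),
    List.mem_singleton.1 (slotValues_last ▸ hvalue (by omega)),
    strictMonoOn_of_lt_add_one Set.ordConnected_Iic fun s _ _ hs => ?_⟩
  have hσ : List.replicate r s ∈ tuples r (List.range (k + 1)) :=
    mem_tuples.2 ⟨List.length_replicate, fun x hx =>
      List.mem_range.2 (List.eq_of_mem_replicate hx ▸ Nat.lt_of_succ_le hs)⟩
  obtain ⟨-, -, hgaps⟩ := mem_formOptions_inr.1 (hf _ (inr_mem_formSlots.2 hσ))
  rw [snd_eq_map_of_forall_formInc hf hhit hσ, List.map_replicate] at hgaps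
  exact (mem_gaps.1 (hgaps _ (List.mem_replicate.2 ⟨hr.ne', rfl⟩))).1

theorem formEval_of_forall_formInc
    (hf : ∀ p ∈ formSlots r k, f p ∈ formOptions r n D.length k p)
    (hhit : ∀ c ∈ formClauses r n D k, ∃ p ∈ formSlots r k, formInc k p (f p) c = true) :
    formEval (chainHolds k fun s => (f (.inl s)).1) D = true := by
  have hi := (mem_formOptions_inl.1 (hf (.inl (k + 2)) (inl_mem_formSlots.2 (by omega)))).1
  rw [slotValues_disjunct, List.mem_range] at hi
  refine formEval_iff.2 ⟨D[(f (.inl (k + 2))).1], List.getElem_mem hi, fun c hc => ?_⟩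
  obtain ⟨s | σ, hσ, hinc⟩ :=
    hhit _ (inr_mem_formClauses.2 ⟨hi, (List.getD_eq_getElem _ _ hi).symm ▸ hc⟩)
  · obtain ⟨rfl, hne⟩ := formInc_inl_inr.1 hinc
    exact absurd rfl hne
  · rw [inr_mem_formSlots] at hσ
    obtain ⟨t, ht, hl⟩ := formInc_inr_inr.1 hinc
    refine ⟨t, ht, fun l hlt => chainHolds_iff.2 ?_⟩
    obtain ⟨g, hg, hgl⟩ := hl l hlt
    rw [snd_eq_map_of_forall_formInc hf hhit hσ] at hg
    obtain ⟨s, hs, rfl⟩ := List.mem_map.1 hg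
    exact ⟨s, List.mem_range.1 ((mem_tuples.1 hσ).2 s hs), hgl⟩

end ToChain

theorem formInstance_yes_iff (hr : 0 < r) (hrD : ∀ F ∈ D, ∀ c ∈ F, ∀ t ∈ c, t.length ≤ r) :
    ColoredHittingSet.Yes (formInstance r n D k) (formSlots r k).length ↔
      ∃ a, IsChain n k a ∧ formEval (chainHolds k a) D = true := by
  rw [formInstance, hitInstance_yes_iff (nodup_formSlots r k)]
  constructor
  · rintro ⟨f, hf, hhit⟩
    exact ⟨_, isChain_of_forall_formInc hr hf hhit, formEval_of_forall_formInc hf hhit⟩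
  · rintro ⟨a, ha, hD⟩
    obtain ⟨F, hF, hc⟩ := formEval_iff.1 hD
    obtain ⟨i, hi, rfl⟩ := List.getElem_of_mem hF
    exact ⟨chainChoice k a i, fun p hp => ha.chainChoice_mem_formOptions hi hp,
      fun c hcl => exists_formInc_chainChoice hcl hrD hi hc⟩

end FormInstance

theorem exists_eval_iff_exists_isChain {C : Circuit} {h : ℕ} (hweft : C.weft ≤ 2)
    (hdepth : C.depth ≤ h) {k : ℕ} :
    (∃ x, (Finset.univ.filter fun w => x w = true).card = k ∧ C.eval x = true) ↔
      ∃ a, IsChain C.inputs k a ∧ formEval (chainHolds k a) (outputForm h C) = true := by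
  have heval {a : ℕ → ℕ} {x : Fin C.inputs → Bool} (ha : IsChain C.inputs k a)
      (hx : ∀ w, x w = true ↔ InChain k a w) :
      formEval (chainHolds k a) (outputForm h C) = C.eval x :=
    outputForm_eval hweft hdepth fun w hw s => by
      rw [C.val_input x ⟨w, hw⟩, ha.chainHolds_eq_beq hw (hx ⟨w, hw⟩)]
  constructor
  · rintro ⟨x, hcard, hx⟩
    have ha := isChain_nth hcard
    exact ⟨_, ha, (heval ha fun w => (inChain_nth_iff hcard w).symm).trans hx⟩
  · rintro ⟨a, ha, hD⟩
    classical
    have hx (w : Fin C.inputs) : decide (InChain k a w) = true ↔ InChain k a w :=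
      decide_eq_true_iff
    exact ⟨_, ha.card_eq hx, (heval ha hx).symm.trans hD⟩

theorem circuitSat_reducible_coloredHittingSet (h : ℕ) :
    FPTReducible (WeightedCircuitSat 2 h) ColoredHittingSet := by
  have hcircuit : PolyTime fun C : {C : Circuit // C.weft ≤ 2 ∧ C.depth ≤ h} => C.1 :=
    .of_enc_eq fun _ => rfl
  have hC : PolyTime fun p : {C : Circuit // C.weft ≤ 2 ∧ C.depth ≤ h} × ℕ => p.1.1 :=
    hcircuit.comp (.fst .id)
  refine FPTReducible.of_polyTime (A := WeightedCircuitSat 2 h)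
    (R := fun p => (formInstance (2 ^ h) p.1.1.inputs (outputForm h p.1.1) p.2,
      (formSlots (2 ^ h) p.2).length))
    (g := fun k => k + 3 + (k + 1) ^ 2 ^ h) ?_ ?_ (fun _ _ => (length_formSlots _ _).le) ?_
  · exact PolyTime.pair (by fun_prop) (by fun_prop)
  · exact computable_add (computable_add .id (.const 3)) (computable_pow .succ (.const _))
  · rintro ⟨C, hweft, hdepth⟩ k
    exact (exists_eval_iff_exists_isChain hweft hdepth).trans
      (formInstance_yes_iff (Nat.two_pow_pos h)
        fun _ hF _ hc _ ht => length_le_of_mem_outputForm hF hc ht).symm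

/-! ### Tuples of moves -/

theorem ParamComputable.iterate {σ : Type} [TreeEnc σ] {step : σ → σ} (hstep : PolyTime step)
    (s : σ) {S : ℕ → ℕ} (hS : Computable S)
    (hb : ∀ k, ∀ i ≤ k, encSize (step^[i] s) ≤ S k) :
    ParamComputable fun k => step^[k] s := by
  have hstep' : PolyTime fun p : Unit × σ × Unit => step p.2.1 := by fun_prop
  obtain ⟨p, T, hp, ⟨c, hT⟩, -⟩ := hstep'
  obtain ⟨q, u, hq⟩ := exists_runs_const (enc s)
  refine ⟨.seq (.cons .id (.cons .nil q)) (.seq (foldProg p) (.seq .tl .tl)),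
    fun k => k * ((S k + 5) ^ c + 25) + S k + (u + 12), ?_, fun k => ?_⟩
  · exact computable_add (computable_add (computable_mul .id (computable_add
      (computable_pow (computable_add hS (.const 5)) (.const c)) (.const 25))) hS) (.const _)
  obtain ⟨t, ht, hr⟩ := runs_foldProg (p := p) (e := .nil) (B := (S k + 5) ^ c)
    (step := fun s (_ : Unit) => step s) (List.replicate k ()) s fun l₁ b l₂ hl => by
      refine ⟨_, (hT _).trans (Nat.pow_le_pow_left ?_ _), hp ((), _, b)⟩
      have hlen := congrArg List.length hl
      rw [List.length_replicate, List.length_append, List.length_cons] at hlen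
      have hsize := hb k l₁.length (by omega)
      have hunit : encSize () = 1 := rfl
      rw [List.foldl_const, encSize_pair, encSize_pair, hunit]
      omega
  rw [List.foldl_const, List.length_replicate, ← enc_nat_eq_enc_replicate] at hr
  rw [List.length_replicate] at ht
  refine ⟨_, .seq (.cons (.id _) (.cons (.nil _) (hq _))) (.seq hr (.seq (.tl _) (.tl _))), ?_⟩
  have hsize := hb k k le_rfl
  beta_reduce
  omega

/-- One step of the iteration that produces the lists of moves: all extensions of the given lists
by one of the codes `0`, `1`, `2` of the three moves. -/
def consMoves (T : List (List ℕ)) : List (List ℕ) :=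
  [0, 1, 2].flatMap fun x => T.map (x :: ·)

theorem iterate_consMoves (k : ℕ) : consMoves^[k] [[]] = tuples k [0, 1, 2] := by
  induction k with
  | zero => rfl
  | succ k ih => rw [Function.iterate_succ_apply', ih]; rfl

theorem encSize_moveTuples_le (k : ℕ) :
    encSize (tuples k [0, 1, 2]) ≤ 3 ^ k * (k * 6 + 2) + 1 := by
  have hentry : ∀ x ∈ [0, 1, 2], encSize x ≤ 5 := by decide
  have htuple : ∀ l ∈ tuples k [0, 1, 2], encSize l ≤ k * 6 + 1 := fun l hl => by
    obtain ⟨hlen, hmem⟩ := mem_tuples.1 hl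
    simpa only [hlen] using encSize_list_le l fun x hx => hentry x (hmem x hx)
  exact (encSize_list_le _ htuple).trans_eq (by rw [length_tuples]; rfl)

theorem paramComputable_moveTuples : ParamComputable fun k => tuples k [0, 1, 2] := by
  simp only [← iterate_consMoves]
  refine .iterate (S := fun k => 3 ^ k * (k * 6 + 2) + 1) (by unfold consMoves; fun_prop) _
    (computable_add (computable_mul (computable_pow (.const 3) .id)
      (computable_add (computable_mul .id (.const 6)) (.const 2))) (.const 1)) fun k i hi => ?_
  rw [iterate_consMoves]
  refine (encSize_moveTuples_le i).trans ?_
  gcongr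
  norm_num

/-! ### Runs of blind machines -/

namespace BlindNTM

variable (M : BlindNTM)

/-- The transition that does nothing in the state `q`. -/
def idle (q : Fin M.states) : Transition M.tapes M.symbols M.states where
  read _ := none
  src := q
  write _ := none
  tgt := q
  move _ := 0

/-- The transitions of the machine, and idle transitions in the accepting states. With them, a
computation of at most `k` steps that accepts can be extended to one of exactly `k` steps. -/
def deltaIdle : List (Transition M.tapes M.symbols M.states) :=
  M.delta ++ ((List.finRange M.states).filter M.accepting).map M.idle

/-- The configuration reached from `c` by the transitions `d 0, …, d (n - 1)`, whether or not these
are applicable. -/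
def conf (c : M.Config) (d : ℕ → Transition M.tapes M.symbols M.states) : ℕ → M.Config
  | 0 => c
  | n + 1 => M.apply (d n) (conf c d n)

/-- The transitions `d 0, …, d (n - 1)` belong to `D` and can be applied in turn, from `c` on. -/
def IsRun (D : List (Transition M.tapes M.symbols M.states)) (c : M.Config)
    (d : ℕ → Transition M.tapes M.symbols M.states) (n : ℕ) : Prop :=
  ∀ i < n, d i ∈ D ∧ M.Applicable (d i) (M.conf c d i)

variable {M} {D : List (Transition M.tapes M.symbols M.states)} {c c' : M.Config}
  {d d' : ℕ → Transition M.tapes M.symbols M.states} {δ : Transition M.tapes M.symbols M.states}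
  {n k : ℕ}

theorem mem_deltaIdle :
    δ ∈ M.deltaIdle ↔ δ ∈ M.delta ∨ ∃ q, M.accepting q = true ∧ M.idle q = δ := by
  simp only [deltaIdle, List.mem_append, List.mem_map, List.mem_filter, List.mem_finRange, true_and]

theorem applicable_idle (c : M.Config) : M.Applicable (M.idle c.state) c :=
  ⟨rfl, fun _ => .inl rfl⟩

theorem apply_idle (c : M.Config) : M.apply (M.idle c.state) c = c := by
  obtain ⟨q, h, x⟩ := c
  simp only [apply, idle, SignType.coe_zero, add_zero, Option.getD_none, Function.update_eq_self]

theorem conf_congr (h : ∀ i < n, d i = d' i) : M.conf c d n = M.conf c d' n := by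
  induction n with
  | zero => rfl
  | succ n ih => rw [conf, conf, ih fun i hi => h i (by omega), h n n.lt_succ_self]

theorem IsRun.exists_snoc (h : M.IsRun D c d n) (hδ : δ ∈ D)
    (happ : M.Applicable δ (M.conf c d n)) :
    ∃ d', M.IsRun D c d' (n + 1) ∧ d' n = δ ∧ M.conf c d' (n + 1) = M.apply δ (M.conf c d n) := by
  have hself : Function.update d n δ n = δ := Function.update_self ..
  have hlt (i) (hi : i < n) : Function.update d n δ i = d i := Function.update_of_ne hi.ne ..
  have hconf (i) (hi : i ≤ n) : M.conf c (Function.update d n δ) i = M.conf c d i :=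
    conf_congr fun j hj => hlt j (by omega)
  refine ⟨Function.update d n δ, Nat.forall_lt_succ_right.2 ⟨fun i hi => ?_, ?_⟩, hself, ?_⟩
  · rw [hlt i hi, hconf i hi.le]
    exact h i hi
  · rw [hself, hconf n le_rfl]
    exact ⟨hδ, happ⟩
  · rw [conf, hself, hconf n le_rfl]

theorem Reach.exists_isRun (h : M.Reach n c c') :
    ∃ d, M.IsRun M.delta c d n ∧ M.conf c d n = c' := by
  induction n generalizing c' with
  | zero =>
    cases h with
    | refl => exact ⟨fun _ => M.idle c.state, fun _ hi => absurd hi (Nat.not_lt_zero _), rfl⟩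
  | succ n ih =>
    obtain ⟨c', hr, δ, hδ, happ, rfl⟩ := h.exists_snoc
    obtain ⟨d, hd, rfl⟩ := ih hr
    obtain ⟨d', hd', -, hconf⟩ := hd.exists_snoc hδ happ
    exact ⟨d', hd', hconf⟩

theorem Reach.exists_isRun_deltaIdle (h : M.Reach n c c') (hn : n ≤ k)
    (hacc : M.accepting c'.state = true) :
    ∃ d, M.IsRun M.deltaIdle c d k ∧ M.conf c d k = c' := by
  induction k, hn using Nat.le_induction with
  | base =>
    obtain ⟨d, hd, hconf⟩ := h.exists_isRun
    exact ⟨d, fun i hi => ⟨mem_deltaIdle.2 (.inl (hd i hi).1), (hd i hi).2⟩, hconf⟩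
  | succ k _ ih =>
    obtain ⟨d, hd, rfl⟩ := ih
    obtain ⟨d', hd', -, hconf⟩ :=
      hd.exists_snoc (mem_deltaIdle.2 (.inr ⟨_, hacc, rfl⟩)) (applicable_idle _)
    exact ⟨d', hd', hconf.trans (apply_idle _)⟩

theorem IsRun.exists_reach (h : M.IsRun M.deltaIdle c d n) :
    ∃ m ≤ n, M.Reach m c (M.conf c d n) := by
  induction n with
  | zero => exact ⟨0, le_rfl, .refl _⟩
  | succ n ih =>
    obtain ⟨m, hm, hr⟩ := ih fun i hi => h i (by omega)
    obtain ⟨hδ, happ⟩ := h n n.lt_succ_self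
    obtain hδ | ⟨q, -, hq⟩ := mem_deltaIdle.1 hδ
    · exact ⟨m + 1, by omega, hr.snoc ⟨d n, hδ, happ, rfl⟩⟩
    · obtain rfl : (M.conf c d n).state = q := by rw [happ.1, ← hq]; rfl
      refine ⟨m, by omega, ?_⟩
      rwa [conf, ← hq, apply_idle]

theorem acceptsWithin_iff_exists_isRun {w : List (Fin M.symbols)} :
    M.AcceptsWithin w k ↔
      ∃ d, M.IsRun M.deltaIdle (M.init w) d (k + 1) ∧ M.accepting (d k).src = true := by
  constructor
  · rintro ⟨n, hn, c, hr, hacc⟩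
    obtain ⟨d, hd, rfl⟩ := hr.exists_isRun_deltaIdle hn hacc
    obtain ⟨d', hd', hk, -⟩ :=
      hd.exists_snoc (mem_deltaIdle.2 (.inr ⟨_, hacc, rfl⟩)) (applicable_idle _)
    exact ⟨d', hd', hk ▸ hacc⟩
  · rintro ⟨d, hd, hacc⟩
    obtain ⟨n, hn, hr⟩ := IsRun.exists_reach fun i hi => hd i (Nat.lt_succ_of_lt hi)
    exact ⟨n, hn, _, hr, (hd k k.lt_succ_self).2.1 ▸ hacc⟩

variable (M) in
/-- When `d 0, d 1, …` are applied from `c` on, `d i` writes a symbol to the cell `x` of the tape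
`t`. -/
def Writes (c : M.Config) (d : ℕ → Transition M.tapes M.symbols M.states) (t : Fin M.tapes)
    (x : ℤ) (i : ℕ) : Prop :=
  (M.conf c d i).head t = x ∧ (d i).write t ≠ none

section Cell

variable {t : Fin M.tapes} {x : ℤ} {a : Fin M.symbols} {i j : ℕ}

theorem conf_succ_cell :
    (M.conf c d (i + 1)).cell t = Function.update ((M.conf c d i).cell t) ((M.conf c d i).head t)
      (((d i).write t).getD ((M.conf c d i).cell t ((M.conf c d i).head t))) := rfl

theorem conf_succ_cell_of_write_eq (hx : (M.conf c d i).head t = x) (ha : (d i).write t = some a) :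
    (M.conf c d (i + 1)).cell t x = a := by
  rw [conf_succ_cell, hx, ha, Function.update_self, Option.getD_some]

theorem conf_succ_cell_of_not_writes (h : ¬M.Writes c d t x i) :
    (M.conf c d (i + 1)).cell t x = (M.conf c d i).cell t x := by
  rw [conf_succ_cell]
  by_cases hx : (M.conf c d i).head t = x
  · rw [not_not.1 fun hw => h ⟨hx, hw⟩, Option.getD_none, Function.update_eq_self]
  · exact Function.update_of_ne (Ne.symm hx) ..

theorem conf_cell_eq_of_forall_not_writes (hji : j ≤ i)
    (h : ∀ p < i, j ≤ p → ¬M.Writes c d t x p) :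
    (M.conf c d i).cell t x = (M.conf c d j).cell t x := by
  induction i, hji using Nat.le_induction with
  | base => rfl
  | succ i hji ih =>
    rw [conf_succ_cell_of_not_writes (h i i.lt_succ_self hji), ih fun p hp => h p (by omega)]

theorem exists_last_writes (h : ∃ p < i, M.Writes c d t x p) :
    ∃ p < i, M.Writes c d t x p ∧ ∀ q < i, p < q → ¬M.Writes c d t x q := by
  classical
  obtain ⟨p, hp, hw⟩ := h
  refine ⟨Nat.findGreatest (M.Writes c d t x) (i - 1), ?_, Nat.findGreatest_spec (by omega) hw,
    fun q hq hlt => Nat.findGreatest_is_greatest hlt (by omega)⟩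
  exact (Nat.findGreatest_le _).trans_lt (by omega)

/-- The last write to the cell counts, or the initial symbol if there is none; the right-hand side
puts this as a conjunction of disjunctions, which will become clauses. -/
theorem conf_cell_eq_iff :
    (M.conf c d i).cell t x = a ↔
      (c.cell t x = a ∨ ∃ p < i, M.Writes c d t x p) ∧
      ∀ j < i, (M.Writes c d t x j → (d j).write t = some a) ∨
        ∃ p < i, j < p ∧ M.Writes c d t x p := by
  by_cases h : ∃ p < i, M.Writes c d t x p
  · obtain ⟨p, hp, hw, hlast⟩ := exists_last_writes h
    obtain ⟨b, hb⟩ := Option.ne_none_iff_exists'.1 hw.2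
    have hcell : (M.conf c d i).cell t x = b :=
      (conf_cell_eq_of_forall_not_writes hp hlast).trans (conf_succ_cell_of_write_eq hw.1 hb)
    rw [hcell]
    constructor
    · rintro rfl
      refine ⟨.inr h, fun j hj => ?_⟩
      obtain hjp | rfl | hpj := lt_trichotomy j p
      · exact .inr ⟨p, hp, hjp, hw⟩
      · exact .inl fun _ => hb
      · exact .inl fun hwj => absurd hwj (hlast j hj hpj)
    · rintro ⟨-, hwrite⟩
      obtain hpa | ⟨q, hq, hpq, hwq⟩ := hwrite p hp
      · exact Option.some.inj (hb.symm.trans (hpa hw))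
      · exact absurd hwq (hlast q hq hpq)
  · have hnot : ∀ p < i, ¬M.Writes c d t x p := by simpa only [not_exists, not_and] using h
    have hcell : (M.conf c d i).cell t x = c.cell t x :=
      conf_cell_eq_of_forall_not_writes i.zero_le fun p hp _ => hnot p hp
    rw [hcell]
    exact ⟨fun ha => ⟨.inl ha, fun j hj => .inl fun hw => absurd hw (hnot j hj)⟩,
      fun ha => ha.1.resolve_right h⟩

end Cell

end BlindNTM

/-! ### From blind machines to hitting sets -/

/-- The code of a symbol to be read or written; `0` stands for the neutral symbol. -/
def symCode {s : ℕ} : Option (Fin s) → ℕ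
  | none => 0
  | some a => a + 1

/-- The code of a move of a head. -/
def moveCode : SignType → ℕ
  | .zero => 0
  | .pos => 1
  | .neg => 2

theorem enc_symCode {s : ℕ} (o : Option (Fin s)) : enc (symCode o) = enc o := by
  cases o <;> rfl

theorem symCode_eq_zero {s : ℕ} {o : Option (Fin s)} : symCode o = 0 ↔ o = none := by
  cases o <;> simp [symCode]

theorem symCode_eq_succ {s : ℕ} {o : Option (Fin s)} {a : Fin s} :
    symCode o = a + 1 ↔ o = some a := by
  cases o <;> simp [symCode, Fin.ext_iff]

theorem enc_moveCode (v : SignType) : enc (moveCode v) = enc v := by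
  cases v <;> rfl

theorem moveCode_mem (v : SignType) : moveCode v ∈ [0, 1, 2] := by
  cases v <;> decide

/-- A transition as plain data: symbol codes to be read, source, symbol codes to be written, target
and move codes. It does not depend on the numbers of tapes, symbols and states, so that `PolyTime`
applies to functions of it. -/
abbrev RawTransition : Type := List ℕ × ℕ × List ℕ × ℕ × List ℕ

namespace RawTransition

abbrev readCode (δ : RawTransition) (t : ℕ) : ℕ := δ.1.getD t 0

abbrev source (δ : RawTransition) : ℕ := δ.2.1

abbrev writeCode (δ : RawTransition) (t : ℕ) : ℕ := δ.2.2.1.getD t 0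

abbrev target (δ : RawTransition) : ℕ := δ.2.2.2.1

abbrev tapeMove (δ : RawTransition) (t : ℕ) : ℕ := δ.2.2.2.2.getD t 0

/-- The transition of a machine with `m` tapes that does nothing in the state `q`. -/
def idle (m q : ℕ) : RawTransition :=
  ((List.range m).map fun _ => 0, q, (List.range m).map fun _ => 0, q,
    (List.range m).map fun _ => 0)

end RawTransition

/-- A machine with its input word as plain data: the numbers of tapes, symbols and states, the blank
symbol, the initial state, the accepting states, the transitions and the word. -/
abbrev RawMachine : Type :=
  (ℕ × ℕ × ℕ) × ℕ × ℕ × List Bool × List RawTransition × List ℕ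

namespace RawMachine

abbrev tapes (r : RawMachine) : ℕ := r.1.1

abbrev symbols (r : RawMachine) : ℕ := r.1.2.1

abbrev states (r : RawMachine) : ℕ := r.1.2.2

abbrev blank (r : RawMachine) : ℕ := r.2.1

abbrev start (r : RawMachine) : ℕ := r.2.2.1

abbrev accepting (r : RawMachine) (q : ℕ) : Bool := r.2.2.2.1.getD q false

abbrev delta (r : RawMachine) : List RawTransition := r.2.2.2.2.1

abbrev word (r : RawMachine) : List ℕ := r.2.2.2.2.2

end RawMachine

/-- The list of transitions with the idle transitions in the accepting states. -/
def rawDelta (r : RawMachine) : List RawTransition :=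
  r.delta ++ ((List.range r.states).filter fun q => r.accepting q).map
    fun q => RawTransition.idle r.tapes q

/-- The options for the transition number `i` of a run of length `k + 1`, the last transition of
which only serves to check that its source is accepting. -/
def runOptions (r : RawMachine) (k i : ℕ) : List RawTransition :=
  (rawDelta r).filter fun δ =>
    (!(i == 0) || δ.source == r.start) && (!(i == k) || r.accepting δ.source)

/-- The number of entries `v` of `μ` at the times from `i` on before `j`. -/
def countMoves (μ : List ℕ) (i j v : ℕ) : ℕ :=
  ((List.range j).filter fun p => Nat.ble i p && μ.getD p 0 == v).length

/-- With the moves in `μ`, the head is at the same cell at the times `i` and `j`: between them, it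
makes as many moves to the right as to the left. -/
def samePos (μ : List ℕ) (i j : ℕ) : Bool := countMoves μ i j 1 == countMoves μ i j 2

/-- The initial symbol of the cell of tape `t` that is reached at time `i` by the moves in `μ`. -/
def initSym (r : RawMachine) (t : ℕ) (μ : List ℕ) (i : ℕ) : ℕ :=
  bif t == 0 && Nat.ble (countMoves μ 0 i 2) (countMoves μ 0 i 1) then
    r.word.getD (countMoves μ 0 i 1 - countMoves μ 0 i 2) r.blank else r.blank

/-- The clauses: `.inl (i, q)` forces the transition `i + 1` to have the source `q` if `q` is the
target of the transition `i`. The clauses `.inr (t, i, μ, j, a)` force that, if the transition `i`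
reads `a` from tape `t` after the moves in `μ`, then `a` is there: for `j = 0`, a cell that has not
been written to must contain `a` initially, and for `j > 0`, a cell written to at time `j - 1`, but
not later, must have received `a`. -/
abbrev RunClause : Type := (ℕ × ℕ) ⊕ (ℕ × ℕ × List ℕ × ℕ × ℕ)

/-- The list of all clauses, where `E` lists the possible sequences of moves. -/
def runClauses (r : RawMachine) (k : ℕ) (E : List (List ℕ)) : List RunClause :=
  ((List.range k).flatMap fun i => (List.range r.states).map fun q => .inl (i, q)) ++
  (List.range r.tapes).flatMap fun t => (List.range (k + 1)).flatMap fun i => E.flatMap fun μ =>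
    (List.range (i + 1)).flatMap fun j => (List.range r.symbols).map fun a => .inr (t, i, μ, j, a)

/-- The transition `δ` at time `p` hits the clause `.inl (i, q)`. -/
def linkInc (p : ℕ) (δ : RawTransition) (i q : ℕ) : Bool :=
  (p == i && !(δ.target == q)) || (p == i + 1 && δ.source == q)

/-- The transition `δ` at time `p` hits the clause `.inr (t, i, μ, j, a)`. -/
def readInc (r : RawMachine) (p : ℕ) (δ : RawTransition) (t i : ℕ) (μ : List ℕ) (j a : ℕ) : Bool :=
  (Nat.blt p i && !(δ.tapeMove t == μ.getD p 0)) ||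
  ((p == i && !(δ.readCode t == a + 1)) ||
  ((Nat.blt p i && (Nat.ble j p && (samePos μ p i && !(δ.writeCode t == 0)))) ||
  bif j == 0 then initSym r t μ i == a else
    !samePos μ (j - 1) i || (p == j - 1 && (δ.writeCode t == 0 || δ.writeCode t == a + 1))))

/-- The transition `δ` at time `p` hits the clause `c`. -/
def runInc (r : RawMachine) (p : ℕ) (δ : RawTransition) (c : RunClause) : Bool :=
  Sum.elim (fun q => linkInc p δ q.1 q.2)
    (fun q => readInc r p δ q.1 q.2.1 q.2.2.1 q.2.2.2.1 q.2.2.2.2) c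

/-- The hitting set instance of a machine: a slot for each of the times `0, …, k` chooses the
transition, and `E` lists the possible sequences of moves. -/
def runInstance (r : RawMachine) (k : ℕ) (E : List (List ℕ)) : ℕ × List (List (List Bool)) :=
  hitInstance (List.range (k + 1)) (runOptions r k) (runClauses r k E) (runInc r)

section PolyTime

variable {α : Type} [TreeEnc α] {r : α → RawMachine} {k p t i j a v : α → ℕ} {μ : α → List ℕ}
  {E : α → List (List ℕ)} {δ : α → RawTransition}

@[fun_prop]
theorem polyTime_runOptions (hr : PolyTime r) (hk : PolyTime k) (hi : PolyTime i) :
    PolyTime (fun x => runOptions (r x) (k x) (i x)) := by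
  unfold runOptions rawDelta RawTransition.idle
  fun_prop

@[fun_prop]
theorem polyTime_countMoves (hμ : PolyTime μ) (hi : PolyTime i) (hj : PolyTime j)
    (hv : PolyTime v) : PolyTime (fun x => countMoves (μ x) (i x) (j x) (v x)) := by
  unfold countMoves
  fun_prop

@[fun_prop]
theorem polyTime_runClauses (hr : PolyTime r) (hk : PolyTime k) (hE : PolyTime E) :
    PolyTime (fun x => runClauses (r x) (k x) (E x)) := by
  unfold runClauses
  fun_prop

@[fun_prop]
theorem polyTime_readInc (hr : PolyTime r) (hp : PolyTime p) (hδ : PolyTime δ) (ht : PolyTime t)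
    (hi : PolyTime i) (hμ : PolyTime μ) (hj : PolyTime j) (ha : PolyTime a) :
    PolyTime (fun x => readInc (r x) (p x) (δ x) (t x) (i x) (μ x) (j x) (a x)) := by
  unfold readInc initSym samePos
  fun_prop

@[fun_prop]
theorem polyTime_runInc {c : α → RunClause} (hr : PolyTime r) (hp : PolyTime p) (hδ : PolyTime δ)
    (hc : PolyTime c) : PolyTime (fun x => runInc (r x) (p x) (δ x) (c x)) := by
  unfold runInc linkInc
  fun_prop

@[fun_prop]
theorem polyTime_runInstance (hr : PolyTime r) (hk : PolyTime k) (hE : PolyTime E) :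
    PolyTime (fun x => runInstance (r x) (k x) (E x)) := by
  unfold runInstance hitInstance
  fun_prop

end PolyTime

theorem getD_ofFn {β : Type} {m : ℕ} (f : Fin m → β) (t : Fin m) (b : β) :
    (List.ofFn f).getD t b = f t := by
  rw [List.getD_eq_getElem _ _ (t.2.trans_eq (List.length_ofFn).symm), List.getElem_ofFn]

namespace Transition

variable {m s q : ℕ} (δ : Transition m s q)

/-- A transition as plain data. -/
def raw : RawTransition :=
  (List.ofFn fun t => symCode (δ.read t), δ.src, List.ofFn fun t => symCode (δ.write t), δ.tgt,
    List.ofFn fun t => moveCode (δ.move t))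

theorem enc_raw : enc δ.raw = enc δ :=
  enc_pair_congr (enc_fun_congr fun _ => enc_symCode _) (enc_pair_congr rfl
    (enc_pair_congr (enc_fun_congr fun _ => enc_symCode _) (enc_pair_congr rfl
      (enc_fun_congr fun _ => enc_moveCode _))))

theorem raw_readCode (t : Fin m) : δ.raw.readCode t = symCode (δ.read t) := getD_ofFn _ _ _

theorem raw_writeCode (t : Fin m) : δ.raw.writeCode t = symCode (δ.write t) := getD_ofFn _ _ _

theorem raw_tapeMove (t : Fin m) : δ.raw.tapeMove t = moveCode (δ.move t) := getD_ofFn _ _ _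

end Transition

theorem BlindNTM.idle_raw {M : BlindNTM} (q : Fin M.states) :
    (M.idle q).raw = RawTransition.idle M.tapes q := by
  simp only [RawTransition.idle, map_range_eq_ofFn]
  rfl

/-- A machine with its input word as plain data. -/
def BlindInstance.raw (I : BlindInstance) : RawMachine :=
  ((I.machine.tapes, I.machine.symbols, I.machine.states), I.machine.blank, I.machine.start,
    List.ofFn I.machine.accepting, I.machine.delta.map Transition.raw, I.word.map Fin.val)

@[fun_prop]
theorem polyTime_blindInstance_raw : PolyTime BlindInstance.raw :=
  .of_enc_eq fun I => congrArg₂ Val.cons rfl (enc_pair_congr rfl (enc_pair_congr rfl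
    (enc_pair_congr rfl (enc_pair_congr
      (enc_list_congr (by rw [List.map_map]; exact List.map_congr_left fun δ _ => δ.enc_raw))
      (enc_list_congr (by rw [List.map_map]; rfl))))))

theorem rawDelta_raw (I : BlindInstance) :
    rawDelta I.raw = I.machine.deltaIdle.map Transition.raw := by
  have haccepting : (fun q => I.raw.accepting q) ∘ Fin.val = I.machine.accepting :=
    funext fun q => getD_ofFn _ _ _
  have hstates : List.range I.raw.states = (List.finRange I.machine.states).map Fin.val :=
    List.map_coe_finRange_eq_range.symm
  rw [rawDelta, BlindNTM.deltaIdle, List.map_append, List.map_map, hstates, List.filter_map,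
    haccepting, List.map_map]
  exact congrArg _ (List.map_congr_left fun q _ => (BlindNTM.idle_raw q).symm)

section CountMoves

variable {μ : List ℕ} {i j v : ℕ}

theorem countMoves_self : countMoves μ i i v = 0 := by
  rw [countMoves, List.length_eq_zero_iff, List.filter_eq_nil_iff]
  intro p hp
  rw [Bool.and_eq_true, Nat.ble_eq]
  exact fun h => (List.mem_range.1 hp).not_ge h.1

theorem countMoves_succ (h : i ≤ j) :
    countMoves μ i (j + 1) v = countMoves μ i j v + if μ.getD j 0 = v then 1 else 0 := by
  rw [countMoves, countMoves, List.range_succ, List.filter_append, List.length_append,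
    List.filter_singleton, Nat.ble_eq_true_of_le h, Bool.true_and, Bool.cond_eq_ite,
    apply_ite List.length]
  simp only [beq_iff_eq, List.length_singleton, List.length_nil]

variable {M : BlindNTM} {c : M.Config} {d : ℕ → Transition M.tapes M.symbols M.states}
  {t : Fin M.tapes}

theorem head_eq_countMoves (h : i ≤ j) (hμ : ∀ p < j, moveCode ((d p).move t) = μ.getD p 0) :
    (M.conf c d j).head t = (M.conf c d i).head t + countMoves μ i j 1 - countMoves μ i j 2 := by
  induction j, h using Nat.le_induction with
  | base => simp only [countMoves_self, Nat.cast_zero, add_zero, sub_zero]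
  | succ j h ih =>
    have hhead : (M.conf c d (j + 1)).head t = (M.conf c d j).head t + ((d j).move t : ℤ) := rfl
    rw [hhead, ih fun p hp => hμ p (by omega), countMoves_succ h, countMoves_succ h,
      ← hμ j (by omega)]
    cases (d j).move t <;> simp [moveCode] <;> ring

theorem samePos_iff (h : i ≤ j) (hμ : ∀ p < j, moveCode ((d p).move t) = μ.getD p 0) :
    samePos μ i j = true ↔ (M.conf c d i).head t = (M.conf c d j).head t := by
  rw [head_eq_countMoves (c := c) h hμ, samePos, beq_iff_eq]
  omega

end CountMoves

section RunInstance

variable {I : BlindInstance} {d : ℕ → Transition I.machine.tapes I.machine.symbols I.machine.states}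
  {t : Fin I.machine.tapes} {μ : List ℕ} {a : Fin I.machine.symbols} {k i j p : ℕ}

theorem mem_runOptions {δ : RawTransition} :
    δ ∈ runOptions I.raw k i ↔ ∃ δ' ∈ I.machine.deltaIdle, δ'.raw = δ ∧
      (i = 0 → δ'.src = I.machine.start) ∧ (i = k → I.machine.accepting δ'.src = true) := by
  have hacc (δ' : Transition I.machine.tapes I.machine.symbols I.machine.states) :
      I.raw.accepting δ'.raw.source = I.machine.accepting δ'.src := getD_ofFn _ _ _
  have hstart (δ' : Transition I.machine.tapes I.machine.symbols I.machine.states) :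
      δ'.raw.source = I.raw.start ↔ δ'.src = I.machine.start := Fin.ext_iff.symm
  simp only [runOptions, rawDelta_raw, List.filter_map, List.mem_map, List.mem_filter,
    Function.comp_apply, hacc, Bool.and_eq_true, Bool.or_eq_true, Bool.not_eq_true',
    beq_eq_false_iff_ne, beq_iff_eq, hstart, imp_iff_not_or, ne_eq]
  exact exists_congr fun δ' => by tauto

theorem initSym_eq (hμ : ∀ p < i, moveCode ((d p).move t) = μ.getD p 0) :
    initSym I.raw t μ i = (I.machine.init I.word).cell t
      ((I.machine.conf (I.machine.init I.word) d i).head t) := by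
  have hhead : (I.machine.conf (I.machine.init I.word) d i).head t =
      0 + countMoves μ 0 i 1 - countMoves μ 0 i 2 :=
    head_eq_countMoves (c := I.machine.init I.word) i.zero_le hμ
  have hword (n : ℕ) : I.raw.word.getD n I.raw.blank = I.word.getD n I.machine.blank :=
    List.getD_map _ _ _
  rw [hhead, initSym, BlindNTM.init, apply_ite Fin.val, Bool.cond_eq_ite, hword]
  refine if_congr ?_ (congrArg (fun n => (I.word.getD n _).val) (by omega)) rfl
  rw [Bool.and_eq_true, beq_iff_eq, Nat.ble_eq]
  omega

theorem readInc_iff :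
    readInc I.raw p (d p).raw t i μ j a = true ↔
      (p < i ∧ moveCode ((d p).move t) ≠ μ.getD p 0) ∨
      (p = i ∧ (d p).read t ≠ some a) ∨
      (p < i ∧ j ≤ p ∧ samePos μ p i = true ∧ (d p).write t ≠ none) ∨
      if j = 0 then initSym I.raw t μ i = a else ¬samePos μ (j - 1) i = true ∨
        (p = j - 1 ∧ ((d p).write t = none ∨ (d p).write t = some a)) := by
  rw [readInc, Transition.raw_readCode, Transition.raw_writeCode, Transition.raw_tapeMove]
  simp only [Bool.or_eq_true, Bool.and_eq_true, nat_blt_iff, Bool.not_eq_true',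
    beq_eq_false_iff_ne, beq_iff_eq, Nat.ble_eq, ne_eq, symCode_eq_zero, symCode_eq_succ,
    Bool.cond_eq_ite]
  split_ifs <;> simp only [Bool.or_eq_true, Bool.and_eq_true, Bool.not_eq_true', beq_iff_eq,
    symCode_eq_zero, symCode_eq_succ, Bool.not_eq_true]

theorem exists_readInc_zero_iff (hi : i ≤ k)
    (hμ : ∀ p < i, moveCode ((d p).move t) = μ.getD p 0) (ha : (d i).read t = some a) :
    (∃ p ≤ k, readInc I.raw p (d p).raw t i μ 0 a = true) ↔
      (I.machine.init I.word).cell t ((I.machine.conf (I.machine.init I.word) d i).head t) = a ∨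
      ∃ p < i, I.machine.Writes (I.machine.init I.word) d t
        ((I.machine.conf (I.machine.init I.word) d i).head t) p := by
  simp only [readInc_iff, if_true, initSym_eq hμ, ← Fin.ext_iff]
  constructor
  · rintro ⟨p, -, ⟨hp, hne⟩ | ⟨rfl, hne⟩ | ⟨hp, -, hsame, hw⟩ | hinit⟩
    · exact absurd (hμ p hp) hne
    · exact absurd ha hne
    · exact .inr ⟨p, hp, (samePos_iff hp.le hμ).1 hsame, hw⟩
    · exact .inl hinit
  · rintro (hinit | ⟨p, hp, hsame, hw⟩)
    · exact ⟨i, hi, .inr (.inr (.inr hinit))⟩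
    · exact ⟨p, hp.le.trans hi,
        .inr (.inr (.inl ⟨hp, p.zero_le, (samePos_iff hp.le hμ).2 hsame, hw⟩))⟩

theorem exists_readInc_succ_iff (hi : i ≤ k)
    (hμ : ∀ p < i, moveCode ((d p).move t) = μ.getD p 0) (ha : (d i).read t = some a)
    (hj : j < i) :
    (∃ p ≤ k, readInc I.raw p (d p).raw t i μ (j + 1) a = true) ↔
      (I.machine.Writes (I.machine.init I.word) d t
          ((I.machine.conf (I.machine.init I.word) d i).head t) j → (d j).write t = some a) ∨
      ∃ p < i, j < p ∧ I.machine.Writes (I.machine.init I.word) d t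
        ((I.machine.conf (I.machine.init I.word) d i).head t) p := by
  simp only [readInc_iff, Nat.succ_ne_zero, if_false, Nat.add_sub_cancel]
  constructor
  · rintro ⟨p, -, ⟨hp, hne⟩ | ⟨rfl, hne⟩ | ⟨hp, hjp, hsame, hw⟩ | hne | ⟨rfl, hw⟩⟩
    · exact absurd (hμ p hp) hne
    · exact absurd ha hne
    · exact .inr ⟨p, hp, hjp, (samePos_iff hp.le hμ).1 hsame, hw⟩
    · exact .inl fun hw => absurd ((samePos_iff hj.le hμ).2 hw.1) hne
    · exact .inl fun hw' => hw.resolve_left hw'.2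
  · rintro (hwrite | ⟨p, hp, hjp, hsame, hw⟩)
    · by_cases hw : (d j).write t = none
      · exact ⟨j, hj.le.trans hi, .inr (.inr (.inr (.inr ⟨rfl, .inl hw⟩)))⟩
      by_cases hsame : samePos μ j i = true
      · exact ⟨j, hj.le.trans hi, .inr (.inr (.inr (.inr
          ⟨rfl, .inr (hwrite ⟨(samePos_iff hj.le hμ).1 hsame, hw⟩)⟩)))⟩
      · exact ⟨i, hi, .inr (.inr (.inr (.inl hsame)))⟩
    · exact ⟨p, hp.le.trans hi,
        .inr (.inr (.inl ⟨hp, hjp, (samePos_iff hp.le hμ).2 hsame, hw⟩))⟩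

theorem forall_exists_readInc_iff (hi : i ≤ k)
    (hμ : ∀ p < i, moveCode ((d p).move t) = μ.getD p 0) (ha : (d i).read t = some a) :
    (∀ j ≤ i, ∃ p ≤ k, readInc I.raw p (d p).raw t i μ j a = true) ↔
      (I.machine.conf (I.machine.init I.word) d i).cell t
        ((I.machine.conf (I.machine.init I.word) d i).head t) = a := by
  rw [BlindNTM.conf_cell_eq_iff, ← exists_readInc_zero_iff hi hμ ha]
  constructor
  · exact fun h =>
      ⟨h 0 i.zero_le, fun j hj => (exists_readInc_succ_iff hi hμ ha hj).1 (h (j + 1) hj)⟩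
  · rintro ⟨hzero, hsucc⟩ (- | j) hj
    · exact hzero
    · exact (exists_readInc_succ_iff hi hμ ha hj).2 (hsucc j hj)

theorem forall_exists_linkInc_iff :
    (∀ i < k, ∀ q < I.machine.states, ∃ p ≤ k, linkInc p (d p).raw i q = true) ↔
      ∀ i < k, (d i).tgt = (d (i + 1)).src := by
  simp only [linkInc, Transition.raw, Bool.or_eq_true, Bool.and_eq_true, Bool.not_eq_true',
    beq_eq_false_iff_ne, beq_iff_eq]
  constructor
  · intro h i hi
    obtain ⟨p, -, ⟨rfl, hne⟩ | ⟨rfl, hsrc⟩⟩ := h i hi (d i).tgt (d i).tgt.2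
    · exact absurd rfl hne
    · exact Fin.ext hsrc.symm
  · intro h i hi q _
    by_cases hq : (d i).tgt.val = q
    · exact ⟨i + 1, hi, .inr ⟨rfl, h i hi ▸ hq⟩⟩
    · exact ⟨i, hi.le, .inl ⟨rfl, hq⟩⟩

theorem forall_mem_runClauses {r : RawMachine} {E : List (List ℕ)} {P : RunClause → Prop} :
    (∀ c ∈ runClauses r k E, P c) ↔
      (∀ i < k, ∀ q < r.states, P (.inl (i, q))) ∧
      ∀ t < r.tapes, ∀ i ≤ k, ∀ μ ∈ E, ∀ j ≤ i, ∀ a < r.symbols, P (.inr (t, i, μ, j, a)) := by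
  simp only [runClauses, List.forall_mem_append, List.forall_mem_flatMap, List.forall_mem_map,
    List.mem_range, Nat.lt_succ_iff]

theorem forall_exists_runInc_iff {E : List (List ℕ)} :
    (∀ c ∈ runClauses I.raw k E, ∃ p ≤ k, runInc I.raw p (d p).raw c = true) ↔
      (∀ i < k, (d i).tgt = (d (i + 1)).src) ∧
      ∀ (t : Fin I.machine.tapes), ∀ i ≤ k, ∀ μ ∈ E, ∀ j ≤ i, ∀ a : Fin I.machine.symbols,
        ∃ p ≤ k, readInc I.raw p (d p).raw t i μ j a = true := by
  rw [forall_mem_runClauses, ← forall_exists_linkInc_iff]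
  exact and_congr_right' ⟨fun h t i hi μ hμ j hj a => h t t.2 i hi μ hμ j hj a a.2,
    fun h t ht i hi μ hμ j hj a ha => h ⟨t, ht⟩ i hi μ hμ j hj ⟨a, ha⟩⟩

theorem exists_mem_tuples_moveCode (d : ℕ → Transition I.machine.tapes I.machine.symbols
    I.machine.states) (t : Fin I.machine.tapes) (k : ℕ) :
    ∃ μ ∈ tuples k [0, 1, 2], ∀ p < k, moveCode ((d p).move t) = μ.getD p 0 := by
  refine ⟨(List.range k).map fun p => moveCode ((d p).move t), mem_tuples.2 ⟨?_, ?_⟩,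
    fun p hp => ?_⟩
  · rw [List.length_map, List.length_range]
  · exact List.forall_mem_map.2 fun p _ => moveCode_mem _
  · rw [List.getD_eq_getElem _ _ (by simpa using hp), List.getElem_map, List.getElem_range]

theorem applicable_iff_forall_exists_runInc (hs : (d 0).src = I.machine.start) :
    (∀ i ≤ k, I.machine.Applicable (d i) (I.machine.conf (I.machine.init I.word) d i)) ↔
      ∀ c ∈ runClauses I.raw k (tuples k [0, 1, 2]),
        ∃ p ≤ k, runInc I.raw p (d p).raw c = true := by
  rw [forall_exists_runInc_iff]
  constructor
  · intro h
    refine ⟨fun i hi => (h (i + 1) hi).1, fun t i hi μ _ j hj a => ?_⟩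
    by_cases hμ : ∀ p < i, moveCode ((d p).move t) = μ.getD p 0
    · by_cases ha : (d i).read t = some a
      · refine (forall_exists_readInc_iff hi hμ ha).2 ?_ j hj
        have hread := (h i hi).2 t
        rw [ha] at hread
        exact (Option.some.inj (hread.resolve_left (Option.some_ne_none a))).symm
      · exact ⟨i, hi, readInc_iff.2 (.inr (.inl ⟨rfl, ha⟩))⟩
    · push Not at hμ
      obtain ⟨p, hp, hne⟩ := hμ
      exact ⟨p, hp.le.trans hi, readInc_iff.2 (.inl ⟨hp, hne⟩)⟩
  · rintro ⟨hlink, hread⟩ i hi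
    refine ⟨?_, fun t => or_iff_not_imp_left.2 fun hnone => ?_⟩
    · cases i with
      | zero => exact hs.symm
      | succ i => exact hlink i hi
    · obtain ⟨a, ha⟩ := Option.ne_none_iff_exists'.1 hnone
      obtain ⟨μ, hmem, hμ⟩ := exists_mem_tuples_moveCode d t k
      rw [(forall_exists_readInc_iff hi (fun p hp => hμ p (hp.trans_le hi)) ha).1
        fun j hj => hread t i hi μ hmem j hj a, ha]

theorem runInstance_yes_iff (I : BlindInstance) (k : ℕ) :
    I.machine.AcceptsWithin I.word k ↔
      ColoredHittingSet.Yes (runInstance I.raw k (tuples k [0, 1, 2])) (k + 1) := by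
  have hyes := hitInstance_yes_iff (List.nodup_range (n := k + 1)) (opts := runOptions I.raw k)
    (Cl := runClauses I.raw k (tuples k [0, 1, 2])) (inc := runInc I.raw)
  rw [List.length_range] at hyes
  rw [runInstance, hyes, BlindNTM.acceptsWithin_iff_exists_isRun]
  simp only [List.mem_range, Nat.lt_succ_iff]
  constructor
  · rintro ⟨d, hd, hacc⟩
    have hrun (i) (hi : i ≤ k) := hd i (Nat.lt_succ_of_le hi)
    have hs : (d 0).src = I.machine.start := (hrun 0 k.zero_le).2.1.symm
    exact ⟨fun i => (d i).raw, fun i hi => mem_runOptions.2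
      ⟨d i, (hrun i hi).1, rfl, fun h => h ▸ hs, fun h => h ▸ hacc⟩,
      (applicable_iff_forall_exists_runInc hs).1 fun i hi => (hrun i hi).2⟩
  · rintro ⟨f, hf, hhit⟩
    have : Nonempty (Transition I.machine.tapes I.machine.symbols I.machine.states) :=
      ⟨I.machine.idle I.machine.start⟩
    choose! d hd hraw hstart hacc using fun i hi => mem_runOptions.1 (hf i hi)
    refine ⟨d, fun i hi => ⟨hd i (Nat.le_of_lt_succ hi), ?_⟩, hacc k le_rfl rfl⟩
    refine (applicable_iff_forall_exists_runInc (hstart 0 k.zero_le rfl)).2 (fun c hc => ?_) i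
      (Nat.le_of_lt_succ hi)
    obtain ⟨p, hp, hinc⟩ := hhit c hc
    exact ⟨p, hp, (hraw p hp).symm ▸ hinc⟩

end RunInstance

theorem shortBlind_reducible_coloredHittingSet :
    FPTReducible ShortBlindMultiTapeNTM ColoredHittingSet := by
  have hR : PolyTime fun p : (BlindInstance × ℕ) × List (List ℕ) =>
      (runInstance p.1.1.raw p.1.2 p.2, p.1.2 + 1) := by
    fun_prop
  exact .of_paramComputable (A := ShortBlindMultiTapeNTM) (B := ColoredHittingSet)
    paramComputable_moveTuples hR (g := fun k => k + 1) Computable.succ (fun _ _ => le_rfl)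
    runInstance_yes_iff

end ParamW

theorem theorem1 : ParamW.WComplete 2 ParamW.ShortBlindMultiTapeNTM := by
  refine ⟨⟨2, ParamW.shortBlind_reducible_coloredHittingSet.trans
    ParamW.coloredHittingSet_reducible_circuitSat⟩, ?_⟩
  rintro A ⟨h, hA⟩
  exact (hA.trans (ParamW.circuitSat_reducible_coloredHittingSet h)).trans
    ParamW.coloredHittingSet_reducible_shortBlind
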